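/- **Special functions.** Write $(a)_n=a(a+1)\cdots(a+n-1)$, $[n]_\mu=n+(1-(-1)^n)\mu$, $[n]_\mu!=[1]_\mu\cdots[n]_\mu$, and let ${}_pF_q$ be the usual hypergeometric series. Let $L_k^{(\alpha)}(x)=\frac{(\alpha+1)_k}{k!}\,{}_1F_1(-k;\alpha+1;x)$ be the Laguerre polynomials. The Specialized Chihara polynomials are $$P_{2k}(\lambda;\mu,\gamma)=(-1)^k\sqrt{\tfrac{k!\,\Gamma(\mu+\frac12)}{\Gamma(k+\mu+\frac12)}}\,L_k^{(\mu-\frac12)}\!\left(\tfrac{\lambda^2-\gamma^2}{2}\right),\qquad P_{2k+1}(\lambda;\mu,\gamma)=(-1)^k\sqrt{\tfrac{k!\,\Gamma(\mu+\frac32)}{\Gamma(k+\mu+\frac32)}}\,\tfrac{\lambda-\gamma}{\sqrt{2\mu+1}}\,L_k^{(\mu+\frac12)}\!\left(\tfrac{\lambda^2-\gamma^2}{2}\right),$$ and $W(\lambda,\mu,\gamma)=\frac{1}{2\Gamma(\mu+\frac12)}\,\mathrm{sign}(\lambda)(\lambda+\gamma)\left(\frac{\lambda^2-\gamma^2}{2}\right)^{\mu-\frac12}e^{-(\lambda^2-\gamma^2)/2}$.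 The Big $-1$ Jacobi polynomials are, with $z=\frac{1-x^2}{1-c^2}$, $$J_n(x;a,b,c)={}_2F_1\!\left({-\frac n2,\frac{n+a+b+2}{2}\atop\frac{a+1}{2}};z\right)+\tfrac{n(1-x)}{(1+c)(a+1)}\,{}_2F_1\!\left({1-\frac n2,\frac{n+a+b+2}{2}\atop\frac{a+3}{2}};z\right)\quad(n\text{ even}),$$ $$J_n(x;a,b,c)={}_2F_1\!\left({-\frac{n-1}2,\frac{n+a+b+1}{2}\atop\frac{a+1}{2}};z\right)-\tfrac{(n+a+b+1)(1-x)}{(1+c)(a+1)}\,{}_2F_1\!\left({-\frac{n-1}2,\frac{n+a+b+3}{2}\atop\frac{a+3}{2}};z\right)\quad(n\text{ odd}),$$ and $$h_n(a,b)=\frac{2\,\Gamma(\frac{n+b+1}2)\Gamma(\frac{n+a+3}2)(\frac n2)!}{(n+a+1)\Gamma(\frac{n+a+b+2}2)(\frac{a+1}2)_{n/2}^2}\ (n\text{ even}),\qquad h_n(a,b)=\frac{(n+a+b+1)\Gamma(\frac{n+b+2}2)\Gamma(\frac{n+a+2}2)(\frac{n-1}2)!}{2\,\Gamma(\frac{n+a+b+3}2)(\frac{a+1}2)_{(n+1)/2}^2}\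 (n\text{ odd}).$$ The dual $-1$ Hahn polynomials are as follows, with $k=\lfloor n/2\rfloor$. For $N$ even put $\delta=-\frac{\eta+\xi+N}2$; then $R_n(x;\eta,\xi,N)$ equals $$16^{k}(-\tfrac N2)_{k}(\tfrac{1-2\eta-N}2)_{k}\;{}_3F_2\!\left({-k,\delta+\frac{x+1}4,\delta-\frac{x+1}4\atop-\frac N2,\frac{1-2\eta-N}2};1\right)\quad(n\text{ even}),$$ $$16^{k}(1-\tfrac N2)_{k}(\tfrac{1-2\eta-N}2)_{k}(x+2\eta+2\xi+1)\;{}_3F_2\!\left({-k,\delta+\frac{x+1}4,\delta-\frac{x+1}4\atop1-\frac N2,\frac{1-2\eta-N}2};1\right)\quad(n\text{ odd}).$$ For $N$ odd put $\delta=\frac{\eta+\xi+1}2$; then $R_n(x;\eta,\xi,N)$ equals $$16^{k}(\tfrac{1-N}2)_{k}(\tfrac{2\xi+1}2)_{k}\;{}_3F_2\!\left({-k,\delta+\frac{x+1}4,\delta-\frac{x+1}4\atop\frac{1-N}2,\frac{2\xi+1}2};1\right)\quad(n\text{ even}),$$ $$16^{k}(\tfrac{1-N}2)_{k}(\tfrac{2\xi+3}2)_{k}(x+2\xi-2\eta+1)\;{}_3F_2\!\left({-k,\delta+\frac{x+1}4,\delta-\frac{x+1}4\atop\frac{1-N}2,\frac{2\xi+3}2};1\right)\quad(n\text{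 odd}).$$ Put $z_s=(-1)^{s+N+1}(2s+2\eta+2\xi+1)$. With $k=\lfloor s/2\rfloor$ and $p=s-2k$, put $$\varpi_s(\eta,\xi,N)=\begin{cases}(-1)^k\dfrac{(-\frac N2)_{k+p}\,(-\frac N2-\eta+\frac12)_k\,(-N-\eta-\xi)_k}{k!\,(-\frac N2-\xi+\frac12)_k\,(-\frac N2-\eta-\xi)_{k+p}},&N\text{ even},\\[2ex](-1)^k\dfrac{(\frac{1-N}2)_k\,(\xi+\frac12)_{k+p}\,(\eta+\xi+1)_k}{k!\,(\eta+\frac12)_{k+p}\,(\frac{N+3}2+\eta+\xi)_k},&N\text{ odd}.\end{cases}$$ For $N$ even put $\rho_s=\varpi_{N-s}$ and $\nu_0=\dfrac{(-N-\eta-\xi)_{N/2}}{(\frac{-N-2\xi+1}2)_{N/2}}$; for $N$ odd put $\rho_s=\varpi_s$ and $\nu_0=\dfrac{(\eta+\xi+1)_{(N+1)/2}}{(\eta+\frac12)_{(N+1)/2}}$. **Coupling.** Let $\mu_1,\mu_2,\mu_3>0$, $\epsilon_1,\epsilon_2,\epsilon_3\in\{1,-1\}$ and $c\in\mathbb R$.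 For two pairs $(\mu_a,\epsilon_a),(\mu_b,\epsilon_b)$ and $j\ge0$ let $\mu_{ab}=\mu_a+\mu_b+j+\frac12$ and $\epsilon_{ab}=\epsilon_a\epsilon_b(-1)^j$. For $N+j=n_a+n_b$ the $\mathfrak{osp}(1|2)$ Clebsch–Gordan coefficients are, with $M=n_a+n_b$, $$C_{n_a,n_b}^{N,j}=(-1)^{\frac{n_a(n_a-1)}2+\frac{j(j+1)}2+n_a(M+1)}\left(\frac{\epsilon_b}2\right)^{n_a}\sqrt{\frac{[n_b]_{\mu_b}!\,\rho_j(\mu_b,\mu_a,M)}{[n_a]_{\mu_a}!\,[M]_{\mu_b}!\,\nu_0(\mu_b,\mu_a,M)}}\;R_{n_a}(z_j;\mu_b,\mu_a,M),$$ where $z_j$ is formed with the parameters $(\mu_b,\mu_a,M)$. Put $$K_j(\lambda;\mu_b,\mu_a;c)=\mathrm{sign}(\lambda)^j\sqrt{\left(\frac{\lambda^2-c^2}2\right)^j\,\frac{\lambda-c\epsilon_a\epsilon_b}{\lambda-(-1)^jc\epsilon_a\epsilon_b}\,\frac{\Gamma(\mu_a+\frac12)\Gamma(\mu_b+\frac12)}{\Gamma(\mu_{ab}+\frac12)\,h_j(2\mu_b,2\mu_a)}}.$$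 Let $j_{123}=j_{(12)3}+j_{12}=j_{1(23)}+j_{23}$ with all of these integers $\ge0$. Here $(\mu_{12},\epsilon_{12})$ and $(\mu_{23},\epsilon_{23})$ are formed with $j_{12}$ and $j_{23}$, and $\mu_{123}=\mu_1+\mu_2+\mu_3+1+j_{123}$, $\epsilon_{123}=\epsilon_1\epsilon_2\epsilon_3(-1)^{j_{123}}$. In $\ell^2(\mathbb Z_+)\otimes\ell^2(\mathbb Z_+)\otimes\ell^2(\mathbb Z_+)$, with orthonormal basis $e_{n_1}\otimes e_{n_2}\otimes e_{n_3}$, define for $n_{123}\ge0$ $$f_{n_{123}}^{j_{123},j_{12}}=\sum_{n_{12}+n_3=n_{123}+j_{(12)3}}\ \sum_{n_1+n_2=n_{12}+j_{12}}C_{n_{12},n_3}^{n_{123},j_{(12)3}}\,C_{n_1,n_2}^{n_{12},j_{12}}\ e_{n_1}\otimes e_{n_2}\otimes e_{n_3},$$ $$g_{n_{123}}^{j_{123},j_{23}}=\sum_{n_1+n_{23}=n_{123}+j_{1(23)}}\ \sum_{n_2+n_3=n_{23}+j_{23}}C_{n_1,n_{23}}^{n_{123},j_{1(23)}}\,C_{n_2,n_3}^{n_{23},j_{23}}\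 e_{n_1}\otimes e_{n_2}\otimes e_{n_3}.$$ **The operator.** Let $G=\{(\lambda_1,\lambda_2,\lambda_3)\in\mathbb R^3:|\lambda_3|>|\lambda_2|>|\lambda_1|>|c|\}$ and $W^{(3)}=W(\lambda_1,\mu_1,c\epsilon_1)W(\lambda_2,\mu_2,\lambda_1\epsilon_2)W(\lambda_3,\mu_3,\lambda_2\epsilon_3)$, and let $\Theta$ be the linear isometry from $\ell^2(\mathbb Z_+)^{\otimes3}$ to $L^2(G,W^{(3)})$ with $$\Theta(e_{n_1}\otimes e_{n_2}\otimes e_{n_3})=P_{n_1}(\lambda_1;\mu_1,c\epsilon_1)\,P_{n_2}(\lambda_2;\mu_2,\lambda_1\epsilon_2)\,P_{n_3}(\lambda_3;\mu_3,\lambda_2\epsilon_3).$$ **Proposition 6.** In $L^2(G,W^{(3)})$, for all $n_{123}\ge0$ and all indices $j$ as above, $$\begin{aligned}\Theta f_{n_{123}}^{j_{123},j_{12}}={}&K_{j_{12}}(\lambda_2;\mu_2,\mu_1;c)\,J_{j_{12}}\!\left(\tfrac{\epsilon_2\lambda_1}{\lambda_2};2\mu_2,2\mu_1,-\tfrac{c\epsilon_1\epsilon_2}{\lambda_2}\right)\\&\times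 K_{j_{(12)3}}(\lambda_3;\mu_3,\mu_{12};c)\,J_{j_{(12)3}}\!\left(\tfrac{\epsilon_3\lambda_2}{\lambda_3};2\mu_3,2\mu_{12},-\tfrac{c\epsilon_{12}\epsilon_3}{\lambda_3}\right)P_{n_{123}}(\lambda_3;\mu_{123},c\epsilon_{123}),\end{aligned}$$ $$\begin{aligned}\Theta g_{n_{123}}^{j_{123},j_{23}}={}&K_{j_{23}}(\lambda_3;\mu_3,\mu_2;\lambda_1)\,J_{j_{23}}\!\left(\tfrac{\epsilon_3\lambda_2}{\lambda_3};2\mu_3,2\mu_2,-\tfrac{\lambda_1\epsilon_2\epsilon_3}{\lambda_3}\right)\\&\times K_{j_{1(23)}}(\lambda_3;\mu_{23},\mu_1;c)\,J_{j_{1(23)}}\!\left(\tfrac{\epsilon_{23}\lambda_1}{\lambda_3};2\mu_{23},2\mu_1,-\tfrac{c\epsilon_1\epsilon_{23}}{\lambda_3}\right)P_{n_{123}}(\lambda_3;\mu_{123},c\epsilon_{123}).\end{aligned}$$ -/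

import Mathlib

open MeasureTheory

namespace Osp12

noncomputable section

/-! ### Special functions -/

/-- The Pochhammer symbol `(a)_n = a (a + 1) ⋯ (a + n - 1)`. -/
def poch (a : ℝ) (n : ℕ) : ℝ := (ascPochhammer ℝ n).eval a

/-- The generalized hypergeometric series `pFq(as; bs; x)`. -/
def pFq (as bs : List ℝ) (x : ℝ) : ℝ :=
  ∑' k : ℕ, (as.map fun a => poch a k).prod / (bs.map fun b => poch b k).prod
    * (x ^ k / (k.factorial : ℝ))

/-- The Laguerre polynomial `L_n^{(α)}(x)`. -/
def laguerre (n : ℕ) (α x : ℝ) : ℝ :=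
  poch (α + 1) n / (n.factorial : ℝ) * pFq [-(n : ℝ)] [α + 1] x

/-- The `μ`-number `[n]_μ = n + (1 - (-1)^n) μ`. -/
def muNumber (n : ℕ) (μ : ℝ) : ℝ := n + (1 - (-1) ^ n) * μ

/-- The `μ`-factorial `[n]_μ! = [1]_μ [2]_μ ⋯ [n]_μ`. -/
def muFactorial (n : ℕ) (μ : ℝ) : ℝ := ∏ i ∈ Finset.range n, muNumber (i + 1) μ

/-- The Specialized Chihara polynomial `P_n(x; μ, γ)`. -/
def chihara (n : ℕ) (x μ γ : ℝ) : ℝ :=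
  let k := n / 2
  if Even n then
    (-1) ^ k * √((k.factorial : ℝ) * Real.Gamma (μ + 1 / 2) / Real.Gamma (k + μ + 1 / 2))
      * laguerre k (μ - 1 / 2) ((x ^ 2 - γ ^ 2) / 2)
  else
    (-1) ^ k * √((k.factorial : ℝ) * Real.Gamma (μ + 3 / 2) / Real.Gamma (k + μ + 3 / 2))
      * ((x - γ) / √(2 * μ + 1)) * laguerre k (μ + 1 / 2) ((x ^ 2 - γ ^ 2) / 2)

/-- The weight `w(x, μ, γ)` of the Specialized Chihara polynomials (on `|x| > |γ|`). -/
def chiharaWeight (x μ γ : ℝ) : ℝ :=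
  Real.sign x * (x + γ) * ((x ^ 2 - γ ^ 2) / 2) ^ (μ - 1 / 2) * Real.exp (-((x ^ 2 - γ ^ 2) / 2))

/-- The normalized weight `W(x, μ, γ) = w(x, μ, γ) / (2 Γ(μ + 1/2))`. -/
def normWeight (x μ γ : ℝ) : ℝ := chiharaWeight x μ γ / (2 * Real.Gamma (μ + 1 / 2))

/-- The Big -1 Jacobi polynomial `J_n(x; a, b, c)`. -/
def bigJacobi (n : ℕ) (x a b c : ℝ) : ℝ :=
  let z := (1 - x ^ 2) / (1 - c ^ 2)
  if Even n then
    ₂F₁ (-((n : ℝ) / 2)) ((n + a + b + 2) / 2) ((a + 1) / 2) z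
      + n * (1 - x) / ((1 + c) * (a + 1))
        * ₂F₁ (1 - (n : ℝ) / 2) ((n + a + b + 2) / 2) ((a + 3) / 2) z
  else
    ₂F₁ (-(((n : ℝ) - 1) / 2)) ((n + a + b + 1) / 2) ((a + 1) / 2) z
      - (n + a + b + 1) * (1 - x) / ((1 + c) * (a + 1))
        * ₂F₁ (-(((n : ℝ) - 1) / 2)) ((n + a + b + 3) / 2) ((a + 3) / 2) z

/-- The normalization factor `h_n(a, b)` of the Big -1 Jacobi polynomials. -/
def bigJacobiNorm (n : ℕ) (a b : ℝ) : ℝ :=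
  let k := n / 2
  if Even n then
    2 * Real.Gamma ((n + b + 1) / 2) * Real.Gamma ((n + a + 3) / 2) * (k.factorial : ℝ)
      / ((n + a + 1) * Real.Gamma ((n + a + b + 2) / 2) * poch ((a + 1) / 2) k ^ 2)
  else
    (n + a + b + 1) * Real.Gamma ((n + b + 2) / 2) * Real.Gamma ((n + a + 2) / 2)
      * (k.factorial : ℝ)
      / (2 * Real.Gamma ((n + a + b + 3) / 2) * poch ((a + 1) / 2) (k + 1) ^ 2)

/-- The dual -1 Hahn polynomial `R_n(x; η, ξ, N)`. -/
def dualHahn (n : ℕ) (x η ξ : ℝ) (N : ℕ) : ℝ :=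
  let k := n / 2
  if Even N then
    let δ := -((η + ξ + N) / 2)
    if Even n then
      16 ^ k * poch (-((N : ℝ) / 2)) k * poch ((1 - 2 * η - N) / 2) k
        * pFq [-(k : ℝ), δ + (x + 1) / 4, δ - (x + 1) / 4]
            [-((N : ℝ) / 2), (1 - 2 * η - N) / 2] 1
    else
      16 ^ k * poch (1 - (N : ℝ) / 2) k * poch ((1 - 2 * η - N) / 2) k * (x + 2 * η + 2 * ξ + 1)
        * pFq [-(k : ℝ), δ + (x + 1) / 4, δ - (x + 1) / 4]
            [1 - (N : ℝ) / 2, (1 - 2 * η - N) / 2] 1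
  else
    let δ := (η + ξ + 1) / 2
    if Even n then
      16 ^ k * poch ((1 - (N : ℝ)) / 2) k * poch ((2 * ξ + 1) / 2) k
        * pFq [-(k : ℝ), δ + (x + 1) / 4, δ - (x + 1) / 4]
            [(1 - (N : ℝ)) / 2, (2 * ξ + 1) / 2] 1
    else
      16 ^ k * poch ((1 - (N : ℝ)) / 2) k * poch ((2 * ξ + 3) / 2) k * (x + 2 * ξ - 2 * η + 1)
        * pFq [-(k : ℝ), δ + (x + 1) / 4, δ - (x + 1) / 4]
            [(1 - (N : ℝ)) / 2, (2 * ξ + 3) / 2] 1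

/-- The weights `ϖ_s(η, ξ, N)` of the dual -1 Hahn polynomials. -/
def dualHahnWeight (s : ℕ) (η ξ : ℝ) (N : ℕ) : ℝ :=
  let k := s / 2
  if Even N then
    if Even s then
      (-1) ^ k * (poch (-((N : ℝ) / 2)) k * poch (-((N : ℝ) / 2) - η + 1 / 2) k
          * poch (-(N : ℝ) - η - ξ) k)
        / ((k.factorial : ℝ) * poch (-((N : ℝ) / 2) - ξ + 1 / 2) k
          * poch (-((N : ℝ) / 2) - η - ξ) k)
    else
      (-1) ^ k * (poch (-((N : ℝ) / 2)) (k + 1) * poch (-((N : ℝ) / 2) - η + 1 / 2) k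
          * poch (-(N : ℝ) - η - ξ) k)
        / ((k.factorial : ℝ) * poch (-((N : ℝ) / 2) - ξ + 1 / 2) k
          * poch (-((N : ℝ) / 2) - η - ξ) (k + 1))
  else
    if Even s then
      (-1) ^ k * (poch ((1 - (N : ℝ)) / 2) k * poch (ξ + 1 / 2) k * poch (η + ξ + 1) k)
        / ((k.factorial : ℝ) * poch (η + 1 / 2) k * poch (((N : ℝ) + 3) / 2 + η + ξ) k)
    else
      (-1) ^ k * (poch ((1 - (N : ℝ)) / 2) k * poch (ξ + 1 / 2) (k + 1) * poch (η + ξ + 1) k)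
        / ((k.factorial : ℝ) * poch (η + 1 / 2) (k + 1) * poch (((N : ℝ) + 3) / 2 + η + ξ) k)

/-- The normalization factor `ν_0(η, ξ, N)` of the dual -1 Hahn polynomials. -/
def dualHahnNormZero (η ξ : ℝ) (N : ℕ) : ℝ :=
  if Even N then
    poch (-(N : ℝ) - η - ξ) (N / 2) / poch ((-(N : ℝ) - 2 * ξ + 1) / 2) (N / 2)
  else
    poch (η + ξ + 1) ((N + 1) / 2) / poch (η + 1 / 2) ((N + 1) / 2)

/-- The reordered grid points `z_s`. -/
def dualHahnGrid (s : ℕ) (η ξ : ℝ) (N : ℕ) : ℝ :=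
  (-1) ^ (s + N + 1) * (2 * s + 2 * η + 2 * ξ + 1)

/-- The reordered weights `ρ_s(η, ξ, N)`. -/
def dualHahnRho (s : ℕ) (η ξ : ℝ) (N : ℕ) : ℝ :=
  if Even N then dualHahnWeight (N - s) η ξ N else dualHahnWeight s η ξ N

/-! ### Positive discrete series and Clebsch-Gordan coefficients -/

/-- The labels `(μ, ε)`, `μ > 0`, `ε = ±1`, of the positive discrete series representations. -/
structure DiscreteSeries where
  mu : ℝ
  eps : ℝ
  mu_pos : 0 < mu
  eps_eq : eps = 1 ∨ eps = -1

/-- The labels `(μ₁ + μ₂ + j + 1/2, ε₁ ε₂ (-1)^j)` of the `j`-th irreducible component of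
`(μ₁, ε₁) ⊗ (μ₂, ε₂)`. -/
def couple (r₁ r₂ : DiscreteSeries) (j : ℕ) : DiscreteSeries where
  mu := r₁.mu + r₂.mu + j + 1 / 2
  eps := r₁.eps * r₂.eps * (-1) ^ j
  mu_pos := by have := r₁.mu_pos; have := r₂.mu_pos; positivity
  eps_eq := by
    rcases r₁.eps_eq with h₁ | h₁ <;> rcases r₂.eps_eq with h₂ | h₂ <;>
      rcases neg_one_pow_eq_or ℝ j with h | h <;> simp [h₁, h₂, h]

/-- The labels `(μ₁ + μ₂ + μ₃ + 1 + j, ε₁ ε₂ ε₃ (-1)^j)` of the irreducible components of the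
three-fold tensor product. -/
def triple (r₁ r₂ r₃ : DiscreteSeries) (j : ℕ) : DiscreteSeries where
  mu := r₁.mu + r₂.mu + r₃.mu + 1 + j
  eps := r₁.eps * r₂.eps * r₃.eps * (-1) ^ j
  mu_pos := by have := r₁.mu_pos; have := r₂.mu_pos; have := r₃.mu_pos; positivity
  eps_eq := by
    rcases r₁.eps_eq with h₁ | h₁ <;> rcases r₂.eps_eq with h₂ | h₂ <;>
      rcases r₃.eps_eq with h₃ | h₃ <;>
      rcases neg_one_pow_eq_or ℝ j with h | h <;> simp [h₁, h₂, h₃, h]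

/-- The Clebsch-Gordan coefficient `C_{n₁,n₂}^{N,j}` of `(μ₁, ε₁) ⊗ (μ₂, ε₂)`, for
`N + j = n₁ + n₂` (so that `N` need not be an argument). -/
def clebschGordan (r₁ r₂ : DiscreteSeries) (n₁ n₂ j : ℕ) : ℝ :=
  (-1) ^ (n₁ * (n₁ - 1) / 2 + j * (j + 1) / 2 + n₁ * (n₁ + n₂ + 1)) * (r₂.eps / 2) ^ n₁
    * √(muFactorial n₂ r₂.mu * dualHahnRho j r₂.mu r₁.mu (n₁ + n₂)
        / (muFactorial n₁ r₁.mu * muFactorial (n₁ + n₂) r₂.mu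
          * dualHahnNormZero r₂.mu r₁.mu (n₁ + n₂)))
    * dualHahn n₁ (dualHahnGrid j r₂.mu r₁.mu (n₁ + n₂)) r₂.mu r₁.mu (n₁ + n₂)

/-- The factor `K_j(x; μ₂, μ₁; c)` attached to `(μ₁, ε₁) ⊗ (μ₂, ε₂)`. The sign selects, for odd
`j`, the branch of the square root which is a polynomial in `x`, namely a positive multiple of
`(x - c ε₁ ε₂) (x ^ 2 - c ^ 2) ^ ((j - 1) / 2)`. -/
def kFactor (r₁ r₂ : DiscreteSeries) (j : ℕ) (x c : ℝ) : ℝ :=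
  Real.sign x ^ j
    * √(((x ^ 2 - c ^ 2) / 2) ^ j
        * ((x - c * r₁.eps * r₂.eps) / (x - (-1) ^ j * c * r₁.eps * r₂.eps))
        * (Real.Gamma (r₁.mu + 1 / 2) * Real.Gamma (r₂.mu + 1 / 2)
          / (Real.Gamma ((couple r₁ r₂ j).mu + 1 / 2) * bigJacobiNorm j (2 * r₂.mu) (2 * r₁.mu))))

/-! ### The Hilbert spaces and the coupled bases -/

/-- The Hilbert space `ℓ²(ℤ₊) ⊗ ℓ²(ℤ₊) ⊗ ℓ²(ℤ₊)`, realized as `ℓ²(ℤ₊³)`. -/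
abbrev TripleSpace : Type := lp (fun _ : ℕ × ℕ × ℕ => ℂ) 2

/-- The product basis vector `e_{n₁} ⊗ e_{n₂} ⊗ e_{n₃}`. -/
def basisVec (n₁ n₂ n₃ : ℕ) : TripleSpace := lp.single 2 (n₁, n₂, n₃) (1 : ℂ)

/-- The vector `f_n^{j,j₁₂}`, `j₁₂ ≤ j` (coupling first 1 with 2, then 12 with 3); here
`j₍₁₂₎₃ = j - j₁₂`. -/
def fVec (r₁ r₂ r₃ : DiscreteSeries) (n j j₁₂ : ℕ) : TripleSpace :=
  ∑ p ∈ Finset.HasAntidiagonal.antidiagonal (n + (j - j₁₂)), ∑ q ∈ Finset.HasAntidiagonal.antidiagonal (p.1 + j₁₂),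
    ((clebschGordan (couple r₁ r₂ j₁₂) r₃ p.1 p.2 (j - j₁₂)
      * clebschGordan r₁ r₂ q.1 q.2 j₁₂ : ℝ) : ℂ) • basisVec q.1 q.2 p.2

/-- The vector `g_n^{j,j₂₃}`, `j₂₃ ≤ j` (coupling first 2 with 3, then 1 with 23); here
`j₁₍₂₃₎ = j - j₂₃`. -/
def gVec (r₁ r₂ r₃ : DiscreteSeries) (n j j₂₃ : ℕ) : TripleSpace :=
  ∑ p ∈ Finset.HasAntidiagonal.antidiagonal (n + (j - j₂₃)), ∑ q ∈ Finset.HasAntidiagonal.antidiagonal (p.2 + j₂₃),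
    ((clebschGordan r₁ (couple r₂ r₃ j₂₃) p.1 p.2 (j - j₂₃)
      * clebschGordan r₂ r₃ q.1 q.2 j₂₃ : ℝ) : ℂ) • basisVec p.1 q.1 q.2

/-- The region `|x₃| > |x₂| > |x₁| > |c|`. -/
def region (c : ℝ) : Set (ℝ × ℝ × ℝ) :=
  {x | |c| < |x.1| ∧ |x.1| < |x.2.1| ∧ |x.2.1| < |x.2.2|}

/-- The weight `W(x₁, μ₁, c ε₁) W(x₂, μ₂, x₁ ε₂) W(x₃, μ₃, x₂ ε₃)`. -/
def tripleWeight (r₁ r₂ r₃ : DiscreteSeries) (c : ℝ) (x : ℝ × ℝ × ℝ) : ℝ :=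
  normWeight x.1 r₁.mu (c * r₁.eps) * normWeight x.2.1 r₂.mu (x.1 * r₂.eps)
    * normWeight x.2.2 r₃.mu (x.2.1 * r₃.eps)

/-- The weighted Lebesgue measure on the region. -/
def tripleMeasure (r₁ r₂ r₃ : DiscreteSeries) (c : ℝ) : Measure (ℝ × ℝ × ℝ) :=
  (volume.restrict (region c)).withDensity fun x => ENNReal.ofReal (tripleWeight r₁ r₂ r₃ c x)

/-- The function `P_{n₁}(x₁; μ₁, c ε₁) P_{n₂}(x₂; μ₂, x₁ ε₂) P_{n₃}(x₃; μ₃, x₂ ε₃)`. -/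
def triplePoly (r₁ r₂ r₃ : DiscreteSeries) (c : ℝ) (n : ℕ × ℕ × ℕ) (x : ℝ × ℝ × ℝ) : ℝ :=
  chihara n.1 x.1 r₁.mu (c * r₁.eps) * chihara n.2.1 x.2.1 r₂.mu (x.1 * r₂.eps)
    * chihara n.2.2 x.2.2 r₃.mu (x.2.1 * r₃.eps)

/-! ### Orthonormality of the product polynomials -/

section

open Set

/-- Laguerre polynomials as polynomials. -/
def lagPoly (n : ℕ) (α : ℝ) : Polynomial ℝ :=
  ∑ i ∈ Finset.range (n + 1),
    Polynomial.C (poch (α + 1) n / (n.factorial : ℝ) * ((-1) ^ i * (n.choose i : ℝ) / poch (α + 1) i))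
      * Polynomial.X ^ i

lemma poch_pos {a : ℝ} (ha : 0 < a) (n : ℕ) : 0 < poch a n := ascPochhammer_pos n a ha

lemma poch_neg (n i : ℕ) :
    poch (-(n : ℝ)) i / (i.factorial : ℝ) = (-1) ^ i * (n.choose i : ℝ) := by
  unfold poch
  rw [ascPochhammer_eval_neg_eq_descPochhammer, descPochhammer_eval_eq_descFactorial,
    Nat.descFactorial_eq_factorial_mul_choose]
  have : (i.factorial : ℝ) ≠ 0 := by positivity
  push_cast
  field_simp

lemma poch_add (a : ℝ) (i k : ℕ) : poch a (i + k) = poch a i * poch (a + i) k := by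
  unfold poch
  rw [← ascPochhammer_mul]
  simp [Polynomial.eval_comp]

lemma laguerre_eq (n : ℕ) (α x : ℝ) : laguerre n α x = (lagPoly n α).eval x := by
  unfold laguerre pFq lagPoly
  rw [tsum_eq_sum (s := Finset.range (n + 1))]
  · rw [Polynomial.eval_finsetSum, Finset.mul_sum]
    refine Finset.sum_congr rfl fun i _ => ?_
    simp only [List.map_cons, List.map_nil, List.prod_cons, List.prod_nil, mul_one,
      Polynomial.eval_mul, Polynomial.eval_C, Polynomial.eval_pow, Polynomial.eval_X]
    rw [← poch_neg]
    ring
  · intro i hi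
    have hi' : n < i := by simpa using hi
    have : poch (-(n : ℝ)) i = 0 := ascPochhammer_eval_neg_coe_nat_of_lt hi'
    simp [this]

lemma poch_gamma {s : ℝ} (hs : 0 < s) (k : ℕ) :
    Real.Gamma (s + k) = poch s k * Real.Gamma s := by
  induction k with
  | zero => simp [poch]
  | succ k ih =>
    have h : poch s (k + 1) = poch s k * (s + k) := by
      rw [poch_add]; simp [poch]
    rw [h, Nat.cast_succ, ← add_assoc, Real.Gamma_add_one (by positivity), ih]
    ring

/-- The weight of the Laguerre polynomials. -/
def lagW (α x : ℝ) : ℝ := x ^ α * Real.exp (-x)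

lemma lagW_pow {α : ℝ} (k : ℕ) {x : ℝ} (hx : x ∈ Ioi (0 : ℝ)) :
    x ^ k * lagW α x = Real.exp (-x) * x ^ (α + k + 1 - 1) := by
  have hx : 0 < x := hx
  rw [lagW, add_sub_cancel_right, Real.rpow_add hx, Real.rpow_natCast]
  ring

lemma int_pow {α : ℝ} (hα : -1 < α) (k : ℕ) :
    IntegrableOn (fun x => x ^ k * lagW α x) (Ioi 0) := by
  refine IntegrableOn.congr_fun (Real.GammaIntegral_convergent (s := α + k + 1) ?_)
    (fun x hx => (lagW_pow k hx).symm) measurableSet_Ioi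
  have : (0 : ℝ) ≤ k := by positivity
  linarith

lemma integral_pow {α : ℝ} (hα : -1 < α) (k : ℕ) :
    ∫ x in Ioi 0, x ^ k * lagW α x = poch (α + 1) k * Real.Gamma (α + 1) := by
  have : (0 : ℝ) ≤ k := by positivity
  rw [setIntegral_congr_fun measurableSet_Ioi (fun x hx => lagW_pow k hx),
    ← Real.Gamma_eq_integral (by linarith), ← poch_gamma (by linarith)]
  ring_nf

lemma int_poly {α : ℝ} (hα : -1 < α) (p : Polynomial ℝ) :
    IntegrableOn (fun x => p.eval x * lagW α x) (Ioi 0) := by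
  simp_rw [Polynomial.eval_eq_sum_range, Finset.sum_mul]
  refine integrable_finsetSum _ fun i _ => ?_
  simp_rw [mul_assoc]
  exact (int_pow hα i).const_mul _

lemma integral_poly {α : ℝ} (hα : -1 < α) (n : ℕ) (c : ℕ → ℝ) (k : ℕ) :
    ∫ x in Ioi 0, (∑ i ∈ Finset.range n, c i * x ^ i) * x ^ k * lagW α x
      = ∑ i ∈ Finset.range n, c i * (poch (α + 1) (i + k) * Real.Gamma (α + 1)) := by
  have : ∀ x, (∑ i ∈ Finset.range n, c i * x ^ i) * x ^ k * lagW α x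
      = ∑ i ∈ Finset.range n, c i * (x ^ (i + k) * lagW α x) := fun x => by
    rw [Finset.sum_mul, Finset.sum_mul]
    exact Finset.sum_congr rfl fun i _ => by ring
  simp_rw [this]
  rw [integral_finsetSum _ fun i _ => (int_pow hα _).const_mul _]
  exact Finset.sum_congr rfl fun i _ => by rw [integral_const_mul, integral_pow hα]

/-- Alternating sum of Pochhammer values. -/
lemma alt_sum (a : ℝ) (n k : ℕ) (hk : k ≤ n) :
    ∑ i ∈ Finset.range (n + 1), (-1) ^ i * (n.choose i : ℝ) * poch (a + i) k
      = if k = n then (-1) ^ n * (n.factorial : ℝ) else 0 := by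
  have h := fwdDiff_iter_eq_sum_shift (1 : ℝ) (ascPochhammer ℝ k).eval n a
  have h2 : ∑ i ∈ Finset.range (n + 1), (-1) ^ i * (n.choose i : ℝ) * poch (a + i) k
      = (-1) ^ n * (fwdDiff (1 : ℝ))^[n] (ascPochhammer ℝ k).eval a := by
    rw [h, Finset.mul_sum]
    refine Finset.sum_congr rfl fun i hi => ?_
    have hi' : i ≤ n := by simpa [Nat.lt_succ_iff] using hi
    have : ((-1 : ℝ)) ^ n * (-1) ^ (n - i) = (-1) ^ i := by
      obtain ⟨d, rfl⟩ := Nat.exists_eq_add_of_le hi'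
      rw [Nat.add_sub_cancel_left, pow_add, mul_assoc, ← pow_add, ← two_mul, pow_mul]
      simp
    rw [zsmul_eq_mul, ← this]
    simp only [poch, nsmul_eq_mul, mul_one]
    push_cast
    ring
  rw [h2]
  split_ifs with hkn
  · subst hkn
    have := congrFun (Polynomial.fwdDiff_iter_degree_eq_factorial (ascPochhammer ℝ k)) a
    rw [ascPochhammer_natDegree, (monic_ascPochhammer ℝ k).leadingCoeff] at this
    rw [this]
    simp
  · rw [Polynomial.fwdDiff_iter_eq_zero_of_degree_lt]
    · simp
    · rw [ascPochhammer_natDegree]; omega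

lemma lag_eval (n : ℕ) (α x : ℝ) : (lagPoly n α).eval x = ∑ i ∈ Finset.range (n + 1),
    (poch (α + 1) n / (n.factorial : ℝ) * ((-1) ^ i * (n.choose i : ℝ) / poch (α + 1) i)) * x ^ i := by
  simp [lagPoly, Polynomial.eval_finsetSum]

lemma lag_moment {α : ℝ} (hα : -1 < α) (n k : ℕ) (hk : k ≤ n) :
    ∫ x in Ioi 0, (lagPoly n α).eval x * x ^ k * lagW α x
      = if k = n then (-1) ^ n * (poch (α + 1) n * Real.Gamma (α + 1)) else 0 := by
  simp_rw [lag_eval]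
  rw [integral_poly hα]
  have h0 : 0 < α + 1 := by linarith
  have hn : (n.factorial : ℝ) ≠ 0 := by positivity
  have : ∀ i ∈ Finset.range (n + 1),
      (poch (α + 1) n / (n.factorial : ℝ) * ((-1) ^ i * (n.choose i : ℝ) / poch (α + 1) i))
        * (poch (α + 1) (i + k) * Real.Gamma (α + 1))
      = poch (α + 1) n / (n.factorial : ℝ) * Real.Gamma (α + 1)
        * ((-1) ^ i * (n.choose i : ℝ) * poch (α + 1 + i) k) := fun i _ => by
    rw [poch_add]
    have := (poch_pos h0 i).ne'
    field_simp
  rw [Finset.sum_congr rfl this, ← Finset.mul_sum, alt_sum _ _ _ hk]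
  split_ifs
  · field_simp
  · simp

lemma lag_orth_le {α : ℝ} (hα : -1 < α) (n m : ℕ) (hm : m ≤ n) :
    ∫ x in Ioi 0, (lagPoly n α).eval x * (lagPoly m α).eval x * lagW α x
      = if m = n then Real.Gamma (n + α + 1) / (n.factorial : ℝ) else 0 := by
  have h0 : 0 < α + 1 := by linarith
  have hn : (n.factorial : ℝ) ≠ 0 := by positivity
  have e : ∀ x, (lagPoly n α).eval x * (lagPoly m α).eval x * lagW α x
      = ∑ i ∈ Finset.range (m + 1),
        (poch (α + 1) m / (m.factorial : ℝ) * ((-1) ^ i * (m.choose i : ℝ) / poch (α + 1) i))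
        * ((lagPoly n α).eval x * x ^ i * lagW α x) := fun x => by
    rw [lag_eval m, Finset.mul_sum, Finset.sum_mul]
    exact Finset.sum_congr rfl fun i _ => by ring
  simp_rw [e]
  rw [integral_finsetSum]
  · rw [Finset.sum_congr rfl fun i hi => by
      rw [integral_const_mul, lag_moment hα n i (by simp at hi; omega)]]
    split_ifs with h
    · subst h
      rw [Finset.sum_range_succ, Finset.sum_eq_zero]
      · have := (poch_pos h0 m).ne'
        have hg := poch_gamma h0 m
        have h1 : ((-1 : ℝ)) ^ m * (-1) ^ m = 1 := by
          rw [← pow_add, ← two_mul, pow_mul]; simp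
        have e2 : (m : ℝ) + α + 1 = α + 1 + m := by ring
        rw [e2, hg]
        simp only [if_true, Nat.choose_self, Nat.cast_one]
        field_simp
        rw [pow_two, h1]; ring
      · intro i hi
        rw [if_neg (by simp at hi; omega), mul_zero]
    · refine Finset.sum_eq_zero fun i hi => ?_
      rw [if_neg (by simp at hi; omega), mul_zero]
  · intro i _
    have := int_poly hα (lagPoly n α * Polynomial.X ^ i)
    simp only [Polynomial.eval_mul, Polynomial.eval_pow, Polynomial.eval_X] at this
    exact this.const_mul _

lemma lag_orth {α : ℝ} (hα : -1 < α) (n m : ℕ) :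
    ∫ x in Ioi 0, (lagPoly n α).eval x * (lagPoly m α).eval x * lagW α x
      = if n = m then Real.Gamma (n + α + 1) / (n.factorial : ℝ) else 0 := by
  rcases le_total m n with h | h
  · rw [lag_orth_le hα n m h]; simp [eq_comm]
  · have := lag_orth_le hα m n h
    simp_rw [mul_comm ((lagPoly n α).eval _)]
    rw [this]
    split_ifs with h
    · subst h; rfl
    · rfl

/-- The quadratic change of variables. -/
def quad (g x : ℝ) : ℝ := (x ^ 2 - g ^ 2) / 2

lemma quad_image (g : ℝ) : quad g '' Ioi |g| = Ioi 0 := by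
  ext y
  simp only [mem_image, mem_Ioi, quad]
  constructor
  · rintro ⟨x, hx, rfl⟩
    have := sq_lt_sq' (by linarith [abs_nonneg g]) hx
    rw [sq_abs] at this
    linarith
  · intro hy
    refine ⟨√(2 * y + g ^ 2), ?_, ?_⟩
    · rw [← Real.sqrt_sq_eq_abs]
      exact Real.sqrt_lt_sqrt (sq_nonneg _) (by linarith)
    · rw [Real.sq_sqrt (by positivity)]; ring

lemma quad_inj (g : ℝ) : InjOn (quad g) (Ioi |g|) := by
  intro x hx y hy h
  have hx' : 0 < x := lt_of_le_of_lt (abs_nonneg g) hx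
  have hy' : 0 < y := lt_of_le_of_lt (abs_nonneg g) hy
  simp only [quad] at h
  have : x ^ 2 = y ^ 2 := by linarith
  nlinarith

lemma quad_deriv (g x : ℝ) : HasDerivAt (quad g) x x := by
  have h := ((hasDerivAt_pow 2 x).sub_const (g ^ 2)).div_const 2
  have e : ((2 : ℕ) : ℝ) * x ^ (2 - 1) / 2 = x := by norm_num
  rw [e] at h
  exact h

lemma quad_int (g : ℝ) {φ : ℝ → ℝ} (h : IntegrableOn φ (Ioi 0)) :
    IntegrableOn (fun x => x * φ (quad g x)) (Ioi |g|) := by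
  rw [← quad_image g, integrableOn_image_iff_integrableOn_abs_deriv_smul measurableSet_Ioi
    (fun x _ => (quad_deriv g x).hasDerivWithinAt) (quad_inj g)] at h
  refine h.congr_fun (fun x hx => ?_) measurableSet_Ioi
  simp [abs_of_pos (lt_of_le_of_lt (abs_nonneg g) hx)]

lemma quad_integral (g : ℝ) (φ : ℝ → ℝ) :
    ∫ x in Ioi |g|, x * φ (quad g x) = ∫ x in Ioi 0, φ x := by
  rw [← quad_image g, integral_image_eq_integral_abs_deriv_smul measurableSet_Ioi
    (fun x _ => (quad_deriv g x).hasDerivWithinAt) (quad_inj g)]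
  refine setIntegral_congr_fun measurableSet_Ioi (fun x hx => ?_)
  simp [abs_of_pos (lt_of_le_of_lt (abs_nonneg g) hx)]

/-- The set `|x| > |g|`. -/
def outer (g : ℝ) : Set ℝ := {x | |g| < |x|}

lemma outer_eq (g : ℝ) : outer g = Iio (-|g|) ∪ Ioi |g| := by
  ext x
  simp only [outer, mem_ofPred_eq, mem_union, mem_Iio, mem_Ioi, lt_abs]
  constructor
  · rintro (h | h)
    · exact Or.inr h
    · exact Or.inl (by linarith)
  · rintro (h | h)
    · exact Or.inr (by linarith)
    · exact Or.inl h

lemma fold_int (g : ℝ) {h : ℝ → ℝ} (h1 : IntegrableOn h (Ioi |g|))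
    (h2 : IntegrableOn (fun x => h (-x)) (Ioi |g|)) : IntegrableOn h (outer g) := by
  rw [outer_eq]
  refine IntegrableOn.union ?_ h1
  have h3 := ((integrable_indicator_iff measurableSet_Ioi).2 h2).comp_neg
  rw [← integrable_indicator_iff measurableSet_Iio]
  refine h3.congr (Filter.Eventually.of_forall fun x => ?_)
  by_cases hx : x < -|g|
  · have hx' : |g| < -x := by linarith
    simp [indicator, hx, hx']
  · have hx' : ¬ |g| < -x := by linarith
    simp [indicator, hx, hx']

lemma fold_integral (g : ℝ) {h : ℝ → ℝ} (h1 : IntegrableOn h (Ioi |g|))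
    (h2 : IntegrableOn (fun x => h (-x)) (Ioi |g|)) :
    ∫ x in outer g, h x = (∫ x in Ioi |g|, h x) + ∫ x in Ioi |g|, h (-x) := by
  have h3 : IntegrableOn h (Iio (-|g|)) := (fold_int g h1 h2).mono_set (by
    rw [outer_eq]; exact subset_union_left)
  rw [outer_eq, setIntegral_union _ measurableSet_Ioi h3 h1, integral_comp_neg_Ioi,
    integral_Iic_eq_integral_Iio, add_comm]
  rw [Set.disjoint_left]
  intro x hx hx'
  simp only [mem_Iio, mem_Ioi] at hx hx'
  linarith [abs_nonneg g]

/-- Integral over `outer` of a function given by a function of `quad` times `x ± g`. -/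
lemma same_parity (g : ℝ) (s : ℝ) (hs : s = 1 ∨ s = -1) {h φ : ℝ → ℝ}
    (hφ : IntegrableOn φ (Ioi 0))
    (h1 : ∀ x ∈ Ioi |g|, h x = (x + s * g) * φ (quad g x))
    (h2 : ∀ x ∈ Ioi |g|, h (-x) = (x - s * g) * φ (quad g x)) :
    IntegrableOn h (outer g) ∧ ∫ x in outer g, h x = 2 * ∫ x in Ioi 0, φ x := by
  have hq := quad_int g hφ
  have key : ∀ t : ℝ, |t| ≤ |g| → IntegrableOn (fun x => (x + t) * φ (quad g x)) (Ioi |g|) := by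
    intro t ht
    have e : ∀ x ∈ Ioi |g|, (1 + t / x) * (x * φ (quad g x)) = (x + t) * φ (quad g x) := by
      intro x hx
      have : 0 < x := lt_of_le_of_lt (abs_nonneg g) hx
      field_simp
    refine IntegrableOn.congr_fun ?_ e measurableSet_Ioi
    refine Integrable.bdd_mul (c := 2) hq (by fun_prop) ?_
    filter_upwards [ae_restrict_mem measurableSet_Ioi] with x hx
    have hx0 : 0 < x := lt_of_le_of_lt (abs_nonneg g) hx
    have : |t / x| ≤ 1 := by
      rw [abs_div, abs_of_pos hx0, div_le_one hx0]
      exact ht.trans (le_of_lt hx)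
    rw [Real.norm_eq_abs]
    calc |1 + t / x| ≤ |1| + |t / x| := abs_add_le _ _
      _ ≤ 2 := by rw [abs_one]; linarith
  have hsg : |s * g| ≤ |g| := by rcases hs with h | h <;> simp [h]
  have hsg' : |-(s * g)| ≤ |g| := by rwa [abs_neg]
  have i1 : IntegrableOn h (Ioi |g|) :=
    (key _ hsg).congr_fun (fun x hx => (h1 x hx).symm) measurableSet_Ioi
  have i2 : IntegrableOn (fun x => h (-x)) (Ioi |g|) :=
    (key _ hsg').congr_fun (fun x hx => by
      simp only [h2 x hx]; ring) measurableSet_Ioi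
  refine ⟨fold_int g i1 i2, ?_⟩
  rw [fold_integral g i1 i2, ← integral_add i1 i2, ← quad_integral g φ, ← integral_const_mul]
  refine setIntegral_congr_fun measurableSet_Ioi fun x hx => ?_
  simp only [h1 x hx, h2 x hx]
  ring

lemma chihara_even (k : ℕ) (x μ γ : ℝ) : chihara (2 * k) x μ γ =
    (-1) ^ k * √((k.factorial : ℝ) * Real.Gamma (μ + 1 / 2) / Real.Gamma (k + μ + 1 / 2))
      * (lagPoly k (μ - 1 / 2)).eval (quad γ x) := by
  have h : 2 * k / 2 = k := by omega
  simp only [chihara, h, even_two_mul, if_true, laguerre_eq, quad]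

lemma chihara_odd (k : ℕ) (x μ γ : ℝ) : chihara (2 * k + 1) x μ γ =
    (-1) ^ k * √((k.factorial : ℝ) * Real.Gamma (μ + 3 / 2) / Real.Gamma (k + μ + 3 / 2))
      * ((x - γ) / √(2 * μ + 1)) * (lagPoly k (μ + 1 / 2)).eval (quad γ x) := by
  have h : (2 * k + 1) / 2 = k := by omega
  have h' : ¬ Even (2 * k + 1) := by simp
  simp only [chihara, h, h', if_false, laguerre_eq, quad]

lemma quad_neg (g x : ℝ) : quad g (-x) = quad g x := by simp [quad]

lemma weight_pos (μ γ x : ℝ) (hx : x ∈ Ioi |γ|) :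
    normWeight x μ γ = (x + γ) * (lagW (μ - 1 / 2) (quad γ x) / (2 * Real.Gamma (μ + 1 / 2))) := by
  have h0 : 0 < x := lt_of_le_of_lt (abs_nonneg γ) hx
  simp only [normWeight, chiharaWeight, Real.sign_of_pos h0, lagW, quad]
  ring

lemma weight_neg (μ γ x : ℝ) (hx : x ∈ Ioi |γ|) :
    normWeight (-x) μ γ
      = (x - γ) * (lagW (μ - 1 / 2) (quad γ x) / (2 * Real.Gamma (μ + 1 / 2))) := by
  have h0 : 0 < x := lt_of_le_of_lt (abs_nonneg γ) hx
  simp only [normWeight, chiharaWeight, Real.sign_of_neg (neg_lt_zero.2 h0), lagW, quad, neg_sq]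
  ring

/-- The integrand of the orthogonality relation. -/
def dens (μ γ : ℝ) (n m : ℕ) (x : ℝ) : ℝ :=
  chihara n x μ γ * chihara m x μ γ * normWeight x μ γ

lemma dens_even {μ : ℝ} (hμ : 0 < μ) (γ : ℝ) (k l : ℕ) :
    IntegrableOn (dens μ γ (2 * k) (2 * l)) (outer γ) ∧
      ∫ x in outer γ, dens μ γ (2 * k) (2 * l) x = if k = l then 1 else 0 := by
  have hα : -1 < μ - 1 / 2 := by linarith
  set C : ℝ := (-1) ^ k * √((k.factorial : ℝ) * Real.Gamma (μ + 1 / 2) / Real.Gamma (k + μ + 1 / 2))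
    * ((-1) ^ l * √((l.factorial : ℝ) * Real.Gamma (μ + 1 / 2) / Real.Gamma (l + μ + 1 / 2)))
    / (2 * Real.Gamma (μ + 1 / 2)) with hC
  have hi := int_poly hα (lagPoly k (μ - 1 / 2) * lagPoly l (μ - 1 / 2))
  simp only [Polynomial.eval_mul] at hi
  obtain ⟨h1, h2⟩ := same_parity γ 1 (Or.inl rfl) (h := dens μ γ (2 * k) (2 * l)) (hi.const_mul C)
    (fun x hx => by
      rw [dens, weight_pos μ γ x hx, chihara_even, chihara_even, hC]; ring)
    (fun x hx => by
      rw [dens, weight_neg μ γ x hx, chihara_even, chihara_even, quad_neg, hC]; ring)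
  refine ⟨h1, ?_⟩
  rw [h2, integral_const_mul, lag_orth hα]
  split_ifs with h
  · subst h
    have g1 : 0 < Real.Gamma (μ + 1 / 2) := Real.Gamma_pos_of_pos (by linarith)
    have g2 : 0 < Real.Gamma (k + μ + 1 / 2) := Real.Gamma_pos_of_pos (by positivity)
    have e : (k : ℝ) + (μ - 1 / 2) + 1 = k + μ + 1 / 2 := by ring
    have s1 : ((-1 : ℝ)) ^ k * (-1) ^ k = 1 := by
      rw [← pow_add, ← two_mul, pow_mul]; simp
    have s2 := Real.mul_self_sqrt (x := (k.factorial : ℝ) * Real.Gamma (μ + 1 / 2)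
      / Real.Gamma (k + μ + 1 / 2)) (by positivity)
    have hC2 : C = ((-1 : ℝ) ^ k * (-1) ^ k) * ((k.factorial : ℝ) * Real.Gamma (μ + 1 / 2)
        / Real.Gamma (k + μ + 1 / 2)) / (2 * Real.Gamma (μ + 1 / 2)) := by
      rw [← s2, hC]; ring
    have hk : (k.factorial : ℝ) ≠ 0 := by positivity
    rw [hC2, s1, e]
    field_simp
  · simp

lemma dens_odd {μ : ℝ} (hμ : 0 < μ) (γ : ℝ) (k l : ℕ) :
    IntegrableOn (dens μ γ (2 * k + 1) (2 * l + 1)) (outer γ) ∧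
      ∫ x in outer γ, dens μ γ (2 * k + 1) (2 * l + 1) x = if k = l then 1 else 0 := by
  have hα : -1 < μ - 1 / 2 := by linarith
  have hα' : -1 < μ + 1 / 2 := by linarith
  have hm : √(2 * μ + 1) * √(2 * μ + 1) = 2 * μ + 1 := Real.mul_self_sqrt (by linarith)
  have hm0 : √(2 * μ + 1) ≠ 0 := by positivity
  set C : ℝ := (-1) ^ k * √((k.factorial : ℝ) * Real.Gamma (μ + 3 / 2) / Real.Gamma (k + μ + 3 / 2))
    * ((-1) ^ l * √((l.factorial : ℝ) * Real.Gamma (μ + 3 / 2) / Real.Gamma (l + μ + 3 / 2)))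
    / (√(2 * μ + 1) * √(2 * μ + 1)) / (Real.Gamma (μ + 1 / 2)) with hC
  have hi := int_poly hα (Polynomial.X * lagPoly k (μ + 1 / 2) * lagPoly l (μ + 1 / 2))
  simp only [Polynomial.eval_mul, Polynomial.eval_X] at hi
  obtain ⟨h1, h2⟩ := same_parity γ (-1) (Or.inr rfl) (h := dens μ γ (2 * k + 1) (2 * l + 1))
    (hi.const_mul C)
    (fun x hx => by
      rw [dens, weight_pos μ γ x hx, chihara_odd, chihara_odd, hC]
      have : quad γ x = (x - γ) * (x + γ) / 2 := by rw [quad]; ring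
      generalize (lagPoly k (μ + 1 / 2)).eval (quad γ x) = A
      generalize (lagPoly l (μ + 1 / 2)).eval (quad γ x) = B
      generalize lagW (μ - 1 / 2) (quad γ x) = D
      rw [this]
      ring)
    (fun x hx => by
      rw [dens, weight_neg μ γ x hx, chihara_odd, chihara_odd, quad_neg, hC]
      have : quad γ x = (x - γ) * (x + γ) / 2 := by rw [quad]; ring
      generalize (lagPoly k (μ + 1 / 2)).eval (quad γ x) = A
      generalize (lagPoly l (μ + 1 / 2)).eval (quad γ x) = B
      generalize lagW (μ - 1 / 2) (quad γ x) = D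
      rw [this]
      ring)
  refine ⟨h1, ?_⟩
  have e1 : ∀ x ∈ Ioi (0 : ℝ), x * (lagPoly k (μ + 1 / 2)).eval x * (lagPoly l (μ + 1 / 2)).eval x
      * lagW (μ - 1 / 2) x = (lagPoly k (μ + 1 / 2)).eval x * (lagPoly l (μ + 1 / 2)).eval x
      * lagW (μ + 1 / 2) x := by
    intro x hx
    have hx : 0 < x := hx
    have : μ + 1 / 2 = (μ - 1 / 2) + 1 := by ring
    have hp : x ^ (μ + 1 / 2) = x ^ (μ - 1 / 2) * x := by
      rw [this, Real.rpow_add hx, Real.rpow_one]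
    simp only [lagW, hp]
    ring
  rw [h2, integral_const_mul, setIntegral_congr_fun measurableSet_Ioi e1, lag_orth hα']
  split_ifs with h
  · subst h
    have g1 : 0 < Real.Gamma (μ + 1 / 2) := Real.Gamma_pos_of_pos (by linarith)
    have g3 : Real.Gamma (μ + 3 / 2) = (μ + 1 / 2) * Real.Gamma (μ + 1 / 2) := by
      rw [← Real.Gamma_add_one (by positivity)]; congr 1; ring
    have g2 : 0 < Real.Gamma (k + μ + 3 / 2) := Real.Gamma_pos_of_pos (by positivity)
    have g4 : 0 < Real.Gamma (μ + 3 / 2) := Real.Gamma_pos_of_pos (by positivity)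
    have e : (k : ℝ) + (μ + 1 / 2) + 1 = k + μ + 3 / 2 := by ring
    have s1 : ((-1 : ℝ)) ^ k * (-1) ^ k = 1 := by
      rw [← pow_add, ← two_mul, pow_mul]; simp
    have s2 := Real.mul_self_sqrt (x := (k.factorial : ℝ) * Real.Gamma (μ + 3 / 2)
      / Real.Gamma (k + μ + 3 / 2)) (by positivity)
    have hC2 : C = ((-1 : ℝ) ^ k * (-1) ^ k) * ((k.factorial : ℝ) * Real.Gamma (μ + 3 / 2)
        / Real.Gamma (k + μ + 3 / 2)) / (2 * μ + 1) / (Real.Gamma (μ + 1 / 2)) := by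
      rw [← s2, hC, hm]; ring
    have hk : (k.factorial : ℝ) ≠ 0 := by positivity
    rw [hC2, s1, e, g3]
    field_simp
  · simp

lemma measurable_eval (p : Polynomial ℝ) : Measurable fun x => p.eval x :=
  p.continuous.measurable

lemma measurable_chihara (n : ℕ) (μ : ℝ) :
    Measurable fun p : ℝ × ℝ => chihara n p.2 μ p.1 := by
  have hq : Measurable fun p : ℝ × ℝ => quad p.1 p.2 := by unfold quad; fun_prop
  rcases Nat.even_or_odd' n with ⟨k, rfl | rfl⟩
  · simp_rw [chihara_even]
    exact ((measurable_eval _).comp hq).const_mul _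
  · simp_rw [chihara_odd]
    exact Measurable.mul (by fun_prop) ((measurable_eval _).comp hq)

lemma measurable_sign : Measurable Real.sign := by
  have : Real.sign = fun r : ℝ => if r < 0 then -1 else if 0 < r then 1 else 0 := by
    ext r; rw [Real.sign]
  rw [this]
  exact Measurable.ite measurableSet_Iio measurable_const
    (Measurable.ite measurableSet_Ioi measurable_const measurable_const)

lemma measurable_weight (μ : ℝ) : Measurable fun p : ℝ × ℝ => normWeight p.2 μ p.1 := by
  have := measurable_sign
  unfold normWeight chiharaWeight
  fun_prop

lemma measurable_dens (μ : ℝ) (n m : ℕ) : Measurable fun p : ℝ × ℝ => dens μ p.1 n m p.2 :=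
  ((measurable_chihara n μ).mul (measurable_chihara m μ)).mul (measurable_weight μ)

lemma measurableSet_outer (g : ℝ) : MeasurableSet (outer g) :=
  measurableSet_lt measurable_const measurable_id.abs

lemma dens_diag {μ : ℝ} (hμ : 0 < μ) (γ : ℝ) (n : ℕ) :
    IntegrableOn (dens μ γ n n) (outer γ) ∧ ∫ x in outer γ, dens μ γ n n x = 1 := by
  rcases Nat.even_or_odd' n with ⟨k, rfl | rfl⟩
  · simpa using dens_even hμ γ k k
  · simpa using dens_odd hμ γ k k

lemma weight_nonneg {μ : ℝ} (hμ : 0 < μ) (γ x : ℝ) (hx : |γ| < |x|) : 0 ≤ normWeight x μ γ := by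
  have g1 : 0 < Real.Gamma (μ + 1 / 2) := Real.Gamma_pos_of_pos (by linarith)
  have hq : 0 < quad γ x := by
    have := sq_lt_sq.2 hx
    rw [quad]; linarith
  have hl : 0 ≤ lagW (μ - 1 / 2) (quad γ x) :=
    mul_nonneg (Real.rpow_nonneg hq.le _) (Real.exp_pos _).le
  rcases lt_abs.1 hx with h | h
  · rw [weight_pos μ γ x h]
    have : 0 ≤ x + γ := by linarith [neg_abs_le γ]
    positivity
  · have h2 := weight_neg μ γ (-x) h
    rw [neg_neg, quad_neg] at h2
    rw [h2]
    have : 0 ≤ -x - γ := by linarith [le_abs_self γ]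
    positivity

lemma dens_le {μ : ℝ} (hμ : 0 < μ) (γ : ℝ) (n m : ℕ) (x : ℝ) (hx : |γ| < |x|) :
    ‖dens μ γ n m x‖ ≤ (dens μ γ n n x + dens μ γ m m x) / 2 := by
  have hw := weight_nonneg hμ γ x hx
  rw [Real.norm_eq_abs, dens, dens, dens, abs_mul, abs_of_nonneg hw]
  have : |chihara n x μ γ * chihara m x μ γ|
      ≤ (chihara n x μ γ * chihara n x μ γ + chihara m x μ γ * chihara m x μ γ) / 2 := by
    rw [abs_le]
    constructor
    · nlinarith [sq_nonneg (chihara n x μ γ + chihara m x μ γ)]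
    · nlinarith [sq_nonneg (chihara n x μ γ - chihara m x μ γ)]
  nlinarith

lemma dens_int {μ : ℝ} (hμ : 0 < μ) (γ : ℝ) (n m : ℕ) :
    IntegrableOn (dens μ γ n m) (outer γ) ∧ ∫ x in outer γ, ‖dens μ γ n m x‖ ≤ 1 := by
  have hb : IntegrableOn (fun x => (dens μ γ n n x + dens μ γ m m x) / 2) (outer γ) :=
    ((dens_diag hμ γ n).1.add (dens_diag hμ γ m).1).div_const 2
  have hle : ∀ᵐ x ∂volume.restrict (outer γ),
      ‖dens μ γ n m x‖ ≤ (dens μ γ n n x + dens μ γ m m x) / 2 := by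
    filter_upwards [ae_restrict_mem (measurableSet_outer γ)] with x hx
    exact dens_le hμ γ n m x hx
  have hi : IntegrableOn (dens μ γ n m) (outer γ) := Integrable.mono' hb
    ((measurable_dens μ n m).comp (by fun_prop : Measurable fun x : ℝ => (γ, x))).aestronglyMeasurable
    hle
  refine ⟨hi, (integral_mono_ae hi.norm hb hle).trans ?_⟩
  rw [integral_div, integral_add (dens_diag hμ γ n).1 (dens_diag hμ γ m).1,
    (dens_diag hμ γ n).2, (dens_diag hμ γ m).2]
  norm_num

lemma dens_mixed {μ : ℝ} (hμ : 0 < μ) (γ : ℝ) (k l : ℕ) :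
    ∫ x in outer γ, dens μ γ (2 * k) (2 * l + 1) x = 0 := by
  have hi := (dens_int hμ γ (2 * k) (2 * l + 1)).1
  have hs : Ioi |γ| ⊆ outer γ := by rw [outer_eq]; exact subset_union_right
  have h1 := hi.mono_set hs
  have e : ∀ x ∈ Ioi |γ|, -dens μ γ (2 * k) (2 * l + 1) x = dens μ γ (2 * k) (2 * l + 1) (-x) := by
    intro x hx
    rw [dens, dens, weight_pos μ γ x hx, weight_neg μ γ x hx, chihara_even, chihara_even,
      chihara_odd, chihara_odd, quad_neg]
    ring
  have h2 : IntegrableOn (fun x => dens μ γ (2 * k) (2 * l + 1) (-x)) (Ioi |γ|) :=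
    IntegrableOn.congr_fun h1.neg e measurableSet_Ioi
  rw [fold_integral γ h1 h2, ← setIntegral_congr_fun measurableSet_Ioi e, integral_neg]
  ring

lemma dens_orth {μ : ℝ} (hμ : 0 < μ) (γ : ℝ) (n m : ℕ) :
    ∫ x in outer γ, dens μ γ n m x = if n = m then 1 else 0 := by
  rcases Nat.even_or_odd' n with ⟨k, rfl | rfl⟩ <;> rcases Nat.even_or_odd' m with ⟨l, rfl | rfl⟩
  · rw [(dens_even hμ γ k l).2]; simp
  · rw [dens_mixed hμ, if_neg (by omega)]
  · have : ∀ x, dens μ γ (2 * k + 1) (2 * l) x = dens μ γ (2 * l) (2 * k + 1) x := fun x => by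
      rw [dens, dens]; ring
    simp_rw [this]
    rw [dens_mixed hμ, if_neg (by omega)]
  · rw [(dens_odd hμ γ k l).2]; simp

/-- The orthogonality integrand extended by zero. -/
def cut (μ γ : ℝ) (n m : ℕ) (x : ℝ) : ℝ := (outer γ).indicator (dens μ γ n m) x

lemma measurable_cut (μ : ℝ) (n m : ℕ) : Measurable fun p : ℝ × ℝ => cut μ p.1 n m p.2 := by
  have : (fun p : ℝ × ℝ => cut μ p.1 n m p.2)
      = {p : ℝ × ℝ | |p.1| < |p.2|}.indicator fun p => dens μ p.1 n m p.2 := by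
    ext p
    by_cases h : |p.1| < |p.2| <;> simp [cut, outer, indicator, h]
  rw [this]
  exact (measurable_dens μ n m).indicator
    (measurableSet_lt measurable_fst.abs measurable_snd.abs)

lemma cut_int {μ : ℝ} (hμ : 0 < μ) (γ : ℝ) (n m : ℕ) :
    Integrable (cut μ γ n m) ∧ ∫ x, ‖cut μ γ n m x‖ ≤ 1 ∧
      ∫ x, cut μ γ n m x = if n = m then 1 else 0 := by
  obtain ⟨h1, h2⟩ := dens_int hμ γ n m
  refine ⟨(integrable_indicator_iff (measurableSet_outer γ)).2 h1, ?_, ?_⟩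
  · simp only [cut, norm_indicator_eq_indicator_norm]
    rwa [integral_indicator (measurableSet_outer γ)]
  · simp only [cut]
    rw [integral_indicator (measurableSet_outer γ), dens_orth hμ]

lemma step {Y : Type} [MeasureSpace Y] [SFinite (volume : Measure Y)] {a : ℝ → ℝ} {q : ℝ → Y → ℝ}
    (hq : Measurable fun p : ℝ × Y => a p.1 * q p.1 p.2) (ha : Integrable a)
    (ha1 : ∫ x, ‖a x‖ ≤ 1) (h1 : ∀ x, Integrable (q x)) (h2 : ∀ x, ∫ y, ‖q x y‖ ≤ 1) {d : ℝ}
    (h3 : ∀ x, ∫ y, q x y = d) :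
    Integrable (fun p : ℝ × Y => a p.1 * q p.1 p.2) ∧
      ∫ p : ℝ × Y, ‖a p.1 * q p.1 p.2‖ ≤ 1 ∧ ∫ p : ℝ × Y, a p.1 * q p.1 p.2 = (∫ x, a x) * d := by
  have hb : ∀ x, ∫ y, ‖a x * q x y‖ ≤ ‖a x‖ := fun x => by
    simp_rw [norm_mul]
    rw [integral_const_mul]
    exact mul_le_of_le_one_right (norm_nonneg _) (h2 x)
  have hm : Measurable fun x => ∫ y, ‖a x * q x y‖ :=
    (hq.norm.stronglyMeasurable.integral_prod_right').measurable
  have hbi : Integrable fun x => ∫ y, ‖a x * q x y‖ := by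
    refine Integrable.mono' ha.norm hm.aestronglyMeasurable (Filter.Eventually.of_forall fun x => ?_)
    rw [Real.norm_of_nonneg (integral_nonneg fun _ => norm_nonneg _)]
    exact hb x
  have hi : Integrable (fun p : ℝ × Y => a p.1 * q p.1 p.2) := by
    rw [Measure.volume_eq_prod, integrable_prod_iff hq.aestronglyMeasurable]
    exact ⟨Filter.Eventually.of_forall fun x => (h1 x).const_mul (a x), hbi⟩
  refine ⟨hi, ?_, ?_⟩
  · rw [Measure.volume_eq_prod] at hi ⊢
    rw [integral_prod _ hi.norm]
    exact (integral_mono hbi ha.norm hb).trans ha1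
  · rw [Measure.volume_eq_prod] at hi ⊢
    rw [integral_prod _ hi]
    simp_rw [integral_const_mul, h3]
    rw [integral_mul_const]

lemma abs_eps (r : DiscreteSeries) (x : ℝ) : |x * r.eps| = |x| := by
  rcases r.eps_eq with h | h <;> simp [h]

lemma abs_eps_one (r : DiscreteSeries) : |r.eps| = 1 := by
  rcases r.eps_eq with h | h <;> simp [h]

lemma measurableSet_region (c : ℝ) : MeasurableSet (region c) := by
  have h1 : Measurable fun x : ℝ × ℝ × ℝ => |x.1| := by fun_prop
  have h2 : Measurable fun x : ℝ × ℝ × ℝ => |x.2.1| := by fun_prop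
  have h3 : Measurable fun x : ℝ × ℝ × ℝ => |x.2.2| := by fun_prop
  exact (measurableSet_lt measurable_const h1).inter
    ((measurableSet_lt h1 h2).inter (measurableSet_lt h2 h3))

variable (r₁ r₂ r₃ : DiscreteSeries) (c : ℝ)

lemma cut_prod (n m : ℕ × ℕ × ℕ) (x : ℝ × ℝ × ℝ) :
    cut r₁.mu (c * r₁.eps) n.1 m.1 x.1 * (cut r₂.mu (x.1 * r₂.eps) n.2.1 m.2.1 x.2.1
      * cut r₃.mu (x.2.1 * r₃.eps) n.2.2 m.2.2 x.2.2)
    = (region c).indicator (fun x => tripleWeight r₁ r₂ r₃ c x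
      * (triplePoly r₁ r₂ r₃ c n x * triplePoly r₁ r₂ r₃ c m x)) x := by
  by_cases h1 : |c| < |x.1| <;> by_cases h2 : |x.1| < |x.2.1| <;>
    by_cases h3 : |x.2.1| < |x.2.2| <;>
    simp [cut, outer, indicator, region, abs_eps_one, h1, h2, h3]
  simp only [dens, tripleWeight, triplePoly]
  ring

lemma triple_int (n m : ℕ × ℕ × ℕ) :
    IntegrableOn (fun x => tripleWeight r₁ r₂ r₃ c x
      * (triplePoly r₁ r₂ r₃ c n x * triplePoly r₁ r₂ r₃ c m x)) (region c) ∧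
    ∫ x in region c, tripleWeight r₁ r₂ r₃ c x
      * (triplePoly r₁ r₂ r₃ c n x * triplePoly r₁ r₂ r₃ c m x) = if n = m then 1 else 0 := by
  have m1 : Measurable (cut r₁.mu (c * r₁.eps) n.1 m.1) :=
    (measurable_cut r₁.mu n.1 m.1).comp (by fun_prop : Measurable fun x : ℝ => (c * r₁.eps, x))
  have m2 : Measurable fun p : ℝ × ℝ => cut r₂.mu (p.1 * r₂.eps) n.2.1 m.2.1 p.2 :=
    (measurable_cut r₂.mu n.2.1 m.2.1).comp
      (by fun_prop : Measurable fun p : ℝ × ℝ => (p.1 * r₂.eps, p.2))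
  have m3 : Measurable fun p : ℝ × ℝ => cut r₃.mu (p.1 * r₃.eps) n.2.2 m.2.2 p.2 :=
    (measurable_cut r₃.mu n.2.2 m.2.2).comp
      (by fun_prop : Measurable fun p : ℝ × ℝ => (p.1 * r₃.eps, p.2))
  have m23 : Measurable fun x : ℝ × ℝ × ℝ => cut r₂.mu (x.1 * r₂.eps) n.2.1 m.2.1 x.2.1
      * cut r₃.mu (x.2.1 * r₃.eps) n.2.2 m.2.2 x.2.2 :=
    (m2.comp (by fun_prop : Measurable fun x : ℝ × ℝ × ℝ => (x.1, x.2.1))).mul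
      (m3.comp (by fun_prop : Measurable fun x : ℝ × ℝ × ℝ => (x.2.1, x.2.2)))
  have s2 : ∀ y : ℝ, _ := fun y => step (Y := ℝ) (a := cut r₂.mu (y * r₂.eps) n.2.1 m.2.1)
    (q := fun z => cut r₃.mu (z * r₃.eps) n.2.2 m.2.2)
    (m23.comp (by fun_prop : Measurable fun x : ℝ × ℝ => (y, x)))
    (cut_int r₂.mu_pos _ _ _).1 (cut_int r₂.mu_pos _ _ _).2.1
    (fun z => (cut_int r₃.mu_pos _ _ _).1) (fun z => (cut_int r₃.mu_pos _ _ _).2.1)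
    (fun z => (cut_int r₃.mu_pos _ _ _).2.2)
  have s1 := step (Y := ℝ × ℝ) (a := cut r₁.mu (c * r₁.eps) n.1 m.1)
    (q := fun y p => cut r₂.mu (y * r₂.eps) n.2.1 m.2.1 p.1
      * cut r₃.mu (p.1 * r₃.eps) n.2.2 m.2.2 p.2)
    ((m1.comp measurable_fst).mul m23)
    (cut_int r₁.mu_pos _ _ _).1 (cut_int r₁.mu_pos _ _ _).2.1
    (fun y => (s2 y).1) (fun y => (s2 y).2.1)
    (fun y => (s2 y).2.2.trans (by rw [(cut_int r₂.mu_pos _ _ _).2.2]))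
  obtain ⟨i1, -, i3⟩ := s1
  simp_rw [cut_prod r₁ r₂ r₃ c n m] at i1 i3
  rw [integral_indicator (measurableSet_region c), (cut_int r₁.mu_pos _ _ _).2.2] at i3
  refine ⟨(integrable_indicator_iff (measurableSet_region c)).1 i1, i3.trans ?_⟩
  by_cases h1 : n.1 = m.1 <;> by_cases h2 : n.2.1 = m.2.1 <;> by_cases h3 : n.2.2 = m.2.2 <;>
    simp [Prod.ext_iff, h1, h2, h3]

lemma measurable_tripleWeight : Measurable (tripleWeight r₁ r₂ r₃ c) := by
  refine Measurable.mul (Measurable.mul ?_ ?_) ?_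
  · exact (measurable_weight r₁.mu).comp
      (by fun_prop : Measurable fun x : ℝ × ℝ × ℝ => (c * r₁.eps, x.1))
  · exact (measurable_weight r₂.mu).comp
      (by fun_prop : Measurable fun x : ℝ × ℝ × ℝ => (x.1 * r₂.eps, x.2.1))
  · exact (measurable_weight r₃.mu).comp
      (by fun_prop : Measurable fun x : ℝ × ℝ × ℝ => (x.2.1 * r₃.eps, x.2.2))

lemma measurable_triplePoly (n : ℕ × ℕ × ℕ) : Measurable (triplePoly r₁ r₂ r₃ c n) := by
  refine Measurable.mul (Measurable.mul ?_ ?_) ?_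
  · exact (measurable_chihara n.1 r₁.mu).comp
      (by fun_prop : Measurable fun x : ℝ × ℝ × ℝ => (c * r₁.eps, x.1))
  · exact (measurable_chihara n.2.1 r₂.mu).comp
      (by fun_prop : Measurable fun x : ℝ × ℝ × ℝ => (x.1 * r₂.eps, x.2.1))
  · exact (measurable_chihara n.2.2 r₃.mu).comp
      (by fun_prop : Measurable fun x : ℝ × ℝ × ℝ => (x.2.1 * r₃.eps, x.2.2))

lemma tripleWeight_nonneg (x : ℝ × ℝ × ℝ) (hx : x ∈ region c) :
    0 ≤ tripleWeight r₁ r₂ r₃ c x := by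
  obtain ⟨h1, h2, h3⟩ := hx
  refine mul_nonneg (mul_nonneg ?_ ?_) ?_
  · exact weight_nonneg r₁.mu_pos _ _ (by rwa [abs_eps])
  · exact weight_nonneg r₂.mu_pos _ _ (by rwa [abs_eps])
  · exact weight_nonneg r₃.mu_pos _ _ (by rwa [abs_eps])

lemma toReal_weight : (fun x => (ENNReal.ofReal (tripleWeight r₁ r₂ r₃ c x)).toReal)
    =ᵐ[volume.restrict (region c)] tripleWeight r₁ r₂ r₃ c := by
  filter_upwards [ae_restrict_mem (measurableSet_region c)] with x hx
  exact ENNReal.toReal_ofReal (tripleWeight_nonneg r₁ r₂ r₃ c x hx)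

lemma triple_integral (n m : ℕ × ℕ × ℕ) :
    ∫ x, triplePoly r₁ r₂ r₃ c n x * triplePoly r₁ r₂ r₃ c m x ∂tripleMeasure r₁ r₂ r₃ c
      = if n = m then 1 else 0 := by
  rw [tripleMeasure, integral_withDensity_eq_integral_toReal_smul
    (measurable_tripleWeight r₁ r₂ r₃ c).ennreal_ofReal (by simp), ← (triple_int r₁ r₂ r₃ c n m).2]
  refine integral_congr_ae ?_
  filter_upwards [toReal_weight r₁ r₂ r₃ c] with x hx
  rw [hx, smul_eq_mul]

lemma triple_memLp (n : ℕ × ℕ × ℕ) :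
    MemLp (fun x => (triplePoly r₁ r₂ r₃ c n x : ℂ)) 2 (tripleMeasure r₁ r₂ r₃ c) := by
  have hm := measurable_triplePoly r₁ r₂ r₃ c n
  rw [memLp_two_iff_integrable_sq_norm (by fun_prop), tripleMeasure,
    integrable_withDensity_iff_integrable_smul'
      (measurable_tripleWeight r₁ r₂ r₃ c).ennreal_ofReal (by simp)]
  refine (triple_int r₁ r₂ r₃ c n n).1.congr ?_
  filter_upwards [toReal_weight r₁ r₂ r₃ c] with x hx
  rw [hx, smul_eq_mul, Complex.norm_real, Real.norm_eq_abs, sq_abs, sq]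

/-- The class of the product polynomial in `L²`. -/
def triplePolyL2 (n : ℕ × ℕ × ℕ) : Lp ℂ 2 (tripleMeasure r₁ r₂ r₃ c) :=
  (triple_memLp r₁ r₂ r₃ c n).toLp _

lemma orthonormal_triplePolyL2 : Orthonormal ℂ (triplePolyL2 r₁ r₂ r₃ c) := by
  rw [orthonormal_iff_ite]
  intro n m
  rw [L2.inner_def]
  have : ∀ᵐ x ∂tripleMeasure r₁ r₂ r₃ c,
      inner ℂ (triplePolyL2 r₁ r₂ r₃ c n x) (triplePolyL2 r₁ r₂ r₃ c m x)
        = ((triplePoly r₁ r₂ r₃ c n x * triplePoly r₁ r₂ r₃ c m x : ℝ) : ℂ) := by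
    filter_upwards [(triple_memLp r₁ r₂ r₃ c n).coeFn_toLp,
      (triple_memLp r₁ r₂ r₃ c m).coeFn_toLp] with x h1 h2
    rw [triplePolyL2, triplePolyL2, h1, h2]
    simp [mul_comm]
  rw [integral_congr_ae this, integral_complex_ofReal, triple_integral]
  split_ifs <;> simp

end

/-! ### The operator `Θ` -/

/-- The isometry `Θ` from `ℓ² ⊗ ℓ² ⊗ ℓ²` to the weighted `L²` space which sends
`e_{n₁} ⊗ e_{n₂} ⊗ e_{n₃}` to the product polynomial with indices `n₁, n₂, n₃`. -/
def theta (r₁ r₂ r₃ : DiscreteSeries) (c : ℝ) :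
    TripleSpace →ₗᵢ[ℂ] Lp ℂ 2 (tripleMeasure r₁ r₂ r₃ c) :=
  (orthonormal_triplePolyL2 r₁ r₂ r₃ c).orthogonalFamily.linearIsometry

theorem theta_basisVec (r₁ r₂ r₃ : DiscreteSeries) (c : ℝ) (n₁ n₂ n₃ : ℕ) :
    theta r₁ r₂ r₃ c (basisVec n₁ n₂ n₃) =ᵐ[tripleMeasure r₁ r₂ r₃ c]
      fun x => (triplePoly r₁ r₂ r₃ c (n₁, n₂, n₃) x : ℂ) := by
  have : theta r₁ r₂ r₃ c (basisVec n₁ n₂ n₃) = triplePolyL2 r₁ r₂ r₃ c (n₁, n₂, n₃) := by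
    rw [theta, basisVec, OrthogonalFamily.linearIsometry_apply_single]
    simp
  rw [this]
  exact (triple_memLp r₁ r₂ r₃ c _).coeFn_toLp

end

end Osp12

open Osp12

/-! Since Θ is linear and each `fVec` or `gVec` is a finite combination of basis vectors, the claim
is an identity of functions that has to hold only at points of `region c`. It is obtained by
applying the two-fold identity `sum_clebschGordan` twice: for |y| > |c|, the Clebsch-Gordan
combination of products P_{n₁}(x) P_{n₂}(y; x ε₂) equals K_j J_j P_N(y), where P_N carries the
coupled labels. For f, the inner coupling takes place in (x₁, x₂) with parameter c, and its output
P(x₂) is the first factor of the outer coupling in (x₂, x₃). For g, the inner coupling takes place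
in (x₂, x₃) with x₁ in the role of c, and its output P(x₃) is the second factor of the outer
coupling in (x₁, x₃).

The two-fold identity comes from a ladder argument. In the recurrence of the monic polynomials
q_m(y; e x), the diagonal coefficient is ± e x, and x in turn acts on p_n(x) by its own recurrence.
Hence multiplication by y on products of total degree M is the sum of a raising part, a scalar and a
lowering part (`mul_tensorSum`). The raising and lowering parts anticommute to a scalar on each
degree (`lowerCoeff_raiseCoeff`), as in osp(1|2). Starting from a vector of degree j killed by
lowering, the raised vectors are therefore lowered with factors [N] formed with the coupled μ
(`lowerCoeff_coupledCoeff`). The corresponding functions satisfy the Chihara recurrence in y with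
coupled labels, so they are the lowest one times P_N (`tensorSum_coupledCoeff`).

Three identifications remain. The coefficients of the raised vectors satisfy a three-term recurrence
in n, which is that of the dual -1 Hahn polynomials at a grid point (`coupledCoeff_eq_dualHahn`).
The lowest function splits by parity of n into convolutions of Laguerre polynomials. Their
generating functions are exponentials times ₀F₁ series, the exponentials cancel, and the product of
two ₀F₁ series has Jacobi polynomials as coefficients by Chu-Vandermonde (`convolution_eq_hypPoly`).
Contiguous relations then recombine these into a Big -1 Jacobi polynomial (`sum_chiharaHat_even_eq`,
`sum_chiharaHat_odd_eq`). Finally, the normalizations agree because both square roots reduce to the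
root of one constant that depends on j but not on N (`couplingConst_eq`, `gamma_const_even`,
`gamma_const_odd`). -/

namespace Osp12

/-! ### Pochhammer symbols and `μ`-factorials -/

@[simp] lemma poch_zero (a : ℝ) : poch a 0 = 1 := by simp [poch]

lemma poch_succ (a : ℝ) (n : ℕ) : poch a (n + 1) = poch a n * (a + n) := by
  rw [poch_add]; simp [poch]

lemma poch_succ_left (a : ℝ) (n : ℕ) : poch a (n + 1) = a * poch (a + 1) n := by
  rw [add_comm n 1, poch_add]; simp [poch]

lemma muNumber_even (k : ℕ) (μ : ℝ) : muNumber (2 * k) μ = 2 * k := by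
  simp [muNumber]

lemma muNumber_odd (k : ℕ) (μ : ℝ) : muNumber (2 * k + 1) μ = 2 * k + 1 + 2 * μ := by
  rw [muNumber, Odd.neg_one_pow ⟨k, rfl⟩]; push_cast; ring

@[simp] lemma muNumber_zero (μ : ℝ) : muNumber 0 μ = 0 := by simp [muNumber]

lemma muNumber_pos (n : ℕ) {μ : ℝ} (hμ : 0 < μ) : 0 < muNumber (n + 1) μ := by
  rcases Nat.even_or_odd' n with ⟨k, rfl | rfl⟩
  · rw [muNumber_odd]; positivity
  · rw [show 2 * k + 1 + 1 = 2 * (k + 1) by ring, muNumber_even]; positivity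

@[simp] lemma muFactorial_zero (μ : ℝ) : muFactorial 0 μ = 1 := by simp [muFactorial]

lemma muFactorial_succ (n : ℕ) (μ : ℝ) :
    muFactorial (n + 1) μ = muFactorial n μ * muNumber (n + 1) μ := by
  rw [muFactorial, Finset.prod_range_succ, muFactorial]

lemma muFactorial_pos (n : ℕ) {μ : ℝ} (hμ : 0 < μ) : 0 < muFactorial n μ :=
  Finset.prod_pos fun i _ => muNumber_pos i hμ

lemma muFactorial_odd_aux (k : ℕ) (μ : ℝ) :
    muFactorial (2 * k + 1) μ = muFactorial (2 * k) μ * (2 * (μ + 1 / 2 + k)) := by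
  rw [muFactorial_succ, muNumber_odd]; ring

lemma muFactorial_even (k : ℕ) (μ : ℝ) :
    muFactorial (2 * k) μ = 4 ^ k * k.factorial * poch (μ + 1 / 2) k := by
  induction k with
  | zero => simp
  | succ k ih =>
    rw [show 2 * (k + 1) = 2 * k + 1 + 1 by ring, muFactorial_succ, muFactorial_odd_aux, ih,
      show 2 * k + 1 + 1 = 2 * (k + 1) by ring, muNumber_even, poch_succ, Nat.factorial_succ]
    push_cast
    ring

lemma muFactorial_odd (k : ℕ) (μ : ℝ) :
    muFactorial (2 * k + 1) μ = 2 * 4 ^ k * k.factorial * poch (μ + 1 / 2) (k + 1) := by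
  rw [muFactorial_odd_aux, muFactorial_even, poch_succ]; ring

/-! ### Generating series of the Laguerre polynomials -/

section

open PowerSeries

/-- The power series of `₀F₁(; b; q u / 2)` in `u`. -/
noncomputable def besselSeries (b q : ℝ) : PowerSeries ℝ :=
  PowerSeries.mk fun i => (q / 2) ^ i / (i.factorial * poch b i)

/-- The generating series `exp(-u / 2) ₀F₁(; b; q u / 2)` of scaled Laguerre polynomials. -/
noncomputable def lagSeries (b q : ℝ) : PowerSeries ℝ :=
  rescale (-1 / 2 : ℝ) (PowerSeries.exp ℝ) * besselSeries b q

lemma derivative_rescale_exp (a : ℝ) :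
    PowerSeries.derivative ℝ (rescale a (PowerSeries.exp ℝ))
      = PowerSeries.C a * rescale a (PowerSeries.exp ℝ) := by
  ext n
  rw [coeff_derivative, coeff_C_mul, coeff_rescale, coeff_rescale, coeff_exp, coeff_exp]
  have : ((n : ℝ) + 1) ≠ 0 := by positivity
  have : (n.factorial : ℝ) ≠ 0 := by positivity
  simp [Nat.factorial_succ]
  field_simp
  ring

lemma derivative_besselSeries {b : ℝ} (hb : 0 < b) (q : ℝ) :
    PowerSeries.derivative ℝ (besselSeries b q)
      = PowerSeries.C (q / (2 * b)) * besselSeries (b + 1) q := by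
  ext n
  rw [coeff_derivative, coeff_C_mul, besselSeries, besselSeries, coeff_mk, coeff_mk,
    poch_succ_left, Nat.factorial_succ]
  have : ((n : ℝ) + 1) ≠ 0 := by positivity
  have : (n.factorial : ℝ) ≠ 0 := by positivity
  have := (poch_pos (by linarith : 0 < b + 1) n).ne'
  push_cast
  field_simp
  ring

/-- Since b (b+1)_n = (b)_n (b+n), lowering the parameter from b + 1 to b multiplies the n-th
coefficient by 1 + n/b, which is the action of 1 + (1/b) u d/du. -/
lemma besselSeries_eq {b : ℝ} (hb : 0 < b) (q : ℝ) :
    besselSeries b q = besselSeries (b + 1) q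
      + PowerSeries.C (1 / b) * (PowerSeries.X * PowerSeries.derivative ℝ (besselSeries (b + 1) q)) := by
  ext n
  have hb1 : 0 < b + 1 := by linarith
  rcases n with _ | n
  · simp [besselSeries]
  · rw [map_add, coeff_C_mul, coeff_succ_X_mul, coeff_derivative, besselSeries, besselSeries,
      coeff_mk, coeff_mk, poch_succ_left b, poch_succ (b + 1)]
    have : ((n + 1).factorial : ℝ) ≠ 0 := by positivity
    have := (poch_pos hb1 n).ne'
    have : b + 1 + (n : ℝ) ≠ 0 := by positivity
    field_simp
    ring

lemma derivative_lagSeries {b : ℝ} (hb : 0 < b) (q : ℝ) :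
    PowerSeries.derivative ℝ (lagSeries b q)
      = PowerSeries.C (-1 / 2) * lagSeries b q
        + PowerSeries.C (q / (2 * b)) * lagSeries (b + 1) q := by
  rw [lagSeries, Derivation.leibniz, derivative_rescale_exp, derivative_besselSeries hb, lagSeries]
  simp only [smul_eq_mul]
  ring

/-- Conjugating by exp(-u/2) replaces u d/du by u d/du + u/2 in the parameter shift of the ₀F₁
series. -/
lemma lagSeries_eq {b : ℝ} (hb : 0 < b) (q : ℝ) :
    lagSeries b q = lagSeries (b + 1) q
      + PowerSeries.C (1 / b) * (PowerSeries.X * PowerSeries.derivative ℝ (lagSeries (b + 1) q))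
      + PowerSeries.C (1 / b) * PowerSeries.C (1 / 2) * (PowerSeries.X * lagSeries (b + 1) q) := by
  have h : PowerSeries.C (-1 / 2 : ℝ) = -PowerSeries.C (1 / 2 : ℝ) := by
    rw [← map_neg]; norm_num
  rw [lagSeries, besselSeries_eq hb, lagSeries, Derivation.leibniz, derivative_rescale_exp, h]
  simp only [smul_eq_mul]
  ring

/-- This coefficient form of `derivative_lagSeries` becomes the Chihara recurrence at odd index. -/
lemma coeff_lagSeries_succ {b : ℝ} (hb : 0 < b) (q : ℝ) (k : ℕ) :
    2 * (k + 1) * coeff (k + 1) (lagSeries b q)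
      = q / b * coeff k (lagSeries (b + 1) q) - coeff k (lagSeries b q) := by
  have h := congrArg (coeff k) (derivative_lagSeries hb q)
  rw [coeff_derivative, map_add, coeff_C_mul, coeff_C_mul] at h
  have e : q / (2 * b) = q / b / 2 := by field_simp
  rw [e] at h
  linear_combination 2 * h

lemma coeff_zero_lagSeries (b q : ℝ) : coeff 0 (lagSeries b q) = 1 := by
  rw [lagSeries, coeff_mul]
  simp [besselSeries]

/-- This coefficient form of `lagSeries_eq` becomes the Chihara recurrence at even index. -/
lemma coeff_lagSeries_shift {b : ℝ} (hb : 0 < b) (q : ℝ) (k : ℕ) :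
    2 * b * coeff (k + 1) (lagSeries b q)
      = 2 * (k + 1 + b) * coeff (k + 1) (lagSeries (b + 1) q) + coeff k (lagSeries (b + 1) q) := by
  have h := congrArg (coeff (k + 1)) (lagSeries_eq hb q)
  rw [map_add, map_add, mul_assoc (PowerSeries.C (1 / b)), coeff_C_mul, coeff_C_mul, coeff_C_mul,
    coeff_succ_X_mul, coeff_succ_X_mul, coeff_derivative] at h
  rw [h]
  field_simp
  ring

lemma coeff_lagSeries {b : ℝ} (hb : 0 < b) (q : ℝ) (k : ℕ) :
    coeff k (lagSeries b q) = (-1 / 2) ^ k / poch b k * (lagPoly k (b - 1)).eval q := by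
  rw [lagSeries, mul_comm, coeff_mul, lag_eval, Finset.mul_sum,
    Finset.Nat.sum_antidiagonal_eq_sum_range_succ_mk]
  refine Finset.sum_congr rfl fun i hi => ?_
  have hi : i ≤ k := by simpa [Nat.lt_succ_iff] using hi
  rw [besselSeries, coeff_mk, coeff_rescale, coeff_exp, sub_add_cancel, Nat.cast_choose ℝ hi]
  obtain ⟨d, rfl⟩ := Nat.exists_eq_add_of_le hi
  have := (poch_pos hb i).ne'
  have := (poch_pos hb (i + d)).ne'
  have : (i.factorial : ℝ) ≠ 0 := by positivity
  have : (d.factorial : ℝ) ≠ 0 := by positivity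
  have : ((i + d).factorial : ℝ) ≠ 0 := by positivity
  have h1 : (-1 : ℝ) ^ i * (-1) ^ i = 1 := by rw [← mul_pow]; simp
  simp only [Nat.add_sub_cancel_left, div_pow, pow_add, map_div₀, map_one, map_natCast]
  field_simp
  linear_combination -(q ^ i) * h1

/-- The convolution of two Laguerre generating series with opposite arguments. -/
lemma sum_lagSeries (b₁ b₂ q₁ q₂ : ℝ) (k : ℕ) :
    ∑ p ∈ Finset.HasAntidiagonal.antidiagonal k,
        (-1) ^ p.1 * coeff p.1 (lagSeries b₁ q₁) * coeff p.2 (lagSeries b₂ q₂)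
      = ∑ p ∈ Finset.HasAntidiagonal.antidiagonal k, (-(q₁ / 2)) ^ p.1 / (p.1.factorial * poch b₁ p.1)
          * ((q₂ / 2) ^ p.2 / (p.2.factorial * poch b₂ p.2)) := by
  have h : rescale (-1 : ℝ) (lagSeries b₁ q₁) * lagSeries b₂ q₂
      = rescale (-1 : ℝ) (besselSeries b₁ q₁) * besselSeries b₂ q₂ := by
    -- The sign change turns exp(-u/2) into exp(u/2), so the exponential factors cancel and only the
    -- ₀F₁ series are convolved.
    have e : rescale (-1 : ℝ) (rescale (-1 / 2 : ℝ) (PowerSeries.exp ℝ))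
        * rescale (-1 / 2 : ℝ) (PowerSeries.exp ℝ) = 1 := by
      rw [rescale_rescale, exp_mul_exp_eq_exp_add]
      norm_num
    rw [lagSeries, lagSeries, map_mul]
    linear_combination (rescale (-1 : ℝ) (besselSeries b₁ q₁) * besselSeries b₂ q₂) * e
  have h := congrArg (coeff k) h
  rw [coeff_mul, coeff_mul] at h
  simp only [coeff_rescale] at h
  rw [h]
  refine Finset.sum_congr rfl fun p _ => ?_
  rw [besselSeries, besselSeries, coeff_mk, coeff_mk, neg_pow (q₁ / 2)]
  ring

/-- The Chihara polynomials divided by the square root of the `μ`-factorial. -/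
noncomputable def chiharaHat (n : ℕ) (x μ γ : ℝ) : ℝ :=
  if Even n then coeff (n / 2) (lagSeries (μ + 1 / 2) (quad γ x))
  else (x - γ) / (2 * μ + 1) * coeff (n / 2) (lagSeries (μ + 3 / 2) (quad γ x))

lemma chiharaHat_even (k : ℕ) (x μ γ : ℝ) :
    chiharaHat (2 * k) x μ γ = coeff k (lagSeries (μ + 1 / 2) (quad γ x)) := by
  simp [chiharaHat]

lemma chiharaHat_odd (k : ℕ) (x μ γ : ℝ) : chiharaHat (2 * k + 1) x μ γ
      = (x - γ) / (2 * μ + 1) * coeff k (lagSeries (μ + 3 / 2) (quad γ x)) := by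
  have h : (2 * k + 1) / 2 = k := by omega
  simp [chiharaHat, h]

end

/-- Both square roots contain k! (b)_k up to perfect squares, with b = μ + 1/2 or μ + 3/2 according
to parity. The powers of 2 match because 4^k = (2^k)^2 cancels the factor (1/2)^k of the series
coefficient. -/
lemma chihara_eq (n : ℕ) (x : ℝ) {μ : ℝ} (hμ : 0 < μ) (γ : ℝ) :
    chihara n x μ γ = √(muFactorial n μ) * chiharaHat n x μ γ := by
  rcases Nat.even_or_odd' n with ⟨k, rfl | rfl⟩
  · have hb : 0 < μ + 1 / 2 := by linarith
    have hp := poch_pos hb k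
    have hG := Real.Gamma_pos_of_pos hb
    rw [chihara_even, chiharaHat_even, coeff_lagSeries hb, muFactorial_even,
      show (k : ℝ) + μ + 1 / 2 = μ + 1 / 2 + k by ring, poch_gamma hb,
      show μ + 1 / 2 - 1 = μ - 1 / 2 by ring]
    have e1 : (k.factorial : ℝ) * Real.Gamma (μ + 1 / 2) / (poch (μ + 1 / 2) k * Real.Gamma (μ + 1 / 2))
        = k.factorial * poch (μ + 1 / 2) k / poch (μ + 1 / 2) k ^ 2 := by field_simp
    have e2 : (4 : ℝ) ^ k * k.factorial * poch (μ + 1 / 2) k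
        = k.factorial * poch (μ + 1 / 2) k * (2 ^ k) ^ 2 := by
      rw [← pow_mul, mul_comm k 2, pow_mul]; norm_num; ring
    rw [e1, e2, Real.sqrt_div' _ (by positivity), Real.sqrt_sq hp.le,
      Real.sqrt_mul' _ (by positivity : (0 : ℝ) ≤ (2 ^ k) ^ 2), Real.sqrt_sq (by positivity), div_pow]
    field_simp
  · have hb : 0 < μ + 3 / 2 := by linarith
    have hp := poch_pos hb k
    have hG := Real.Gamma_pos_of_pos hb
    have h2 : 0 < 2 * μ + 1 := by linarith
    rw [chihara_odd, chiharaHat_odd, coeff_lagSeries hb, muFactorial_odd,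
      show (k : ℝ) + μ + 3 / 2 = μ + 3 / 2 + k by ring, poch_gamma hb,
      show μ + 3 / 2 - 1 = μ + 1 / 2 by ring, poch_succ_left,
      show μ + 1 / 2 + 1 = μ + 3 / 2 by ring]
    have e1 : (k.factorial : ℝ) * Real.Gamma (μ + 3 / 2) / (poch (μ + 3 / 2) k * Real.Gamma (μ + 3 / 2))
        = k.factorial * poch (μ + 3 / 2) k / poch (μ + 3 / 2) k ^ 2 := by field_simp
    have e2 : 2 * (4 : ℝ) ^ k * k.factorial * ((μ + 1 / 2) * poch (μ + 3 / 2) k)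
        = k.factorial * poch (μ + 3 / 2) k * (2 ^ k) ^ 2 * (2 * μ + 1) := by
      rw [← pow_mul, mul_comm k 2, pow_mul]; norm_num; ring
    rw [e1, e2, Real.sqrt_div' _ (by positivity), Real.sqrt_sq hp.le,
      Real.sqrt_mul' _ h2.le,
      Real.sqrt_mul' _ (by positivity : (0 : ℝ) ≤ (2 ^ k) ^ 2), Real.sqrt_sq (by positivity), div_pow]
    have hs : √(2 * μ + 1) ^ 2 = 2 * μ + 1 := Real.sq_sqrt h2.le
    have hs' : √(2 * μ + 1) ≠ 0 := (Real.sqrt_pos.2 h2).ne'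
    have hp' := hp.ne'
    generalize √(2 * μ + 1) = s at *
    generalize poch (μ + 3 / 2) k = p at *
    generalize Polynomial.eval (quad γ x) (lagPoly k (μ + 1 / 2)) = P
    rw [← hs]
    field_simp

/-- The monic Chihara polynomials. -/
noncomputable def chiharaMonic (n : ℕ) (x μ γ : ℝ) : ℝ := muFactorial n μ * chiharaHat n x μ γ

lemma chiharaMonic_zero (x μ γ : ℝ) : chiharaMonic 0 x μ γ = 1 := by
  have := coeff_zero_lagSeries (μ + 1 / 2) (quad γ x)
  have h := chiharaHat_even 0 x μ γ
  rw [mul_zero, this] at h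
  simp [chiharaMonic, h]

/-- The recurrence of the monic Chihara polynomials. -/
lemma mul_chiharaMonic (n : ℕ) (x : ℝ) {μ : ℝ} (hμ : 0 < μ) (γ : ℝ) :
    x * chiharaMonic n x μ γ = chiharaMonic (n + 1) x μ γ + (-1) ^ n * γ * chiharaMonic n x μ γ
      + muNumber n μ * chiharaMonic (n - 1) x μ γ := by
  have hb : 0 < μ + 1 / 2 := by linarith
  have h2 : 2 * μ + 1 ≠ 0 := by positivity
  have e : μ + 3 / 2 = μ + 1 / 2 + 1 := by ring
  rcases Nat.even_or_odd' n with ⟨k, rfl | rfl⟩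
  -- At index 0 the truncated index `0 - 1` is harmless, because its coefficient `muNumber 0 μ`
  -- vanishes.
  · rcases k with _ | k
    · have h1 := chiharaHat_odd 0 x μ γ
      rw [coeff_zero_lagSeries, mul_zero, zero_add] at h1
      have h3 := muFactorial_odd 0 μ
      simp only [chiharaMonic_zero, mul_zero, zero_add] at h3 ⊢
      rw [chiharaMonic, h1, h3]
      simp [poch]
      field_simp
      ring
    · have h := coeff_lagSeries_shift hb (quad γ x) k
      rw [← e] at h
      rw [show 2 * (k + 1) - 1 = 2 * k + 1 by omega, chiharaMonic, chiharaMonic, chiharaMonic,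
        chiharaHat_odd, chiharaHat_odd, chiharaHat_even, muFactorial_succ _ μ, muNumber_odd,
        show 2 * (k + 1) = 2 * k + 1 + 1 by ring, muFactorial_succ _ μ]
      rw [show 2 * k + 1 + 1 = 2 * (k + 1) by ring, pow_mul]
      push_cast
      norm_num
      generalize PowerSeries.coeff (k + 1) (lagSeries (μ + 1 / 2) (quad γ x)) = A at *
      generalize PowerSeries.coeff (k + 1) (lagSeries (μ + 3 / 2) (quad γ x)) = B at *
      generalize PowerSeries.coeff k (lagSeries (μ + 3 / 2) (quad γ x)) = D at *
      field_simp
      linear_combination (muFactorial (2 * k + 1) μ * muNumber (2 * (k + 1)) μ * (x - γ)) * h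
  · have h := coeff_lagSeries_succ hb (quad γ x) k
    rw [← e] at h
    rw [show 2 * k + 1 - 1 = 2 * k by omega, show 2 * k + 1 + 1 = 2 * (k + 1) by ring,
      chiharaMonic, chiharaMonic, chiharaMonic, chiharaHat_odd, chiharaHat_even, chiharaHat_even,
      show 2 * (k + 1) = 2 * k + 1 + 1 by ring, muFactorial_succ (2 * k + 1), muFactorial_succ,
      show 2 * k + 1 + 1 = 2 * (k + 1) by ring, muNumber_even, pow_succ, pow_mul]
    -- At odd index the polynomial carries the factor x - γ, and moving the diagonal term to the
    -- left multiplies it by x + γ; the product is twice `quad γ x`.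
    have hq : quad γ x / (μ + 1 / 2) = (x - γ) * (x + γ) / (2 * μ + 1) := by
      rw [quad]; field_simp; ring
    rw [hq] at h
    push_cast
    norm_num
    linear_combination (-muFactorial (2 * k) μ * muNumber (2 * k + 1) μ) * h

end Osp12

namespace Osp12

/-! ### The ladder operators on the weight spaces of a tensor product -/

/-- The parity terms of consecutive μ-numbers cancel, which is why the anticommutator of the ladder
operators is scalar on each degree. -/
lemma muNumber_add_succ (n : ℕ) (μ : ℝ) :
    muNumber (n + 1) μ + muNumber n μ = 2 * n + 1 + 2 * μ := by
  simp only [muNumber, pow_succ]; push_cast; ring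

/-- The coefficients of the image of a vector of weight `M` under the raising operator. -/
def raiseCoeff (e : ℝ) (M : ℕ) (a : ℕ → ℝ) : ℕ → ℝ
  | 0 => a 0
  | n + 1 => a (n + 1) + (-1) ^ (M + n) * e * a n

/-- The coefficients of the image of a vector of weight `M` under the lowering operator. -/
noncomputable def lowerCoeff (μ₁ μ₂ e : ℝ) (M : ℕ) (a : ℕ → ℝ) (n : ℕ) : ℝ :=
  muNumber (M - n) μ₂ * a n + (-1) ^ (M + n + 1) * e * muNumber (n + 1) μ₁ * a (n + 1)

/-- The vector of weight `M` with given coefficients. -/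
def tensorSum (p q : ℕ → ℝ) (M : ℕ) (a : ℕ → ℝ) : ℝ :=
  ∑ n ∈ Finset.range (M + 1), a n * p n * q (M - n)

lemma neg_one_pow_mul_self (n : ℕ) : (-1 : ℝ) ^ n * (-1) ^ n = 1 := by
  rw [← mul_pow]; simp

/-- The off-diagonal contributions of the two orders have opposite signs and cancel, while the
diagonal ones are sums of consecutive μ-numbers. The second raising is labelled M + 1 although the
lowered vector has degree M - 1: only the parity of the label enters, and truncation at M = 0 is
avoided. The vanishing of the coefficients above M removes the terms where M - n would be truncated.
-/
lemma lowerCoeff_raiseCoeff {e : ℝ} (he : e * e = 1) (μ₁ μ₂ : ℝ) (M : ℕ) {a : ℕ → ℝ}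
    (ha : ∀ n, M < n → a n = 0) (n : ℕ) :
    lowerCoeff μ₁ μ₂ e (M + 1) (raiseCoeff e M a) n
        + raiseCoeff e (M + 1) (lowerCoeff μ₁ μ₂ e M a) n
      = 2 * (M + 1 + μ₁ + μ₂) * a n := by
  rcases n with _ | n
  · have h1 := muNumber_add_succ M μ₂
    have h2 := muNumber_add_succ 0 μ₁
    have hs := neg_one_pow_mul_self M
    simp only [lowerCoeff, raiseCoeff, Nat.sub_zero, add_zero, zero_add, pow_succ,
      muNumber_zero] at *
    push_cast at *
    linear_combination a 0 * h1 + a 0 * h2 + muNumber 1 μ₁ * a 0 * (he + (e * e) * hs)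
  · have hs := neg_one_pow_mul_self (M + n)
    have hn := muNumber_add_succ (n + 1) μ₁
    simp only [lowerCoeff, raiseCoeff]
    rw [show M + 1 - (n + 1) = M - n by omega, show M + 1 + (n + 1) + 1 = M + n + 1 + 1 + 1 by ring,
      show M + (n + 1) + 1 = M + n + 1 + 1 by ring, show M + (n + 1) = M + n + 1 by ring,
      show M + 1 + n = M + n + 1 by ring]
    simp only [pow_succ]
    rcases Nat.lt_or_ge n M with h | h
    · obtain ⟨d, rfl⟩ := Nat.exists_eq_add_of_le (Nat.succ_le_of_lt h)
      have hd := muNumber_add_succ d μ₂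
      rw [show n + 1 + d - n = d + 1 by omega, show n + 1 + d - (n + 1) = d by omega]
      push_cast at *
      linear_combination a (n + 1) * (hn + hd)
        + (muNumber (n + 1 + 1) μ₁ + muNumber (n + 1) μ₁) * a (n + 1) * (he + (e * e) * hs)
    · rw [ha (n + 1) (by omega), ha (n + 1 + 1) (by omega)]
      ring

/-- The diagonal coefficient of the recurrence of q is ± e x. Expanding x p_n by the recurrence of p
spreads this term over degrees M + 1, M and M - 1; together with q_{m+1} and q_{m-1} this gives the
three summands. The degree-M part is scalar because the signs (-1)^n and (-1)^(M-n) multiply to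
(-1)^M. -/
lemma mul_tensorSum {μ₁ μ₂ e g x y : ℝ} {p q : ℕ → ℝ}
    (hp : ∀ n, x * p n = p (n + 1) + (-1) ^ n * g * p n + muNumber n μ₁ * p (n - 1))
    (hq : ∀ n, y * q n = q (n + 1) + (-1) ^ n * (e * x) * q n + muNumber n μ₂ * q (n - 1))
    (M : ℕ) {a : ℕ → ℝ} (ha : ∀ n, M < n → a n = 0) :
    y * tensorSum p q M a = tensorSum p q (M + 1) (raiseCoeff e M a)
      + (-1) ^ M * (e * g) * tensorSum p q M a
      + tensorSum p q (M - 1) (lowerCoeff μ₁ μ₂ e M a) := by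
  have h1 : tensorSum p q (M + 1) (raiseCoeff e M a)
      = ∑ n ∈ Finset.range (M + 1), a n * p n * q (M + 1 - n)
        + ∑ n ∈ Finset.range (M + 1), (-1) ^ (M + n) * e * a n * p (n + 1) * q (M - n) := by
    have e1 : ∑ n ∈ Finset.range (M + 1), a n * p n * q (M + 1 - n)
        = ∑ n ∈ Finset.range (M + 1 + 1), a n * p n * q (M + 1 - n) := by
      rw [Finset.sum_range_succ _ (M + 1), ha (M + 1) (by omega)]; ring
    rw [e1, tensorSum, Finset.sum_range_succ', Finset.sum_range_succ' (n := M + 1),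
      add_right_comm, ← Finset.sum_add_distrib]
    congr 1
    refine Finset.sum_congr rfl fun n _ => ?_
    rw [raiseCoeff, show M + 1 - (n + 1) = M - n by omega]
    ring
  have h2 : tensorSum p q (M - 1) (lowerCoeff μ₁ μ₂ e M a)
      = ∑ n ∈ Finset.range (M + 1), muNumber (M - n) μ₂ * a n * p n * q (M - n - 1)
        + ∑ n ∈ Finset.range (M + 1), (-1) ^ (M + n) * e * muNumber n μ₁ * a n
          * p (n - 1) * q (M - n) := by
    -- In degree 0 the truncated `M - 1` is again 0, but the lowered coefficient itself is zero
    -- there.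
    rcases M with _ | M
    · simp [tensorSum, lowerCoeff, ha 1 (by omega)]
    · rw [Finset.sum_range_succ, Finset.sum_range_succ' (n := M + 1), tensorSum]
      simp only [Nat.sub_self, muNumber_zero, zero_mul, mul_zero, add_zero, Nat.add_sub_cancel]
      rw [← Finset.sum_add_distrib]
      refine Finset.sum_congr rfl fun n _ => ?_
      rw [lowerCoeff, show M + 1 - n - 1 = M - n by omega, show M + 1 - (n + 1) = M - n by omega,
        show M + 1 + n + 1 = M + 1 + (n + 1) by ring]
      ring
  rw [h1, h2, tensorSum, Finset.mul_sum, Finset.mul_sum, ← Finset.sum_add_distrib,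
    ← Finset.sum_add_distrib, ← Finset.sum_add_distrib, ← Finset.sum_add_distrib]
  refine Finset.sum_congr rfl fun n hn => ?_
  obtain ⟨d, rfl⟩ := Nat.exists_eq_add_of_le (Nat.lt_succ_iff.1 (Finset.mem_range.1 hn))
  rw [show n + d + 1 - n = d + 1 by omega, Nat.add_sub_cancel_left]
  have hs := neg_one_pow_mul_self n
  simp only [pow_add]
  linear_combination (a n * p n) * hq d + (-1) ^ d * e * a n * q d * hp n
    - (-1) ^ d * e * a n * q d * (p (n + 1) + muNumber n μ₁ * p (n - 1)) * hs

/-- The coefficients of the lowest weight vector of weight `j`. -/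
noncomputable def lowestCoeff (μ₁ μ₂ e : ℝ) (j n : ℕ) : ℝ :=
  if n ≤ j then (∏ i ∈ Finset.range n, e * (-1) ^ (j + i))
    * (muFactorial j μ₂ / (muFactorial n μ₁ * muFactorial (j - n) μ₂)) else 0

/-- The coefficients of the vectors obtained by raising the lowest weight vector. -/
noncomputable def coupledCoeff (μ₁ μ₂ e : ℝ) (j : ℕ) : ℕ → ℕ → ℝ
  | 0 => lowestCoeff μ₁ μ₂ e j
  | N + 1 => raiseCoeff e (j + N) (coupledCoeff μ₁ μ₂ e j N)

/-- Consecutive coefficients have ratio e (-1)^(j+n) [j-n] / [n+1], each bracket with its own μ. The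
lowering operator pairs them with the sign -e (-1)^(j+n), whose product with the sign of the ratio
is -1, so the two terms cancel. -/
lemma lowerCoeff_lowestCoeff {μ₁ μ₂ e : ℝ} (h₁ : 0 < μ₁) (h₂ : 0 < μ₂) (he : e * e = 1) (j n : ℕ) :
    lowerCoeff μ₁ μ₂ e j (lowestCoeff μ₁ μ₂ e j) n = 0 := by
  rcases lt_trichotomy n j with h | h | h
  · obtain ⟨d, rfl⟩ : ∃ d, j = n + 1 + d := ⟨j - (n + 1), by omega⟩
    rw [lowerCoeff, lowestCoeff, lowestCoeff, if_pos (by omega), if_pos (by omega),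
      Finset.prod_range_succ, show n + 1 + d - n = d + 1 by omega,
      show n + 1 + d - (n + 1) = d by omega, muFactorial_succ, muFactorial_succ]
    have := (muFactorial_pos n h₁).ne'
    have := (muFactorial_pos d h₂).ne'
    have := (muNumber_pos n h₁).ne'
    have := (muNumber_pos d h₂).ne'
    have hs := neg_one_pow_mul_self (n + 1 + d + n)
    rw [pow_succ]
    field_simp
    linear_combination (-(∏ i ∈ Finset.range n, e * (-1) ^ (n + 1 + d + i))
      * muFactorial (n + 1 + d) μ₂) * (he + (e * e) * hs)
  · subst h
    simp [lowerCoeff, lowestCoeff]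
  · rw [lowerCoeff, lowestCoeff, lowestCoeff, if_neg (by omega), if_neg (by omega)]
    ring

lemma coupledCoeff_of_lt (μ₁ μ₂ e : ℝ) (j N n : ℕ) (h : j + N < n) :
    coupledCoeff μ₁ μ₂ e j N n = 0 := by
  induction N generalizing n with
  | zero => rw [coupledCoeff, lowestCoeff, if_neg (by omega)]
  | succ N ih =>
    obtain ⟨n, rfl⟩ : ∃ m, n = m + 1 := ⟨n - 1, by omega⟩
    rw [coupledCoeff, raiseCoeff, ih _ (by omega), ih _ (by omega)]
    ring

lemma coupledCoeff_zero_right (μ₁ : ℝ) {μ₂ : ℝ} (h₂ : 0 < μ₂) (e : ℝ) (j N : ℕ) :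
    coupledCoeff μ₁ μ₂ e j N 0 = 1 := by
  induction N with
  | zero =>
    have := (muFactorial_pos j h₂).ne'
    simp [coupledCoeff, lowestCoeff, this]
  | succ N ih => rw [coupledCoeff, raiseCoeff, ih]

/-- The anticommutator on degree j + N is 2N + 1 + 2μ, where μ = μ₁ + μ₂ + j + 1/2 is the coupled
label. Subtracting the factor [N] from lowering one step earlier leaves [N + 1], because consecutive
μ-numbers add up to exactly that scalar. -/
lemma lowerCoeff_coupledCoeff {μ₁ μ₂ e : ℝ} (h₁ : 0 < μ₁) (h₂ : 0 < μ₂) (he : e * e = 1)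
    (j N n : ℕ) :
    lowerCoeff μ₁ μ₂ e (j + N + 1) (coupledCoeff μ₁ μ₂ e j (N + 1)) n
      = muNumber (N + 1) (μ₁ + μ₂ + j + 1 / 2) * coupledCoeff μ₁ μ₂ e j N n := by
  induction N generalizing n with
  | zero =>
    have h := lowerCoeff_raiseCoeff he μ₁ μ₂ j
      (fun n hn => coupledCoeff_of_lt μ₁ μ₂ e j 0 n (by omega)) n
    have h0 : raiseCoeff e (j + 1) (lowerCoeff μ₁ μ₂ e j (coupledCoeff μ₁ μ₂ e j 0)) n = 0 := by
      have : lowerCoeff μ₁ μ₂ e j (coupledCoeff μ₁ μ₂ e j 0) = fun _ => 0 :=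
        funext fun n => lowerCoeff_lowestCoeff h₁ h₂ he j n
      rw [this]
      cases n <;> simp [raiseCoeff]
    have hN := muNumber_odd 0 (μ₁ + μ₂ + j + 1 / 2)
    rw [h0] at h
    simp only [mul_zero, zero_add, add_zero, Nat.cast_zero] at hN ⊢
    change lowerCoeff μ₁ μ₂ e (j + 1) (raiseCoeff e j (coupledCoeff μ₁ μ₂ e j 0)) n
      = _ * coupledCoeff μ₁ μ₂ e j 0 n
    rw [hN]
    linear_combination h
  | succ N ih =>
    have h := lowerCoeff_raiseCoeff he μ₁ μ₂ (j + (N + 1))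
      (fun n hn => coupledCoeff_of_lt μ₁ μ₂ e j (N + 1) n (by omega)) n
    have h0 : raiseCoeff e (j + (N + 1) + 1)
        (lowerCoeff μ₁ μ₂ e (j + (N + 1)) (coupledCoeff μ₁ μ₂ e j (N + 1))) n
        = muNumber (N + 1) (μ₁ + μ₂ + j + 1 / 2) * coupledCoeff μ₁ μ₂ e j (N + 1) n := by
      have : lowerCoeff μ₁ μ₂ e (j + (N + 1)) (coupledCoeff μ₁ μ₂ e j (N + 1))
          = fun n => muNumber (N + 1) (μ₁ + μ₂ + j + 1 / 2) * coupledCoeff μ₁ μ₂ e j N n :=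
        funext ih
      rw [this]
      rcases n with _ | n
      · simp only [coupledCoeff, raiseCoeff]
      · simp only [coupledCoeff, raiseCoeff]
        rw [show j + (N + 1) + 1 + n = j + N + n + 1 + 1 by ring, pow_succ, pow_succ]
        ring
    have hN := muNumber_add_succ (N + 1) (μ₁ + μ₂ + j + 1 / 2)
    rw [h0] at h
    rw [coupledCoeff.eq_2 _ _ _ _ (N + 1)]
    push_cast at h hN
    linear_combination h - coupledCoeff μ₁ μ₂ e j (N + 1) n * hN

/-- The vectors of a coupled representation are the lowest weight vector times the Chihara
polynomials of the coupled parameters. -/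
lemma tensorSum_coupledCoeff {μ₁ μ₂ e : ℝ} (h₁ : 0 < μ₁) (h₂ : 0 < μ₂) (he : e * e = 1)
    (g x y : ℝ) (j N : ℕ) :
    tensorSum (chiharaMonic · x μ₁ g) (chiharaMonic · y μ₂ (e * x)) (j + N)
        (coupledCoeff μ₁ μ₂ e j N)
      = tensorSum (chiharaMonic · x μ₁ g) (chiharaMonic · y μ₂ (e * x)) j (lowestCoeff μ₁ μ₂ e j)
        * chiharaMonic N y (μ₁ + μ₂ + j + 1 / 2) (e * g * (-1) ^ j) := by
  have hμ : 0 < μ₁ + μ₂ + j + 1 / 2 := by positivity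
  have key := fun N => mul_tensorSum (p := (chiharaMonic · x μ₁ g))
    (q := (chiharaMonic · y μ₂ (e * x)))
    (fun n => mul_chiharaMonic n x h₁ g) (fun n => mul_chiharaMonic n y h₂ (e * x)) (j + N)
    (coupledCoeff_of_lt μ₁ μ₂ e j N)
  have hr := fun N => mul_chiharaMonic N y hμ (e * g * (-1) ^ j)
  -- As functions of N, both sides satisfy the same three-term recurrence under multiplication by y:
  -- the left by raising and lowering, the right by the Chihara recurrence. They agree at N = 0.
  induction N using Nat.twoStepInduction with
  | zero => simp [chiharaMonic_zero, coupledCoeff]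
  | one =>
    have k0 := key 0
    have r0 := hr 0
    have hl : lowerCoeff μ₁ μ₂ e (j + 0) (coupledCoeff μ₁ μ₂ e j 0) = fun _ => 0 :=
      funext fun n => lowerCoeff_lowestCoeff h₁ h₂ he j n
    rw [hl] at k0
    simp only [tensorSum, zero_mul, Finset.sum_const_zero, chiharaMonic_zero, muNumber_zero,
      add_zero, zero_add, pow_zero, mul_one, one_mul] at k0 r0 ⊢
    have e1 : coupledCoeff μ₁ μ₂ e j 1 = raiseCoeff e j (lowestCoeff μ₁ μ₂ e j) := rfl
    rw [e1]
    rw [coupledCoeff] at k0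
    linear_combination -k0 + (∑ n ∈ Finset.range (j + 1),
      lowestCoeff μ₁ μ₂ e j n * chiharaMonic n x μ₁ g * chiharaMonic (j - n) y μ₂ (e * x)) * r0
  | more N ih ih' =>
    have k := key (N + 1)
    have r := hr (N + 1)
    have hl : lowerCoeff μ₁ μ₂ e (j + (N + 1)) (coupledCoeff μ₁ μ₂ e j (N + 1))
        = fun n => muNumber (N + 1) (μ₁ + μ₂ + j + 1 / 2) * coupledCoeff μ₁ μ₂ e j N n :=
      funext fun n => lowerCoeff_coupledCoeff h₁ h₂ he j N n
    have hm : tensorSum (chiharaMonic · x μ₁ g) (chiharaMonic · y μ₂ (e * x)) (j + (N + 1) - 1)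
        (fun n => muNumber (N + 1) (μ₁ + μ₂ + j + 1 / 2) * coupledCoeff μ₁ μ₂ e j N n)
        = muNumber (N + 1) (μ₁ + μ₂ + j + 1 / 2) * tensorSum (chiharaMonic · x μ₁ g)
          (chiharaMonic · y μ₂ (e * x)) (j + N) (coupledCoeff μ₁ μ₂ e j N) := by
      rw [show j + (N + 1) - 1 = j + N by omega, tensorSum, tensorSum, Finset.mul_sum]
      exact Finset.sum_congr rfl fun n _ => by ring
    rw [hl, hm, ih, ih', pow_add (-1 : ℝ) j] at k
    rw [Nat.add_sub_cancel] at r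
    rw [show j + (N + 2) = j + (N + 1) + 1 by ring, coupledCoeff.eq_2 _ _ _ _ (N + 1)]
    linear_combination -k + tensorSum (chiharaMonic · x μ₁ g) (chiharaMonic · y μ₂ (e * x)) j
      (lowestCoeff μ₁ μ₂ e j) * r

end Osp12

namespace Osp12

/-! ### The recurrence of the dual -1 Hahn polynomials -/

lemma poch_eq_prod (a : ℝ) (n : ℕ) : poch a n = ∏ i ∈ Finset.range n, (a + i) := by
  induction n with
  | zero => simp
  | succ n ih => rw [poch_succ, ih, Finset.prod_range_succ]

lemma poch_ne_zero_of_lt {a : ℝ} {n : ℕ} (h : a + n < 1) : poch a n ≠ 0 := by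
  rw [poch_eq_prod]
  refine Finset.prod_ne_zero_iff.2 fun i hi => ne_of_lt ?_
  have : ((i + 1 : ℕ) : ℝ) ≤ n := Nat.cast_le.2 (Finset.mem_range.1 hi)
  push_cast at this
  linarith

/-- The terminating series `16^k (a)_k (b)_k ₃F₂(-k, δ + t, δ - t; a, b; 1)` with denominators
cleared. -/
noncomputable def hahnPoly (a b δ t : ℝ) (k : ℕ) : ℝ :=
  16 ^ k * ∑ i ∈ Finset.range (k + 1), (-1) ^ i * (k.choose i : ℝ)
    * (poch (a + i) (k - i) * poch (b + i) (k - i)) * (poch (δ + t) i * poch (δ - t) i)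

lemma hahnPoly_comm (a b δ t : ℝ) (k : ℕ) : hahnPoly a b δ t k = hahnPoly b a δ t k := by
  simp only [hahnPoly, mul_comm (poch (a + _) _)]

lemma hahnPoly_zero (a b δ t : ℝ) : hahnPoly a b δ t 0 = 1 := by simp [hahnPoly]

/-- Nonvanishing of (a)_k and (b)_k makes all denominators up to index k nonzero, and (-k)_i = 0
ends the series after that. -/
lemma pFq_eq_hahnPoly {a b : ℝ} (δ t : ℝ) {k : ℕ} (ha : poch a k ≠ 0) (hb : poch b k ≠ 0) :
    16 ^ k * poch a k * poch b k * pFq [-(k : ℝ), δ + t, δ - t] [a, b] 1 = hahnPoly a b δ t k := by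
  unfold pFq hahnPoly
  rw [tsum_eq_sum (s := Finset.range (k + 1)), mul_assoc, mul_assoc, Finset.mul_sum, Finset.mul_sum]
  · refine congrArg _ (Finset.sum_congr rfl fun i hi => ?_)
    obtain ⟨d, rfl⟩ := Nat.exists_eq_add_of_le (Nat.lt_succ_iff.1 (Finset.mem_range.1 hi))
    rw [poch_add] at ha hb
    have := left_ne_zero_of_mul ha
    have := left_ne_zero_of_mul hb
    rw [← poch_neg, Nat.add_sub_cancel_left, poch_add a, poch_add b]
    have : (i.factorial : ℝ) ≠ 0 := by positivity
    simp only [List.map_cons, List.map_nil, List.prod_cons, List.prod_nil, mul_one, one_pow]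
    field_simp
  · intro i hi
    have hi' : k < i := by simpa using hi
    have : poch (-(k : ℝ)) i = 0 := ascPochhammer_eval_neg_coe_nat_of_lt hi'
    simp [this]

/-- The i-th terms differ only in (a+i)_{d+1} against (a+1+i)_{d+1}, with d = k - i. These share the
factor (a+1+i)_d, and their difference supplies the factor d + 1 that lowers the binomial
coefficient. -/
lemma hahnPoly_sub (a b δ t : ℝ) (k : ℕ) :
    hahnPoly a b δ t (k + 1) - hahnPoly (a + 1) b δ t (k + 1)
      = -(16 * (k + 1) * (b + k)) * hahnPoly (a + 1) b δ t k := by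
  suffices h : ∑ i ∈ Finset.range (k + 1 + 1), ((-1) ^ i * ((k + 1).choose i : ℝ)
        * (poch (a + i) (k + 1 - i) * poch (b + i) (k + 1 - i)) * (poch (δ + t) i * poch (δ - t) i)
      - (-1) ^ i * ((k + 1).choose i : ℝ) * (poch (a + 1 + i) (k + 1 - i)
        * poch (b + i) (k + 1 - i)) * (poch (δ + t) i * poch (δ - t) i))
      = ∑ i ∈ Finset.range (k + 1), -((k + 1) * (b + k)) * ((-1) ^ i * (k.choose i : ℝ)
        * (poch (a + 1 + i) (k - i) * poch (b + i) (k - i)) * (poch (δ + t) i * poch (δ - t) i)) by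
    rw [Finset.sum_sub_distrib, ← Finset.mul_sum] at h
    rw [hahnPoly, hahnPoly, hahnPoly]
    linear_combination (16 : ℝ) ^ (k + 1) * h
  rw [Finset.sum_range_succ, Nat.sub_self]
  simp only [poch_zero, sub_self, add_zero]
  refine Finset.sum_congr rfl fun i hi => ?_
  obtain ⟨d, rfl⟩ := Nat.exists_eq_add_of_le (Nat.lt_succ_iff.1 (Finset.mem_range.1 hi))
  have hc : ((i + d + 1).choose i : ℝ) * (d + 1) = (i + d).choose i * (i + d + 1) := by
    have h := Nat.add_one_mul_choose_eq (i + d) d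
    have e1 : (i + d).choose i = (i + d).choose d := (Nat.choose_symm_add).symm ▸ rfl
    have e2 : (i + d + 1).choose i = (i + d + 1).choose (d + 1) := by
      rw [add_assoc]; exact Nat.choose_symm_add
    rw [e1, e2]
    have h' : ((i + d + 1 : ℕ) : ℝ) * (i + d).choose d = (i + d + 1).choose (d + 1) * (d + 1 : ℕ) := by
      exact_mod_cast h
    push_cast at h'
    linarith
  rw [show i + d + 1 - i = d + 1 by omega, show i + d - i = d by omega, poch_succ_left (a + i),
    poch_succ (a + 1 + i), poch_succ (b + i), show a + (i : ℝ) + 1 = a + 1 + i by ring]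
  push_cast
  linear_combination (-(-1) ^ i * poch (a + 1 + i) d * poch (b + i) d
    * (poch (δ + t) i * poch (δ - t) i) * (b + i + d)) * hc

/-- This is the companion of `hahnPoly_sub`, going from parameter a + 1 back to a. With 4t = x + 1,
the factor 16 (t² - (δ-a)²) splits into x + 1 - 4(δ-a) and x + 1 + 4(δ-a); in the application 4(δ-a)
is `dualHahnShift`, and the first factor is the linear one carried by the odd-degree polynomials. -/
lemma hahnPoly_succ (a b δ t : ℝ) (k : ℕ) :
    hahnPoly a b δ t (k + 1) = 16 * (t ^ 2 - (δ - a) ^ 2) * hahnPoly (a + 1) b δ t k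
      - 16 * (a + k) * (2 * δ - a - b - k) * hahnPoly a b δ t k := by
  set D : ℕ → ℝ := fun i => poch (δ + t) i * poch (δ - t) i with hD
  have hDs : ∀ i, D (i + 1) = D i * ((δ + i) ^ 2 - t ^ 2) := fun i => by
    simp only [hD, poch_succ]; ring
  -- Both sides are brought to one common difference of two sums: the right side termwise through
  -- D_{i+1} = D_i ((δ+i)² - t²), the left side in `hL` through Pascal's rule.
  have hR : (t ^ 2 - (δ - a) ^ 2) * (∑ i ∈ Finset.range (k + 1), (-1) ^ i * (k.choose i : ℝ)
        * (poch (a + 1 + i) (k - i) * poch (b + i) (k - i)) * D i)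
      - (a + k) * (2 * δ - a - b - k) * (∑ i ∈ Finset.range (k + 1), (-1) ^ i * (k.choose i : ℝ)
        * (poch (a + i) (k - i) * poch (b + i) (k - i)) * D i)
      = ∑ i ∈ Finset.range (k + 1), (-1) ^ i * (k.choose i : ℝ)
        * (poch (a + i) (k + 1 - i) * poch (b + i) (k - i)) * (i + b + k) * D i
      - ∑ i ∈ Finset.range (k + 1), (-1) ^ i * (k.choose i : ℝ)
        * (poch (a + 1 + i) (k - i) * poch (b + i) (k - i)) * D (i + 1) := by
    rw [Finset.mul_sum, Finset.mul_sum, ← Finset.sum_sub_distrib, ← Finset.sum_sub_distrib]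
    refine Finset.sum_congr rfl fun i hi => ?_
    obtain ⟨d, rfl⟩ := Nat.exists_eq_add_of_le (Nat.lt_succ_iff.1 (Finset.mem_range.1 hi))
    have h1 := poch_succ (a + i) d
    have h2 := poch_succ_left (a + i) d
    rw [show a + (i : ℝ) + 1 = a + 1 + i by ring] at h2
    rw [hDs, show i + d + 1 - i = d + 1 by omega, show i + d - i = d by omega]
    push_cast
    linear_combination ((-1) ^ i * ((i + d).choose i : ℝ) * poch (b + i) d * D i)
      * ((2 * δ - a - b - i - d) * h1 - (i + 2 * δ - a) * h2)
  have hL : ∑ i ∈ Finset.range (k + 1 + 1), (-1) ^ i * ((k + 1).choose i : ℝ)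
        * (poch (a + i) (k + 1 - i) * poch (b + i) (k + 1 - i)) * D i
      = ∑ i ∈ Finset.range (k + 1), (-1) ^ i * (k.choose i : ℝ)
        * (poch (a + i) (k + 1 - i) * poch (b + i) (k - i)) * (i + b + k) * D i
      - ∑ i ∈ Finset.range (k + 1), (-1) ^ i * (k.choose i : ℝ)
        * (poch (a + 1 + i) (k - i) * poch (b + i) (k - i)) * D (i + 1) := by
    rw [Finset.sum_range_succ, Finset.sum_range_succ', Finset.sum_range_succ' (n := k),
      Finset.sum_range_succ (n := k)]
    have hs : ∀ i ∈ Finset.range k, (-1) ^ (i + 1) * ((k + 1).choose (i + 1) : ℝ)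
          * (poch (a + (i + 1 : ℕ)) (k + 1 - (i + 1)) * poch (b + (i + 1 : ℕ)) (k + 1 - (i + 1)))
          * D (i + 1)
        = (-1) ^ (i + 1) * (k.choose (i + 1) : ℝ)
          * (poch (a + (i + 1 : ℕ)) (k + 1 - (i + 1)) * poch (b + (i + 1 : ℕ)) (k - (i + 1)))
          * ((i + 1 : ℕ) + b + k) * D (i + 1)
        - (-1) ^ i * (k.choose i : ℝ) * (poch (a + 1 + i) (k - i) * poch (b + i) (k - i))
          * D (i + 1) := by
      intro i hi
      obtain ⟨d, rfl⟩ : ∃ d, k = i + 1 + d := ⟨k - (i + 1), by have := Finset.mem_range.1 hi; omega⟩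
      have h1 := poch_succ (b + (i + 1)) d
      have h2 := poch_succ_left (b + i) d
      rw [add_assoc b] at h2
      have hc := Nat.choose_succ_right_eq (i + 1 + d) i
      rw [show i + 1 + d - i = d + 1 by omega] at hc
      have hc' : ((i + 1 + d).choose (i + 1) : ℝ) * (i + 1) = (i + 1 + d).choose i * (d + 1) := by
        exact_mod_cast hc
      rw [Nat.choose_succ_succ, show i + 1 + d + 1 - (i + 1) = d + 1 by omega,
        show i + 1 + d - (i + 1) = d by omega, show i + 1 + d - i = d + 1 by omega]
      push_cast
      rw [h1, h2, show a + 1 + (i : ℝ) = a + (i + 1) by ring, pow_succ]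
      linear_combination ((-1) ^ i * poch (a + (i + 1)) (d + 1) * poch (b + (i + 1)) d
        * D (i + 1)) * hc'
    rw [Finset.sum_congr rfl hs, Finset.sum_sub_distrib]
    simp only [Nat.sub_self, Nat.sub_zero, poch_zero, Nat.choose_self, Nat.choose_zero_right,
      Nat.cast_one, Nat.cast_zero, add_zero, zero_add, pow_zero, poch_succ b, pow_succ]
    ring
  rw [hahnPoly, hL, ← hR, hahnPoly, hahnPoly]
  ring

/-! ### The dual -1 Hahn polynomials in terms of the cleared ₃F₂ series -/

variable {η ξ : ℝ}

lemma dualHahn_even_even (hη : 0 < η) (x : ℝ) {m k : ℕ} (hk : k ≤ m) :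
    dualHahn (2 * k) x η ξ (2 * m)
      = hahnPoly (-m) (1 / 2 - η - m) (-(η + ξ) / 2 - m) ((x + 1) / 4) k := by
  have hk' : (k : ℝ) ≤ m := Nat.cast_le.2 hk
  rw [← pFq_eq_hahnPoly _ _ (poch_ne_zero_of_lt (by linarith)) (poch_ne_zero_of_lt (by linarith))]
  simp only [dualHahn, even_two_mul, if_true, Nat.mul_div_cancel_left _ (Nat.succ_pos 1)]
  push_cast
  rw [show -(2 * (m : ℝ) / 2) = -m by ring, show (1 - 2 * η - 2 * (m : ℝ)) / 2 = 1 / 2 - η - m by ring,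
    show -((η + ξ + 2 * (m : ℝ)) / 2) = -(η + ξ) / 2 - m by ring]

lemma dualHahn_odd_even (hη : 0 < η) (x : ℝ) {m k : ℕ} (hk : k < m) :
    dualHahn (2 * k + 1) x η ξ (2 * m) = (x + 2 * η + 2 * ξ + 1)
      * hahnPoly (-m + 1) (1 / 2 - η - m) (-(η + ξ) / 2 - m) ((x + 1) / 4) k := by
  have hk' : ((k + 1 : ℕ) : ℝ) ≤ m := Nat.cast_le.2 hk
  push_cast at hk'
  rw [← pFq_eq_hahnPoly _ _ (poch_ne_zero_of_lt (by linarith)) (poch_ne_zero_of_lt (by linarith))]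
  have h1 : (2 * k + 1) / 2 = k := by omega
  have h2 : ¬ Even (2 * k + 1) := by simp
  simp only [dualHahn, even_two_mul, if_true, h1, h2, if_false]
  push_cast
  rw [show 1 - 2 * (m : ℝ) / 2 = -m + 1 by ring,
    show (1 - 2 * η - 2 * (m : ℝ)) / 2 = 1 / 2 - η - m by ring,
    show -((η + ξ + 2 * (m : ℝ)) / 2) = -(η + ξ) / 2 - m by ring]
  ring

/-- For odd N the roles of the lower parameters are exchanged: -m stays fixed and ξ + 1/2 is raised
at odd degree. The swap puts the raised parameter first, as for even N, so the same two contiguous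
relations serve both parities. -/
lemma dualHahn_even_odd (hξ : 0 < ξ) (x : ℝ) {m k : ℕ} (hk : k ≤ m) :
    dualHahn (2 * k) x η ξ (2 * m + 1)
      = hahnPoly (ξ + 1 / 2) (-m) ((η + ξ + 1) / 2) ((x + 1) / 4) k := by
  have hk' : (k : ℝ) ≤ m := Nat.cast_le.2 hk
  rw [hahnPoly_comm, ← pFq_eq_hahnPoly _ _ (poch_ne_zero_of_lt (by linarith))
    (poch_pos (by linarith) _).ne']
  have h2 : ¬ Even (2 * m + 1) := by simp
  simp only [dualHahn, even_two_mul, if_true, h2, if_false, Nat.mul_div_cancel_left _ (Nat.succ_pos 1)]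
  push_cast
  rw [show (1 - (2 * (m : ℝ) + 1)) / 2 = -m by ring, show (2 * ξ + 1) / 2 = ξ + 1 / 2 by ring]

lemma dualHahn_odd_odd (hξ : 0 < ξ) (x : ℝ) {m k : ℕ} (hk : k ≤ m) :
    dualHahn (2 * k + 1) x η ξ (2 * m + 1) = (x + 2 * ξ - 2 * η + 1)
      * hahnPoly (ξ + 1 / 2 + 1) (-m) ((η + ξ + 1) / 2) ((x + 1) / 4) k := by
  have hk' : (k : ℝ) ≤ m := Nat.cast_le.2 hk
  rw [hahnPoly_comm, ← pFq_eq_hahnPoly _ _ (poch_ne_zero_of_lt (by linarith))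
    (poch_pos (by linarith) _).ne']
  have h1 : (2 * k + 1) / 2 = k := by omega
  have h2 : ¬ Even (2 * m + 1) := by simp
  have h3 : ¬ Even (2 * k + 1) := by simp
  simp only [dualHahn, h1, h2, h3, if_false]
  push_cast
  rw [show (1 - (2 * (m : ℝ) + 1)) / 2 = -m by ring, show (2 * ξ + 3) / 2 = ξ + 1 / 2 + 1 by ring]
  ring

/-- The diagonal coefficient of the recurrence of the dual -1 Hahn polynomials, up to sign. -/
noncomputable def dualHahnShift (η ξ : ℝ) (M : ℕ) : ℝ := 2 * (-1) ^ (M + 1) * η - 2 * ξ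

lemma dualHahnShift_even (η ξ : ℝ) (m : ℕ) : dualHahnShift η ξ (2 * m) = -2 * (η + ξ) := by
  rw [dualHahnShift, Odd.neg_one_pow ⟨m, rfl⟩]; ring

lemma dualHahnShift_odd (η ξ : ℝ) (m : ℕ) : dualHahnShift η ξ (2 * m + 1) = 2 * (η - ξ) := by
  rw [dualHahnShift, Even.neg_one_pow ⟨m + 1, by ring⟩]; ring

lemma dualHahn_zero (hη : 0 < η) (hξ : 0 < ξ) (x : ℝ) (M : ℕ) : dualHahn 0 x η ξ M = 1 := by
  rcases Nat.even_or_odd' M with ⟨m, rfl | rfl⟩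
  · have h := dualHahn_even_even (ξ := ξ) hη x (Nat.zero_le m)
    rwa [hahnPoly_zero] at h
  · have h := dualHahn_even_odd (η := η) hξ x (Nat.zero_le m)
    rwa [hahnPoly_zero] at h

lemma dualHahn_one (hη : 0 < η) (hξ : 0 < ξ) (x : ℝ) {M : ℕ} (hM : 1 ≤ M) :
    dualHahn 1 x η ξ M = x + 1 - dualHahnShift η ξ M := by
  rcases Nat.even_or_odd' M with ⟨m, rfl | rfl⟩
  · have h := dualHahn_odd_even (ξ := ξ) hη x (by omega : 0 < m)
    rw [hahnPoly_zero] at h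
    rw [dualHahnShift_even]
    linear_combination h
  · have h := dualHahn_odd_odd (η := η) hξ x (Nat.zero_le m)
    rw [hahnPoly_zero] at h
    rw [dualHahnShift_odd]
    linear_combination h

/-- The three-term recurrence of the dual -1 Hahn polynomials. -/
lemma dualHahn_recurrence (hη : 0 < η) (hξ : 0 < ξ) (x : ℝ) {M n : ℕ} (hn : n + 2 ≤ M) :
    (x + 1) * dualHahn (n + 1) x η ξ M = dualHahn (n + 2) x η ξ M
      + (-1) ^ (n + 1) * dualHahnShift η ξ M * dualHahn (n + 1) x η ξ M
      + 4 * muNumber (n + 1) ξ * muNumber (M - n) η * dualHahn n x η ξ M := by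
  -- The parity of M decides which lower parameter is raised, and the parity of n which relation
  -- applies: `hahnPoly_succ` for n even, `hahnPoly_sub` for n odd.
  rcases Nat.even_or_odd' M with ⟨m, rfl | rfl⟩ <;> rcases Nat.even_or_odd' n with ⟨k, rfl | rfl⟩
  · obtain ⟨d, rfl⟩ : ∃ d, m = k + 1 + d := ⟨m - (k + 1), by omega⟩
    have h := hahnPoly_succ (-((k + 1 + d : ℕ) : ℝ)) (1 / 2 - η - (k + 1 + d : ℕ))
      (-(η + ξ) / 2 - (k + 1 + d : ℕ)) ((x + 1) / 4) k
    rw [show 2 * k + 2 = 2 * (k + 1) by ring, dualHahn_even_even hη _ (by omega),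
      dualHahn_even_even hη _ (by omega), dualHahn_odd_even hη _ (by omega), h, dualHahnShift_even,
      show 2 * (k + 1 + d) - 2 * k = 2 * (d + 1) by omega, muNumber_even, muNumber_odd,
      Odd.neg_one_pow ⟨k, rfl⟩]
    push_cast
    ring
  · obtain ⟨d, rfl⟩ : ∃ d, m = k + 2 + d := ⟨m - (k + 2), by omega⟩
    have h := hahnPoly_sub (-((k + 2 + d : ℕ) : ℝ)) (1 / 2 - η - (k + 2 + d : ℕ))
      (-(η + ξ) / 2 - (k + 2 + d : ℕ)) ((x + 1) / 4) k
    rw [show 2 * k + 1 + 2 = 2 * (k + 1) + 1 by ring, show 2 * k + 1 + 1 = 2 * (k + 1) by ring,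
      dualHahn_even_even hη _ (by omega),
      dualHahn_odd_even hη _ (by omega), dualHahn_odd_even hη _ (by omega), dualHahnShift_even,
      show 2 * (k + 2 + d) - (2 * k + 1) = 2 * (d + 1) + 1 by omega, muNumber_even, muNumber_odd,
      Even.neg_one_pow (even_two_mul _)]
    push_cast at h ⊢
    linear_combination (x + 2 * η + 2 * ξ + 1) * h
  · obtain ⟨d, rfl⟩ : ∃ d, m = k + 1 + d := ⟨m - (k + 1), by omega⟩
    have h := hahnPoly_succ (ξ + 1 / 2) (-((k + 1 + d : ℕ) : ℝ))
      ((η + ξ + 1) / 2) ((x + 1) / 4) k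
    rw [show 2 * k + 2 = 2 * (k + 1) by ring, dualHahn_even_odd hξ _ (by omega),
      dualHahn_even_odd hξ _ (by omega), dualHahn_odd_odd hξ _ (by omega), h, dualHahnShift_odd,
      show 2 * (k + 1 + d) + 1 - 2 * k = 2 * (d + 1) + 1 by omega, muNumber_odd, muNumber_odd,
      Odd.neg_one_pow ⟨k, rfl⟩]
    push_cast
    ring
  · obtain ⟨d, rfl⟩ : ∃ d, m = k + 1 + d := ⟨m - (k + 1), by omega⟩
    have h := hahnPoly_sub (ξ + 1 / 2) (-((k + 1 + d : ℕ) : ℝ))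
      ((η + ξ + 1) / 2) ((x + 1) / 4) k
    rw [show 2 * k + 1 + 2 = 2 * (k + 1) + 1 by ring, show 2 * k + 1 + 1 = 2 * (k + 1) by ring,
      dualHahn_even_odd hξ _ (by omega),
      dualHahn_odd_odd hξ _ (by omega), dualHahn_odd_odd hξ _ (by omega), dualHahnShift_odd,
      show 2 * (k + 1 + d) + 1 - (2 * k + 1) = 2 * (d + 1) by omega, muNumber_even, muNumber_even,
      Even.neg_one_pow (even_two_mul _)]
    push_cast at h ⊢
    linear_combination (x + 2 * ξ - 2 * η + 1) * h

/-- The coefficients of a coupled vector are dual -1 Hahn polynomials. -/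
lemma coupledCoeff_eq_dualHahn (hη : 0 < η) (hξ : 0 < ξ) {e : ℝ} (he : e * e = 1) (j N n : ℕ)
    (hn : n ≤ j + N) :
    coupledCoeff ξ η e j N n = (-1) ^ (n * (n - 1) / 2 + n * (j + N + 1)) * (e / 2) ^ n
      / muFactorial n ξ * dualHahn n (dualHahnGrid j η ξ (j + N)) η ξ (j + N) := by
  -- Lowering after raising is tridiagonal in n, and the coupled vector is an eigenvector of it. As
  -- [n + 1] is nonzero and the coefficient at 0 is 1, this recurrence determines every coefficient.
  have hw := lowerCoeff_coupledCoeff hξ hη he j N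
  simp only [coupledCoeff] at hw
  -- At the grid point z_j the diagonal term of the dual -1 Hahn recurrence is twice the diagonal
  -- term of the eigenvector equation, eigenvalue included. Only the parities of n, d and j matter
  -- for the signs, hence the eight cases.
  have hX : ∀ n d : ℕ, n + d = j + N → dualHahnGrid j η ξ (j + N) + 1
      - (-1) ^ n * dualHahnShift η ξ (j + N)
      = 2 * muNumber (d + 1) η + 2 * muNumber (n + 1) ξ
        - 2 * muNumber (N + 1) (ξ + η + j + 1 / 2) := by
    intro n d h
    have hN : (N : ℝ) = n + d - j := by
      have : (n + d : ℝ) = j + N := by exact_mod_cast h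
      linarith
    have hp : (-1 : ℝ) ^ N = (-1) ^ n * (-1) ^ d * (-1) ^ j := by
      rw [← pow_add (-1 : ℝ) n, h, pow_add, mul_right_comm, neg_one_pow_mul_self, one_mul]
    rw [dualHahnGrid, dualHahnShift]
    simp only [muNumber, pow_add, pow_one]
    push_cast
    rw [hp, hN]
    rcases neg_one_pow_eq_or ℝ n with h1 | h1 <;> rcases neg_one_pow_eq_or ℝ d with h2 | h2 <;>
      rcases neg_one_pow_eq_or ℝ j with h3 | h3 <;> rw [h1, h2, h3] <;> ring
  induction n using Nat.twoStepInduction with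
  | zero => simp [coupledCoeff_zero_right ξ hη, dualHahn_zero hη hξ]
  | one =>
    obtain ⟨d, hd⟩ : ∃ d, j + N = d + 1 := ⟨j + N - 1, by omega⟩
    have h0 := hw 0
    have hX0 := hX 0 (j + N) (by ring)
    have h1 := (muNumber_pos 0 hξ).ne'
    simp only [lowerCoeff, raiseCoeff, coupledCoeff_zero_right ξ hη, Nat.sub_zero, pow_zero,
      zero_add, add_zero, pow_succ] at h0 hX0 h1
    rw [dualHahn_one hη hξ _ hn, muFactorial_succ, muFactorial_zero]
    have hs := neg_one_pow_mul_self (j + N)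
    simp only [pow_succ, Nat.sub_self, mul_zero, Nat.zero_div, zero_add, one_mul, pow_zero]
    field_simp
    generalize (-1 : ℝ) ^ (j + N) = s at *
    linear_combination (2 * s * e) * h0 + (s * e) * hX0
      - 2 * muNumber 1 ξ * (coupledCoeff ξ η e j N 1 + s * e) * (s * s * he + hs)
  | more n ih ih' =>
    obtain ⟨d, hd⟩ : ∃ d, j + N = n + 2 + d := ⟨j + N - (n + 2), by omega⟩
    have h0 := hw (n + 1)
    have hX0 := hX (n + 1) (d + 1) (by omega)
    have hR := dualHahn_recurrence hη hξ (dualHahnGrid j η ξ (j + N)) hn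
    have ha0 := ih (by omega)
    have ha1 := ih' (by omega)
    have hF := (muFactorial_pos n hξ).ne'
    have hf1 := (muNumber_pos n hξ).ne'
    have hf2 := (muNumber_pos (n + 1) hξ).ne'
    have hs1 : ∀ n, (-1 : ℝ) ^ ((n + 1) * (n + 1 - 1) / 2 + (n + 1) * (j + N + 1))
        = (-1) ^ (n * (n - 1) / 2 + n * (j + N + 1)) * (-1) ^ (j + N + n + 1) := fun n => by
      rw [Nat.triangle_succ, ← pow_add]
      ring_nf
    have hs := neg_one_pow_mul_self (j + N + n + 1)
    have hL : j + N - n = d + 1 + 1 := by omega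
    rw [hs1, hs1, show j + N + (n + 1) + 1 = j + N + n + 1 + 1 by ring, pow_succ (-1 : ℝ) (j + N + n + 1),
      muFactorial_succ, muFactorial_succ, pow_succ (e / 2), pow_succ (e / 2)]
    rw [hs1, muFactorial_succ, pow_succ (e / 2) n] at ha1
    simp only [lowerCoeff, raiseCoeff] at h0
    have hs2 : (-1 : ℝ) ^ (j + N + n) = -(-1) ^ (j + N + n + 1) := by rw [pow_succ]; ring
    rw [show j + N + 1 - (n + 1) = d + 1 + 1 by omega,
      show j + N + 1 + (n + 1) + 1 = j + N + n + 1 + 1 + 1 by ring,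
      show j + N + (n + 1) = j + N + n + 1 by ring, pow_succ, pow_succ _ (j + N + n + 1), hs2] at h0
    rw [hL] at hR
    generalize (-1 : ℝ) ^ (j + N + n + 1) = τ at *
    generalize coupledCoeff ξ η e j N n = a0 at *
    generalize coupledCoeff ξ η e j N (n + 1) = a1 at *
    generalize coupledCoeff ξ η e j N (n + 1 + 1) = a2 at *
    set K := (-1) ^ (n * (n - 1) / 2 + n * (j + N + 1)) * (e / 2) ^ n / muFactorial n ξ with hK
    generalize dualHahn n _ _ _ _ = R0 at *
    generalize dualHahn (n + 1) _ _ _ _ = R1 at *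
    generalize dualHahn (n + 1 + 1) _ _ _ _ = R2 at *
    have hT : (τ * e) * (τ * e) = 1 := by linear_combination τ * τ * he + hs
    have ha1' : muNumber (n + 1) ξ * a1 = K * (τ * e / 2) * R1 := by
      rw [ha1, hK]; field_simp
    -- The eigenvector equation is solved for the new coefficient, the two earlier ones are replaced
    -- by the induction hypotheses, and the result is compared with `hR`; the leftover signs are
    -- squares, removed by `hT`.
    have key : muNumber (n + 1) ξ * muNumber (n + 1 + 1) ξ * a2 = -(K / 4) * R2 := by
      linear_combination (τ * e * muNumber (n + 1) ξ) * h0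
        + (-(muNumber (n + 1) ξ * muNumber (n + 1 + 1) ξ * a2)
          + muNumber (d + 1 + 1) η * muNumber (n + 1) ξ * a0
          - τ * e * muNumber (n + 1) ξ * muNumber (n + 1 + 1) ξ * a1
          - K / 2 * (muNumber (d + 1 + 1) η + muNumber (n + 1 + 1) ξ
            - muNumber (N + 1) (ξ + η + j + 1 / 2)) * R1) * hT
        - τ * e * (muNumber (d + 1 + 1) η + muNumber (n + 1 + 1) ξ
            - muNumber (N + 1) (ξ + η + j + 1 / 2)) * ha1'
        + K / 4 * R1 * hX0 - K / 4 * hR + muNumber (d + 1 + 1) η * muNumber (n + 1) ξ * ha0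
    have : a2 = -(K / 4) * R2 / (muNumber (n + 1) ξ * muNumber (n + 1 + 1) ξ) := by
      rw [← key]; field_simp
    rw [this, hK]
    field_simp
    linear_combination (4 * (e / 2) ^ n * R2) * hT

end Osp12

namespace Osp12

/-! ### The normalization of the Clebsch-Gordan coefficients -/

/-- The factors are read in the opposite order. For even N this rewrites the symbols at negative
arguments in ρ and ν₀ as symbols at positive arguments. -/
lemma poch_reverse (a : ℝ) (k : ℕ) : poch a k = (-1) ^ k * poch (1 - a - k) k := by
  rw [poch_eq_prod, poch_eq_prod, ← Finset.prod_range_reflect, ← Finset.card_range k,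
    ← Finset.prod_const, Finset.card_range, ← Finset.prod_mul_distrib]
  refine Finset.prod_congr rfl fun i hi => ?_
  obtain ⟨d, rfl⟩ : ∃ d, k = i + 1 + d := ⟨k - (i + 1), by have := Finset.mem_range.1 hi; omega⟩
  rw [show i + 1 + d - 1 - i = d by omega]
  push_cast
  ring

lemma poch_mul_comm (a : ℝ) (k l : ℕ) : poch a k * poch (a + k) l = poch a l * poch (a + l) k := by
  rw [← poch_add, ← poch_add, add_comm]

lemma poch_one (n : ℕ) : poch 1 n = n.factorial := by
  induction n with
  | zero => simp
  | succ n ih => rw [poch_succ, ih, Nat.factorial_succ]; push_cast; ring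

lemma factorial_add_eq (i r : ℕ) : ((i + r).factorial : ℝ) = i.factorial * poch (i + 1) r := by
  rw [← poch_one, poch_add, poch_one, add_comm (1 : ℝ)]

lemma poch_neg_add (i r : ℕ) :
    poch (-((i + r : ℕ) : ℝ)) i = (-1) ^ i * ((i + r).factorial / r.factorial) := by
  have : (r.factorial : ℝ) ≠ 0 := by positivity
  rw [poch_reverse, add_comm i r, factorial_add_eq]
  push_cast
  rw [show (1 : ℝ) - -(r + i) - i = r + 1 by ring]
  field_simp

/-- The squared norm of the coupling coefficients of the lowest weight vector, up to simple
factors. -/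
noncomputable def couplingConst (η ξ : ℝ) (j : ℕ) : ℝ :=
  if Even j then poch (ξ + 1 / 2) (j / 2) / (4 ^ (j / 2) * (j / 2).factorial
    * poch (η + 1 / 2) (j / 2) * poch (η + ξ + 1 + (j / 2 : ℕ)) (j / 2))
  else poch (ξ + 1 / 2) (j / 2 + 1) / (2 * 4 ^ (j / 2) * (j / 2).factorial
    * poch (η + 1 / 2) (j / 2 + 1) * poch (η + ξ + 1 + (j / 2 : ℕ)) (j / 2 + 1))

lemma couplingConst_even (η ξ : ℝ) (i : ℕ) : couplingConst η ξ (2 * i)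
    = poch (ξ + 1 / 2) i / (4 ^ i * i.factorial * poch (η + 1 / 2) i * poch (η + ξ + 1 + i) i) := by
  simp [couplingConst]

lemma couplingConst_odd (η ξ : ℝ) (i : ℕ) : couplingConst η ξ (2 * i + 1)
    = poch (ξ + 1 / 2) (i + 1) / (2 * 4 ^ i * i.factorial * poch (η + 1 / 2) (i + 1)
      * poch (η + ξ + 1 + i) (i + 1)) := by
  have h1 : (2 * i + 1) / 2 = i := by omega
  simp [couplingConst, h1]

variable {η ξ : ℝ}

lemma couplingConst_pos (hη : 0 < η) (hξ : 0 < ξ) (j : ℕ) : 0 < couplingConst η ξ j := by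
  rcases Nat.even_or_odd' j with ⟨i, rfl | rfl⟩
  · rw [couplingConst_even]
    have := poch_pos (by linarith : 0 < ξ + 1 / 2) i
    have := poch_pos (by linarith : 0 < η + 1 / 2) i
    have := poch_pos (by positivity : 0 < η + ξ + 1 + i) i
    positivity
  · rw [couplingConst_odd]
    have := poch_pos (by linarith : 0 < ξ + 1 / 2) (i + 1)
    have := poch_pos (by linarith : 0 < η + 1 / 2) (i + 1)
    have := poch_pos (by positivity : 0 < η + ξ + 1 + i) (i + 1)
    positivity

lemma couplingConst_eq_even_odd (hη : 0 < η) (hξ : 0 < ξ) (i r : ℕ) :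
    dualHahnRho (2 * i) η ξ (2 * i + (2 * r + 1))
        * muFactorial (2 * r + 1) (ξ + η + (2 * i : ℕ) + 1 / 2)
        / (muFactorial (2 * i + (2 * r + 1)) η * dualHahnNormZero η ξ (2 * i + (2 * r + 1)))
      = couplingConst η ξ (2 * i) := by
  have h1 : ¬ Even (2 * (i + r) + 1) := by simp
  have h2 : (2 * (i + r) + 1 + 1) / 2 = i + r + 1 := by omega
  have e1 : (1 - ((2 * (i + r) + 1 : ℕ) : ℝ)) / 2 = -((i + r : ℕ) : ℝ) := by push_cast; ring
  rw [show 2 * i + (2 * r + 1) = 2 * (i + r) + 1 by ring, dualHahnRho, dualHahnNormZero,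
    if_neg h1, if_neg h1, dualHahnWeight, if_neg h1, if_pos (even_two_mul i), h2,
    Nat.mul_div_cancel_left _ (by norm_num), muFactorial_odd, muFactorial_odd, couplingConst_even,
    e1, poch_neg_add]
  have F1 : poch (η + ξ + 1) (i + r + 1) = poch (η + ξ + 1) i * poch (η + ξ + 1 + i) (r + 1) := by
    rw [add_assoc i r 1, poch_add]
  -- This compares two splittings of the symbol of length i + r + 1 at η + ξ + 1 + i. It is the one
  -- identity behind the cancellation of r, apart from factors that cancel outright.
  have F2 := poch_mul_comm (η + ξ + 1 + i) i (r + 1)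
  rw [show η + ξ + 1 + (i : ℝ) + (r + 1 : ℕ) = (((2 * (i + r) + 1 : ℕ) : ℝ) + 3) / 2 + η + ξ by
      push_cast; ring,
    show η + ξ + 1 + (i : ℝ) + i = ξ + η + (2 * i : ℕ) + 1 / 2 + 1 / 2 by push_cast; ring] at F2
  have p1 := poch_pos (by positivity : 0 < η + ξ + 1) i
  have p2 := poch_pos (by positivity : 0 < η + ξ + 1 + i) (r + 1)
  have p3 := poch_pos (by positivity : 0 < η + ξ + 1 + i) i
  have p4 := poch_pos (by positivity : 0 < (((2 * (i + r) + 1 : ℕ) : ℝ) + 3) / 2 + η + ξ) i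
  have p5 := poch_pos (by positivity : 0 < η + 1 / 2) i
  have p6 := poch_pos (by positivity : 0 < η + 1 / 2) (i + r + 1)
  have hs := neg_one_pow_mul_self i
  have : (i.factorial : ℝ) ≠ 0 := by positivity
  have : (r.factorial : ℝ) ≠ 0 := by positivity
  have : ((i + r).factorial : ℝ) ≠ 0 := by positivity
  rw [F1, pow_add]
  generalize poch ((((2 * (i + r) + 1 : ℕ) : ℝ) + 3) / 2 + η + ξ) i = Q at *
  generalize poch (ξ + η + (2 * i : ℕ) + 1 / 2 + 1 / 2) (r + 1) = Y at *
  generalize poch (η + ξ + 1 + (i : ℝ)) i = Z at *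
  generalize poch (η + ξ + 1 + (i : ℝ)) (r + 1) = T at *
  generalize poch (η + ξ + 1) i = U at *
  generalize poch (η + 1 / 2) (i + r + 1) = V at *
  generalize poch (η + 1 / 2) i = A at *
  generalize poch (ξ + 1 / 2) i = B at *
  generalize (-1 : ℝ) ^ i = s at *
  field_simp
  linear_combination (B * Y * Z) * hs + B * F2

lemma couplingConst_eq_odd_even (hη : 0 < η) (hξ : 0 < ξ) (i r : ℕ) :
    dualHahnRho (2 * i + 1) η ξ (2 * i + 1 + 2 * r)
        * muFactorial (2 * r) (ξ + η + (2 * i + 1 : ℕ) + 1 / 2)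
        / (muFactorial (2 * i + 1 + 2 * r) η * dualHahnNormZero η ξ (2 * i + 1 + 2 * r))
      = couplingConst η ξ (2 * i + 1) := by
  have h1 : ¬ Even (2 * (i + r) + 1) := by simp
  have h3 : ¬ Even (2 * i + 1) := by simp
  have h4 : (2 * i + 1) / 2 = i := by omega
  have h2 : (2 * (i + r) + 1 + 1) / 2 = i + r + 1 := by omega
  have e1 : (1 - ((2 * (i + r) + 1 : ℕ) : ℝ)) / 2 = -((i + r : ℕ) : ℝ) := by push_cast; ring
  rw [show 2 * i + 1 + 2 * r = 2 * (i + r) + 1 by ring, dualHahnRho, dualHahnNormZero,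
    if_neg h1, if_neg h1, dualHahnWeight, if_neg h1, if_neg h3, h2, h4,
    muFactorial_even, muFactorial_odd, couplingConst_odd, e1, poch_neg_add]
  have F1 : poch (η + ξ + 1) (i + r + 1) = poch (η + ξ + 1) i * poch (η + ξ + 1 + i) (r + 1) := by
    rw [add_assoc i r 1, poch_add]
  have F2 : poch (η + ξ + 1 + i) (r + 1) * poch ((((2 * (i + r) + 1 : ℕ) : ℝ) + 3) / 2 + η + ξ) i
      = poch (η + ξ + 1 + i) (i + 1) * poch (ξ + η + (2 * i + 1 : ℕ) + 1 / 2 + 1 / 2) r := by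
    rw [show (((2 * (i + r) + 1 : ℕ) : ℝ) + 3) / 2 + η + ξ = η + ξ + 1 + (i : ℝ) + (r + 1 : ℕ) by
        push_cast; ring,
      show ξ + η + ((2 * i + 1 : ℕ) : ℝ) + 1 / 2 + 1 / 2 = η + ξ + 1 + i + (i + 1 : ℕ) by
        push_cast; ring, ← poch_add, ← poch_add]
    congr 1; ring
  have p1 := poch_pos (by positivity : 0 < η + ξ + 1) i
  have p2 := poch_pos (by positivity : 0 < η + ξ + 1 + i) (r + 1)
  have p3 := poch_pos (by positivity : 0 < η + ξ + 1 + i) (i + 1)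
  have p4 := poch_pos (by positivity : 0 < (((2 * (i + r) + 1 : ℕ) : ℝ) + 3) / 2 + η + ξ) i
  have p5 := poch_pos (by positivity : 0 < η + 1 / 2) (i + 1)
  have p6 := poch_pos (by positivity : 0 < η + 1 / 2) (i + r + 1)
  have hs := neg_one_pow_mul_self i
  have : (i.factorial : ℝ) ≠ 0 := by positivity
  have : (r.factorial : ℝ) ≠ 0 := by positivity
  have : ((i + r).factorial : ℝ) ≠ 0 := by positivity
  rw [F1, pow_add]
  generalize poch ((((2 * (i + r) + 1 : ℕ) : ℝ) + 3) / 2 + η + ξ) i = Q at *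
  generalize poch (ξ + η + (2 * i + 1 : ℕ) + 1 / 2 + 1 / 2) r = Y at *
  generalize poch (η + ξ + 1 + (i : ℝ)) (i + 1) = Z at *
  generalize poch (η + ξ + 1 + (i : ℝ)) (r + 1) = T at *
  generalize poch (η + ξ + 1) i = U at *
  generalize poch (η + 1 / 2) (i + r + 1) = V at *
  generalize poch (η + 1 / 2) (i + 1) = A at *
  generalize poch (ξ + 1 / 2) (i + 1) = B at *
  generalize (-1 : ℝ) ^ i = s at *
  field_simp
  linear_combination (B * Y * Z) * hs - B * F2

/-- For even total weight ρ is the weight at the reversed index, here 2r instead of 2i. After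
reversing all symbols at negative arguments, the two splittings of one Pochhammer symbol again
cancel the dependence on r. -/
lemma couplingConst_eq_even_even (hη : 0 < η) (hξ : 0 < ξ) (i r : ℕ) :
    dualHahnRho (2 * i) η ξ (2 * i + 2 * r)
        * muFactorial (2 * r) (ξ + η + (2 * i : ℕ) + 1 / 2)
        / (muFactorial (2 * i + 2 * r) η * dualHahnNormZero η ξ (2 * i + 2 * r))
      = couplingConst η ξ (2 * i) := by
  have h1 : 2 * (i + r) - 2 * i = 2 * r := by omega
  have E : ((2 * (i + r) : ℕ) : ℝ) = 2 * (i + r) := by push_cast; ring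
  rw [show 2 * i + 2 * r = 2 * (i + r) by ring, dualHahnRho, dualHahnNormZero, h1,
    dualHahnWeight, if_pos (even_two_mul _), if_pos (even_two_mul _), if_pos (even_two_mul _),
    if_pos (even_two_mul _), Nat.mul_div_cancel_left _ (by norm_num),
    Nat.mul_div_cancel_left _ (by norm_num), muFactorial_even, muFactorial_even,
    couplingConst_even, E, poch_reverse (-(2 * ((i : ℝ) + r) / 2)), poch_reverse (-(2 * ((i : ℝ) + r) / 2) - η + 1 / 2),
    poch_reverse (-(2 * ((i : ℝ) + r)) - η - ξ), poch_reverse (-(2 * ((i : ℝ) + r) / 2) - ξ + 1 / 2),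
    poch_reverse (-(2 * ((i : ℝ) + r) / 2) - η - ξ), poch_reverse (-(2 * ((i : ℝ) + r)) - η - ξ) (i + r),
    poch_reverse ((-(2 * ((i : ℝ) + r)) - 2 * ξ + 1) / 2)]
  push_cast
  rw [show 1 - -(2 * ((i : ℝ) + r) / 2) - r = i + 1 by ring,
    show 1 - (-(2 * ((i : ℝ) + r) / 2) - η + 1 / 2) - r = η + 1 / 2 + i by ring,
    show 1 - (-(2 * ((i : ℝ) + r)) - η - ξ) - r = η + ξ + 1 + (i + r) + i by ring,
    show 1 - (-(2 * ((i : ℝ) + r) / 2) - ξ + 1 / 2) - r = ξ + 1 / 2 + i by ring,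
    show 1 - (-(2 * ((i : ℝ) + r) / 2) - η - ξ) - r = η + ξ + 1 + i by ring,
    show 1 - (-(2 * ((i : ℝ) + r)) - η - ξ) - (i + r) = η + ξ + 1 + (i + r) by ring,
    show 1 - (-(2 * ((i : ℝ) + r)) - 2 * ξ + 1) / 2 - (i + r) = ξ + 1 / 2 by ring,
    show ξ + η + 2 * (i : ℝ) + 1 / 2 + 1 / 2 = η + ξ + 1 + i + i by ring]
  have F0 := factorial_add_eq i r
  have F1 := poch_add (η + ξ + 1 + (i + r)) i r
  have F2 := poch_mul_comm (η + ξ + 1 + i) i r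
  have F3 := poch_add (η + 1 / 2) i r
  have F4 := poch_add (ξ + 1 / 2) i r
  rw [show η + ξ + 1 + (i : ℝ) + r = η + ξ + 1 + (i + r) by ring] at F2
  have p1 := poch_pos (by positivity : 0 < (i : ℝ) + 1) r
  have p2 := poch_pos (by positivity : 0 < η + ξ + 1 + (i + r)) i
  have p3 := poch_pos (by positivity : 0 < η + ξ + 1 + (i + r) + i) r
  have p4 := poch_pos (by positivity : 0 < η + ξ + 1 + i) i
  have p5 := poch_pos (by positivity : 0 < η + ξ + 1 + i) r
  have p6 := poch_pos (by positivity : 0 < η + 1 / 2) i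
  have p7 := poch_pos (by positivity : 0 < η + 1 / 2 + i) r
  have p8 := poch_pos (by positivity : 0 < ξ + 1 / 2) i
  have p9 := poch_pos (by positivity : 0 < ξ + 1 / 2 + i) r
  have : (i.factorial : ℝ) ≠ 0 := by positivity
  have : (r.factorial : ℝ) ≠ 0 := by positivity
  have hs := neg_one_pow_mul_self r
  have hi := neg_one_pow_mul_self i
  have hs0 : (-1 : ℝ) ^ r ≠ 0 := by positivity
  have hi0 : (-1 : ℝ) ^ i ≠ 0 := by positivity
  rw [F0, F1, F3, F4, pow_add, pow_add]
  generalize poch ((i : ℝ) + 1) r = P at *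
  generalize poch (η + ξ + 1 + (i + r)) i = Q at *
  generalize poch (η + ξ + 1 + (i + r) + i) r = R at *
  generalize poch (η + ξ + 1 + (i : ℝ)) i = S at *
  generalize poch (η + ξ + 1 + (i : ℝ)) r = T at *
  generalize poch (η + ξ + 1 + (i : ℝ) + i) r = U at *
  generalize poch (η + 1 / 2) i = A at *
  generalize poch (ξ + 1 / 2) i = B at *
  generalize poch (η + 1 / 2 + (i : ℝ)) r = C at *
  generalize poch (ξ + 1 / 2 + (i : ℝ)) r = D at *
  generalize (-1 : ℝ) ^ i = t at *
  generalize (-1 : ℝ) ^ r = s at *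
  field_simp
  linear_combination (U * S) * hs + F2

lemma couplingConst_eq_odd_odd (hη : 0 < η) (hξ : 0 < ξ) (i r : ℕ) :
    dualHahnRho (2 * i + 1) η ξ (2 * i + 1 + (2 * r + 1))
        * muFactorial (2 * r + 1) (ξ + η + (2 * i + 1 : ℕ) + 1 / 2)
        / (muFactorial (2 * i + 1 + (2 * r + 1)) η
          * dualHahnNormZero η ξ (2 * i + 1 + (2 * r + 1)))
      = couplingConst η ξ (2 * i + 1) := by
  have h1 : 2 * (i + 1 + r) - (2 * i + 1) = 2 * r + 1 := by omega
  have h3 : ¬ Even (2 * r + 1) := by simp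
  have h4 : (2 * r + 1) / 2 = r := by omega
  have E : ((2 * (i + 1 + r) : ℕ) : ℝ) = 2 * (i + 1 + r) := by push_cast; ring
  rw [show 2 * i + 1 + (2 * r + 1) = 2 * (i + 1 + r) by ring, dualHahnRho, dualHahnNormZero, h1,
    dualHahnWeight, if_pos (even_two_mul _), if_pos (even_two_mul _), if_pos (even_two_mul _),
    if_neg h3, h4, Nat.mul_div_cancel_left _ (by norm_num), muFactorial_even, muFactorial_odd,
    couplingConst_odd, E, poch_reverse (-(2 * ((i : ℝ) + 1 + r) / 2)),
    poch_reverse (-(2 * ((i : ℝ) + 1 + r) / 2) - η + 1 / 2),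
    poch_reverse (-(2 * ((i : ℝ) + 1 + r)) - η - ξ),
    poch_reverse (-(2 * ((i : ℝ) + 1 + r) / 2) - ξ + 1 / 2),
    poch_reverse (-(2 * ((i : ℝ) + 1 + r) / 2) - η - ξ),
    poch_reverse (-(2 * ((i : ℝ) + 1 + r)) - η - ξ) (i + 1 + r),
    poch_reverse ((-(2 * ((i : ℝ) + 1 + r)) - 2 * ξ + 1) / 2)]
  push_cast
  rw [show 1 - -(2 * ((i : ℝ) + 1 + r) / 2) - (r + 1) = i + 1 by ring,
    show 1 - (-(2 * ((i : ℝ) + 1 + r) / 2) - η + 1 / 2) - r = η + 1 / 2 + (i + 1) by ring,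
    show 1 - (-(2 * ((i : ℝ) + 1 + r)) - η - ξ) - r = η + ξ + 1 + (i + 1 + r) + (i + 1) by ring,
    show 1 - (-(2 * ((i : ℝ) + 1 + r) / 2) - ξ + 1 / 2) - r = ξ + 1 / 2 + (i + 1) by ring,
    show 1 - (-(2 * ((i : ℝ) + 1 + r) / 2) - η - ξ) - (r + 1) = η + ξ + 1 + i by ring,
    show 1 - (-(2 * ((i : ℝ) + 1 + r)) - η - ξ) - (i + 1 + r) = η + ξ + 1 + (i + 1 + r) by ring,
    show 1 - (-(2 * ((i : ℝ) + 1 + r)) - 2 * ξ + 1) / 2 - (i + 1 + r) = ξ + 1 / 2 by ring,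
    show ξ + η + (2 * (i : ℝ) + 1) + 1 / 2 + 1 / 2 = η + ξ + 1 + i + (i + 1) by ring]
  have F0 := factorial_add_eq i (r + 1)
  rw [show i + (r + 1) = i + 1 + r by ring] at F0
  have F1 := poch_add (η + ξ + 1 + (i + 1 + r)) (i + 1) r
  have F2 := poch_mul_comm (η + ξ + 1 + i) (i + 1) (r + 1)
  have F3 := poch_add (η + 1 / 2) (i + 1) r
  have F4 := poch_add (ξ + 1 / 2) (i + 1) r
  push_cast at F1 F2 F3 F4
  rw [show η + ξ + 1 + (i : ℝ) + (r + 1) = η + ξ + 1 + (i + 1 + r) by ring] at F2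
  have p1 := poch_pos (by positivity : 0 < (i : ℝ) + 1) (r + 1)
  have p2 := poch_pos (by positivity : 0 < η + ξ + 1 + (i + 1 + r)) (i + 1)
  have p3 := poch_pos (by positivity : 0 < η + ξ + 1 + (i + 1 + r) + (i + 1)) r
  have p4 := poch_pos (by positivity : 0 < η + ξ + 1 + i) (i + 1)
  have p5 := poch_pos (by positivity : 0 < η + ξ + 1 + i) (r + 1)
  have p6 := poch_pos (by positivity : 0 < η + 1 / 2) (i + 1)
  have p7 := poch_pos (by positivity : 0 < η + 1 / 2 + (i + 1)) r
  have p8 := poch_pos (by positivity : 0 < ξ + 1 / 2) (i + 1)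
  have p9 := poch_pos (by positivity : 0 < ξ + 1 / 2 + (i + 1)) r
  have : (i.factorial : ℝ) ≠ 0 := by positivity
  have : (r.factorial : ℝ) ≠ 0 := by positivity
  have hs := neg_one_pow_mul_self r
  have hs0 : (-1 : ℝ) ^ r ≠ 0 := by positivity
  have hi0 : (-1 : ℝ) ^ i ≠ 0 := by positivity
  rw [F0, F1, F3, F4, pow_add _ (i + 1), pow_add _ (i + 1), pow_succ _ r, pow_succ _ i,
    pow_succ _ i]
  generalize poch ((i : ℝ) + 1) (r + 1) = P at *
  generalize poch (η + ξ + 1 + (i + 1 + r)) (i + 1) = Q at *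
  generalize poch (η + ξ + 1 + (i + 1 + r) + (i + 1)) r = R at *
  generalize poch (η + ξ + 1 + (i : ℝ)) (i + 1) = S at *
  generalize poch (η + ξ + 1 + (i : ℝ)) (r + 1) = T at *
  generalize poch (η + ξ + 1 + (i : ℝ) + (i + 1)) (r + 1) = U at *
  generalize poch (η + 1 / 2) (i + 1) = A at *
  generalize poch (ξ + 1 / 2) (i + 1) = B at *
  generalize poch (η + 1 / 2 + ((i : ℝ) + 1)) r = C at *
  generalize poch (ξ + 1 / 2 + ((i : ℝ) + 1)) r = D at *
  generalize (-1 : ℝ) ^ i = t at *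
  generalize (-1 : ℝ) ^ r = s at *
  field_simp
  linear_combination (4 * U * S) * hs + 4 * F2

/-- Raising from step N to N + 1 multiplies squared norms by the factor [N + 1] of the coupled
label. Once [N]! is divided out of the Clebsch-Gordan normalization, the remaining constant must
therefore be independent of N. -/
lemma couplingConst_eq (hη : 0 < η) (hξ : 0 < ξ) (j N : ℕ) :
    dualHahnRho j η ξ (j + N) * muFactorial N (ξ + η + j + 1 / 2)
        / (muFactorial (j + N) η * dualHahnNormZero η ξ (j + N))
      = couplingConst η ξ j := by
  rcases Nat.even_or_odd' j with ⟨i, rfl | rfl⟩ <;> rcases Nat.even_or_odd' N with ⟨r, rfl | rfl⟩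
  · exact couplingConst_eq_even_even hη hξ i r
  · exact couplingConst_eq_even_odd hη hξ i r
  · exact couplingConst_eq_odd_even hη hξ i r
  · exact couplingConst_eq_odd_odd hη hξ i r

end Osp12

namespace Osp12

/-! ### Terminating hypergeometric series -/

lemma descPochhammer_smeval_eq_poch (x : ℝ) (n : ℕ) :
    (descPochhammer ℤ n).smeval x = poch (x - n + 1) n := by
  rw [Polynomial.descPochhammer_smeval_eq_ascPochhammer, Polynomial.ascPochhammer_smeval_eq_eval,
    poch]

/-- A form of the Chu-Vandermonde identity. -/
lemma sum_choose_mul_poch (x y : ℝ) (n : ℕ) :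
    ∑ l ∈ Finset.range (n + 1), (n.choose l : ℝ) * (poch (x - l) l * poch (y + l) (n - l))
      = poch (x + y - 1) n := by
  have h := Ring.descPochhammer_smeval_add (r := x - 1) (s := y + n - 1) n (Commute.all _ _)
  rw [Finset.Nat.sum_antidiagonal_eq_sum_range_succ_mk] at h
  simp only [descPochhammer_smeval_eq_poch] at h
  rw [show x - 1 + (y + n - 1) - n + 1 = x + y - 1 by ring] at h
  rw [h]
  refine Finset.sum_congr rfl fun l hl => ?_
  rw [Nat.cast_sub (Nat.lt_succ_iff.1 (Finset.mem_range.1 hl)), show x - 1 - l + 1 = x - l by ring,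
    show y + n - 1 - (n - l) + 1 = y + l by ring]

/-- The terminating hypergeometric series `₂F₁(-k, s; b; z)`. -/
noncomputable def hypPoly (k : ℕ) (s b z : ℝ) : ℝ :=
  ∑ i ∈ Finset.range (k + 1), (-1) ^ i * (k.choose i : ℝ) * (poch s i / poch b i) * z ^ i

lemma hypergeometric_eq_hypPoly (k : ℕ) (s b z : ℝ) :
    ₂F₁ (-(k : ℝ)) s b z = hypPoly k s b z := by
  rw [ordinaryHypergeometric_eq_tsum, hypPoly]
  simp only
  rw [tsum_eq_sum (s := Finset.range (k + 1))]
  · refine Finset.sum_congr rfl fun i _ => ?_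
    rw [← poch_neg, smul_eq_mul]
    simp only [poch]
    ring
  · intro i hi
    have hi' : k < i := by simpa using hi
    rw [ascPochhammer_eval_neg_coe_nat_of_lt hi']
    simp

/-- This contiguous relation serves even j: the Laguerre convolution has upper parameter s where the
Big -1 Jacobi polynomial has s + 1. -/
lemma hypPoly_succ_sub {b : ℝ} (hb : 0 < b) (k : ℕ) (s z : ℝ) :
    hypPoly (k + 1) (s + 1) b z - hypPoly (k + 1) s b z
      = -((k + 1) * z / b) * hypPoly k (s + 1) (b + 1) z := by
  rw [hypPoly, hypPoly, hypPoly, ← Finset.sum_sub_distrib, Finset.sum_range_succ', Finset.mul_sum]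
  simp only [poch_zero, sub_self, add_zero]
  refine Finset.sum_congr rfl fun i _ => ?_
  have h1 := poch_succ (s + 1) i
  have h2 := poch_succ_left s i
  have h3 := poch_succ_left b i
  have hp := (poch_pos (by linarith : 0 < b + 1) i).ne'
  have hc : ((k + 1).choose (i + 1) : ℝ) * (i + 1) = (k + 1) * k.choose i := by
    have := Nat.add_one_mul_choose_eq k i
    exact_mod_cast this.symm
  rw [h1, h2, h3, pow_succ, pow_succ]
  field_simp
  linear_combination (-poch (s + 1) i * z ^ i * z) * hc

/-- This contiguous relation serves odd j. Termwise it follows from s (s+1)_i = (s)_i (s+i) and the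
same identity for b. -/
lemma hypPoly_contiguous {b : ℝ} (hb : 0 < b) (k : ℕ) (s z : ℝ) :
    b * hypPoly k s b z = s * hypPoly k (s + 1) (b + 1) z - (s - b) * hypPoly k s (b + 1) z := by
  rw [hypPoly, hypPoly, hypPoly, Finset.mul_sum, Finset.mul_sum, Finset.mul_sum,
    ← Finset.sum_sub_distrib]
  refine Finset.sum_congr rfl fun i _ => ?_
  have h1 : s * poch (s + 1) i = poch s i * (s + i) := by rw [← poch_succ, poch_succ_left]
  have h2 : b * poch (b + 1) i = poch b i * (b + i) := by rw [← poch_succ, poch_succ_left]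
  have hp := (poch_pos (by linarith : 0 < b + 1) i).ne'
  have hp' := (poch_pos hb i).ne'
  field_simp
  linear_combination (k.choose i * z ^ i) * (poch s i * h2 - poch b i * h1)

/-- The convolution of two `₀F₁` series is a Jacobi polynomial. -/
lemma convolution_eq_hypPoly {b₁ b₂ : ℝ} (h₁ : 0 < b₁) (h₂ : 0 < b₂) (q z : ℝ) (k : ℕ) :
    ∑ p ∈ Finset.HasAntidiagonal.antidiagonal k,
        (-(q * (1 - z) / 2)) ^ p.1 / (p.1.factorial * poch b₁ p.1)
          * ((q * z / 2) ^ p.2 / (p.2.factorial * poch b₂ p.2))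
      = (-(q / 2)) ^ k / (k.factorial * poch b₁ k) * hypPoly k (k + b₁ + b₂ - 1) b₂ z := by
  -- The coefficient of z^i is a Chu-Vandermonde sum with x = b₁ + k and y = b₂, after the common
  -- factor (b₁)_k is pulled out of the shorter symbols (b₁)_{k-l}.
  have key : ∀ i ≤ k, ∑ l ∈ Finset.range (i + 1), (-z) ^ (l + (i - l)) / ((k - i).factorial
        * (i - l).factorial * l.factorial * poch b₁ (k - l) * poch b₂ l)
      = 1 / (k.factorial * poch b₁ k) * ((-1) ^ i * (k.choose i : ℝ)
        * (poch (k + b₁ + b₂ - 1) i / poch b₂ i) * z ^ i) := by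
    intro i hi
    rw [show (k : ℝ) + b₁ + b₂ - 1 = b₁ + k + b₂ - 1 by ring, ← sum_choose_mul_poch,
      Nat.cast_choose ℝ hi, Finset.sum_div, Finset.mul_sum, Finset.sum_mul, Finset.mul_sum]
    refine Finset.sum_congr rfl fun l hl => ?_
    have hl' := Nat.lt_succ_iff.1 (Finset.mem_range.1 hl)
    rw [Nat.cast_choose ℝ hl']
    have e1 : poch b₁ k = poch b₁ (k - l) * poch (b₁ + k - l) l := by
      have := poch_add b₁ (k - l) l
      rwa [Nat.sub_add_cancel (hl'.trans hi), Nat.cast_sub (hl'.trans hi), ← add_sub_assoc] at this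
    have e2 : poch b₂ i = poch b₂ l * poch (b₂ + l) (i - l) := by
      have := poch_add b₂ l (i - l)
      rwa [Nat.add_sub_cancel' hl'] at this
    have p1 := poch_pos h₁ (k - l)
    have p2 := poch_pos h₁ k
    have p3 := poch_pos h₂ l
    have p4 := poch_pos h₂ i
    have p5 : poch (b₁ + k - l) l ≠ 0 := fun h => by rw [h, mul_zero] at e1; exact p2.ne' e1
    have p6 : poch (b₂ + l) (i - l) ≠ 0 := fun h => by rw [h, mul_zero] at e2; exact p4.ne' e2
    have : (k.factorial : ℝ) ≠ 0 := by positivity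
    have : (i.factorial : ℝ) ≠ 0 := by positivity
    have : (l.factorial : ℝ) ≠ 0 := by positivity
    have : ((k - i).factorial : ℝ) ≠ 0 := by positivity
    have : ((i - l).factorial : ℝ) ≠ 0 := by positivity
    rw [e1, e2, Nat.add_sub_cancel' hl', neg_pow z]
    field_simp
  -- Here l is the index of the second series and r the binomial index from expanding (1 - z)^(k-l);
  -- the double sum is regrouped by the total power i = l + r.
  have flip := Finset.sum_range_diag_flip (k + 1) fun l r => (-z) ^ (l + r)
    / (((k - (l + r)).factorial : ℝ) * r.factorial * l.factorial * poch b₁ (k - l) * poch b₂ l)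
  have hL : ∑ p ∈ Finset.HasAntidiagonal.antidiagonal k,
        (-(q * (1 - z) / 2)) ^ p.1 / (p.1.factorial * poch b₁ p.1)
          * ((q * z / 2) ^ p.2 / (p.2.factorial * poch b₂ p.2))
      = (-(q / 2)) ^ k * ∑ l ∈ Finset.range (k + 1), ∑ r ∈ Finset.range (k + 1 - l), (-z) ^ (l + r)
        / (((k - (l + r)).factorial : ℝ) * r.factorial * l.factorial * poch b₁ (k - l)
          * poch b₂ l) := by
    rw [← Finset.Nat.sum_antidiagonal_swap, Finset.Nat.sum_antidiagonal_eq_sum_range_succ_mk,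
      Finset.mul_sum]
    refine Finset.sum_congr rfl fun l hl => ?_
    obtain ⟨m, rfl⟩ := Nat.exists_eq_add_of_le (Nat.lt_succ_iff.1 (Finset.mem_range.1 hl))
    simp only [Prod.swap, Nat.add_sub_cancel_left]
    rw [show l + m + 1 - l = m + 1 by omega,
      show -(q * (1 - z) / 2) = -(q / 2) * (-z + 1) by ring, mul_pow, add_pow, Finset.mul_sum,
      Finset.mul_sum, Finset.sum_div, Finset.sum_mul]
    refine Finset.sum_congr rfl fun r hr => ?_
    have hr' := Nat.lt_succ_iff.1 (Finset.mem_range.1 hr)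
    rw [Nat.cast_choose ℝ hr', show l + m - (l + r) = m - r by omega,
      show q * z / 2 = -(q / 2) * -z by ring, mul_pow, one_pow]
    have p1 := (poch_pos h₁ m).ne'
    have p3 := (poch_pos h₂ l).ne'
    have : (m.factorial : ℝ) ≠ 0 := by positivity
    have : (r.factorial : ℝ) ≠ 0 := by positivity
    have : (l.factorial : ℝ) ≠ 0 := by positivity
    have : ((m - r).factorial : ℝ) ≠ 0 := by positivity
    field_simp
    rw [pow_add, pow_add]
    ring
  rw [hL, ← flip, hypPoly, Finset.mul_sum, Finset.mul_sum]
  refine Finset.sum_congr rfl fun i hi => ?_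
  have hk := key i (Nat.lt_succ_iff.1 (Finset.mem_range.1 hi))
  have : ∑ l ∈ Finset.range (i + 1), (-z) ^ (l + (i - l)) / (((k - (l + (i - l))).factorial : ℝ)
      * (i - l).factorial * l.factorial * poch b₁ (k - l) * poch b₂ l)
      = ∑ l ∈ Finset.range (i + 1), (-z) ^ (l + (i - l)) / ((k - i).factorial
        * (i - l).factorial * l.factorial * poch b₁ (k - l) * poch b₂ l) :=
    Finset.sum_congr rfl fun l hl => by
      rw [Nat.add_sub_cancel' (Nat.lt_succ_iff.1 (Finset.mem_range.1 hl))]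
  rw [this, hk]
  ring

end Osp12

namespace Osp12

/-! ### The lowest weight vectors -/

lemma sum_range_even_odd (f : ℕ → ℝ) (k : ℕ) :
    ∑ n ∈ Finset.range (2 * k), f n
      = ∑ m ∈ Finset.range k, f (2 * m) + ∑ m ∈ Finset.range k, f (2 * m + 1) := by
  induction k with
  | zero => simp
  | succ k ih =>
    rw [show 2 * (k + 1) = 2 * k + 1 + 1 by ring, Finset.sum_range_succ, Finset.sum_range_succ, ih,
      Finset.sum_range_succ, Finset.sum_range_succ]
    ring

lemma prod_sign_even {e : ℝ} (he : e * e = 1) (j m : ℕ) :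
    ∏ i ∈ Finset.range (2 * m), e * (-1) ^ (j + i) = (-1) ^ m := by
  induction m with
  | zero => simp
  | succ m ih =>
    rw [show 2 * (m + 1) = 2 * m + 1 + 1 by ring, Finset.prod_range_succ, Finset.prod_range_succ, ih,
      ← add_assoc, pow_succ, pow_succ]
    have hs := neg_one_pow_mul_self (j + 2 * m)
    linear_combination (-(-1) ^ m * e * e) * hs - (-1) ^ m * he

lemma prod_sign_odd {e : ℝ} (he : e * e = 1) (j m : ℕ) :
    ∏ i ∈ Finset.range (2 * m + 1), e * (-1) ^ (j + i) = (-1) ^ m * (e * (-1) ^ j) := by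
  rw [Finset.prod_range_succ, prod_sign_even he, pow_add, pow_mul]
  norm_num

/-- The convolution of scaled Laguerre polynomials. -/
noncomputable def lagConv (b₁ b₂ q₁ q₂ : ℝ) (k : ℕ) : ℝ :=
  ∑ m ∈ Finset.range (k + 1), (-1) ^ m * PowerSeries.coeff m (lagSeries b₁ q₁)
    * PowerSeries.coeff (k - m) (lagSeries b₂ q₂)

/-- The sum q = q₁ + q₂ becomes the scale and the share z = q₂/q the Jacobi variable. The form q z =
q₂ avoids dividing by q. -/
lemma lagConv_eq {b₁ b₂ : ℝ} (h₁ : 0 < b₁) (h₂ : 0 < b₂) {q₁ q₂ q z : ℝ} (hq : q₁ + q₂ = q)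
    (hz : q * z = q₂) (k : ℕ) :
    lagConv b₁ b₂ q₁ q₂ k
      = (-(q / 2)) ^ k / (k.factorial * poch b₁ k) * hypPoly k (k + b₁ + b₂ - 1) b₂ z := by
  rw [← convolution_eq_hypPoly h₁ h₂, show q * (1 - z) = q₁ by linear_combination -hq - hz, hz,
    ← sum_lagSeries, lagConv, Finset.Nat.sum_antidiagonal_eq_sum_range_succ_mk]

lemma tensorSum_lowestCoeff {ξ η : ℝ} (hξ : 0 < ξ) (hη : 0 < η) (e g x y : ℝ) (j : ℕ) :
    tensorSum (chiharaMonic · x ξ g) (chiharaMonic · y η (e * x)) j (lowestCoeff ξ η e j)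
      = muFactorial j η * ∑ n ∈ Finset.range (j + 1), (∏ i ∈ Finset.range n, e * (-1) ^ (j + i))
        * chiharaHat n x ξ g * chiharaHat (j - n) y η (e * x) := by
  rw [tensorSum, Finset.mul_sum]
  refine Finset.sum_congr rfl fun n hn => ?_
  rw [lowestCoeff, if_pos (Nat.lt_succ_iff.1 (Finset.mem_range.1 hn)), chiharaMonic, chiharaMonic]
  have := (muFactorial_pos n hξ).ne'
  have := (muFactorial_pos (j - n) hη).ne'
  field_simp

/-- Splitting by parity of n gives two Laguerre convolutions. The sign product over n = 2m or 2m + 1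
factors contributes (-1)^m, exactly the alternating sign that makes the exponentials of the
generating series cancel. -/
lemma sum_chiharaHat_odd {e : ℝ} (he : e * e = 1) (ξ η g x y : ℝ) (k : ℕ) :
    ∑ n ∈ Finset.range (2 * k + 1 + 1), (∏ i ∈ Finset.range n, e * (-1) ^ (2 * k + 1 + i))
        * chiharaHat n x ξ g * chiharaHat (2 * k + 1 - n) y η (e * x)
      = (y - e * x) / (2 * η + 1)
          * lagConv (ξ + 1 / 2) (η + 3 / 2) (quad g x) (quad (e * x) y) k
        - e * (x - g) / (2 * ξ + 1)
          * lagConv (ξ + 3 / 2) (η + 1 / 2) (quad g x) (quad (e * x) y) k := by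
  rw [show 2 * k + 1 + 1 = 2 * (k + 1) by ring, sum_range_even_odd, lagConv, lagConv,
    Finset.mul_sum, Finset.mul_sum, sub_eq_add_neg, ← Finset.sum_neg_distrib]
  congr 1
  · refine Finset.sum_congr rfl fun m hm => ?_
    have hm := Nat.lt_succ_iff.1 (Finset.mem_range.1 hm)
    rw [prod_sign_even he, show 2 * k + 1 - 2 * m = 2 * (k - m) + 1 by omega, chiharaHat_even,
      chiharaHat_odd]
    ring
  · refine Finset.sum_congr rfl fun m hm => ?_
    have hm := Nat.lt_succ_iff.1 (Finset.mem_range.1 hm)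
    rw [prod_sign_odd he, show 2 * k + 1 - (2 * m + 1) = 2 * (k - m) by omega, chiharaHat_even,
      chiharaHat_odd, Odd.neg_one_pow ⟨k, rfl⟩]
    ring

lemma sum_chiharaHat_even {e : ℝ} (he : e * e = 1) (ξ η g x y : ℝ) (k : ℕ) :
    ∑ n ∈ Finset.range (2 * (k + 1) + 1), (∏ i ∈ Finset.range n, e * (-1) ^ (2 * (k + 1) + i))
        * chiharaHat n x ξ g * chiharaHat (2 * (k + 1) - n) y η (e * x)
      = lagConv (ξ + 1 / 2) (η + 1 / 2) (quad g x) (quad (e * x) y) (k + 1)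
        + e * (x - g) / (2 * ξ + 1) * ((y - e * x) / (2 * η + 1))
          * lagConv (ξ + 3 / 2) (η + 3 / 2) (quad g x) (quad (e * x) y) k := by
  rw [Finset.sum_range_succ, sum_range_even_odd, lagConv, lagConv, Finset.sum_range_succ _ (k + 1),
    add_right_comm, Finset.mul_sum]
  congr 1
  · congr 1
    · refine Finset.sum_congr rfl fun m hm => ?_
      have hm := Nat.lt_succ_iff.1 (Finset.mem_range.1 hm)
      rw [prod_sign_even he, show 2 * (k + 1) - 2 * m = 2 * (k + 1 - m) by omega, chiharaHat_even,
        chiharaHat_even]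
    · rw [prod_sign_even he, show 2 * (k + 1) - 2 * (k + 1) = 2 * 0 by omega, Nat.sub_self,
        chiharaHat_even, chiharaHat_even]
  · refine Finset.sum_congr rfl fun m hm => ?_
    have hm := Nat.lt_succ_iff.1 (Finset.mem_range.1 hm)
    rw [prod_sign_odd he, show 2 * (k + 1) - (2 * m + 1) = 2 * (k - m) + 1 by omega,
      chiharaHat_odd, chiharaHat_odd, Even.neg_one_pow (even_two_mul _)]
    ring

/-! ### The Big -1 Jacobi polynomials -/

lemma bigJacobi_zero (x a b c : ℝ) : bigJacobi 0 x a b c = 1 := by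
  have h := hypergeometric_eq_hypPoly 0 ((a + b + 2) / 2) ((a + 1) / 2) ((1 - x ^ 2) / (1 - c ^ 2))
  simp only [Nat.cast_zero, neg_zero] at h
  simp [bigJacobi, h, hypPoly]

lemma bigJacobi_even (k : ℕ) (x η ξ c : ℝ) :
    bigJacobi (2 * (k + 1)) x (2 * η) (2 * ξ) c
      = hypPoly (k + 1) (k + η + ξ + 1 + 1) (η + 1 / 2) ((1 - x ^ 2) / (1 - c ^ 2))
        + (k + 1) * (1 - x) / ((1 + c) * (η + 1 / 2))
          * hypPoly k (k + η + ξ + 1 + 1) (η + 3 / 2) ((1 - x ^ 2) / (1 - c ^ 2)) := by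
  rw [← hypergeometric_eq_hypPoly, ← hypergeometric_eq_hypPoly]
  simp only [bigJacobi, even_two_mul, if_true]
  push_cast
  rw [show -(2 * ((k : ℝ) + 1) / 2) = -(k + 1) by ring, show 1 - 2 * ((k : ℝ) + 1) / 2 = -k by ring,
    show (2 * ((k : ℝ) + 1) + 2 * η + 2 * ξ + 2) / 2 = k + η + ξ + 1 + 1 by ring,
    show (2 * η + 1) / 2 = η + 1 / 2 by ring, show (2 * η + 3) / 2 = η + 3 / 2 by ring,
    show 2 * ((k : ℝ) + 1) * (1 - x) / ((1 + c) * (2 * η + 1))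
      = (k + 1) * (1 - x) / ((1 + c) * (η + 1 / 2)) by
        rw [show (1 + c) * (2 * η + 1) = 2 * ((1 + c) * (η + 1 / 2)) by ring, mul_assoc,
          mul_div_mul_left _ _ two_ne_zero]]

lemma bigJacobi_odd (k : ℕ) (x η ξ c : ℝ) :
    bigJacobi (2 * k + 1) x (2 * η) (2 * ξ) c
      = hypPoly k (k + η + ξ + 1) (η + 1 / 2) ((1 - x ^ 2) / (1 - c ^ 2))
        - (k + η + ξ + 1) * (1 - x) / ((1 + c) * (η + 1 / 2))
          * hypPoly k (k + η + ξ + 1 + 1) (η + 3 / 2) ((1 - x ^ 2) / (1 - c ^ 2)) := by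
  have h : ¬ Even (2 * k + 1) := by simp
  rw [← hypergeometric_eq_hypPoly, ← hypergeometric_eq_hypPoly]
  simp only [bigJacobi, h, if_false]
  push_cast
  rw [show -((2 * (k : ℝ) + 1 - 1) / 2) = -k by ring,
    show (2 * (k : ℝ) + 1 + 2 * η + 2 * ξ + 1) / 2 = k + η + ξ + 1 by ring,
    show (2 * (k : ℝ) + 1 + 2 * η + 2 * ξ + 3) / 2 = k + η + ξ + 1 + 1 by ring,
    show (2 * η + 1) / 2 = η + 1 / 2 by ring, show (2 * η + 3) / 2 = η + 3 / 2 by ring,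
    show (2 * (k : ℝ) + 1 + 2 * η + 2 * ξ + 1) * (1 - x) / ((1 + c) * (2 * η + 1))
      = (k + η + ξ + 1) * (1 - x) / ((1 + c) * (η + 1 / 2)) by
        rw [show (1 + c) * (2 * η + 1) = 2 * ((1 + c) * (η + 1 / 2)) by ring,
          show (2 * (k : ℝ) + 1 + 2 * η + 2 * ξ + 1) * (1 - x)
            = 2 * ((k + η + ξ + 1) * (1 - x)) by ring, mul_div_mul_left _ _ two_ne_zero]]

/-- The total scale is (y² - g²)/2, free of x since e² = 1. Thus x enters only through the ratio (y²
- x²)/(y² - g²), the variable of the Big -1 Jacobi polynomial, and through the linear factor. -/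
lemma jacobi_arguments {e g x y : ℝ} (he : e * e = 1) (hy : y ≠ 0) (h₁ : y - g * e ≠ 0)
    (h₂ : y + g * e ≠ 0) :
    quad g x + quad (e * x) y = (y - g * e) * (y + g * e) / 2 ∧
    (y - g * e) * (y + g * e) / 2 * ((1 - (e * x / y) ^ 2) / (1 - (-(g * e / y)) ^ 2))
      = quad (e * x) y ∧
    (1 - e * x / y) / (1 + -(g * e / y)) = (y - e * x) / (y - g * e) := by
  refine ⟨?_, ?_, ?_⟩
  · rw [quad, quad]
    linear_combination (g ^ 2 - x ^ 2) / 2 * he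
  · have h3 : 1 - (-(g * e / y)) ^ 2 = (y - g * e) * (y + g * e) / y ^ 2 := by
      field_simp; ring
    have h4 : 1 - (e * x / y) ^ 2 = (y ^ 2 - (e * x) ^ 2) / y ^ 2 := by field_simp
    rw [h3, h4, quad]
    field_simp
  · have h3 : 1 + -(g * e / y) = (y - g * e) / y := by field_simp; ring
    have h4 : 1 - e * x / y = (y - e * x) / y := by field_simp
    rw [h3, h4]
    field_simp

/-! ### Lowest weight vectors as Big -1 Jacobi polynomials -/

variable {ξ η e g x y : ℝ}

lemma sum_chiharaHat_even_eq (hξ : 0 < ξ) (hη : 0 < η) (he : e * e = 1) (hy : y ≠ 0)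
    (h₁ : y - g * e ≠ 0) (h₂ : y + g * e ≠ 0) (k : ℕ) :
    ∑ n ∈ Finset.range (2 * k + 1), (∏ i ∈ Finset.range n, e * (-1) ^ (2 * k + i))
        * chiharaHat n x ξ g * chiharaHat (2 * k - n) y η (e * x)
      = (-((y - g * e) * (y + g * e) / 2 / 2)) ^ k / (k.factorial * poch (ξ + 1 / 2) k)
        * bigJacobi (2 * k) (e * x / y) (2 * η) (2 * ξ) (-(g * e / y)) := by
  obtain ⟨a1, a2, a3⟩ := jacobi_arguments (x := x) he hy h₁ h₂
  -- For k = 0 the sum has one term; the second convolution, of degree k - 1, appears only for k ≥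
  -- 1.
  rcases k with _ | k
  · have c1 := chiharaHat_even 0 x ξ g
    have c2 := chiharaHat_even 0 y η (e * x)
    rw [coeff_zero_lagSeries, mul_zero] at c1 c2
    simp [bigJacobi_zero, c1, c2]
  · have hb₁ : 0 < ξ + 1 / 2 := by linarith
    have hb₂ : 0 < η + 1 / 2 := by linarith
    have hb₁' : 0 < ξ + 3 / 2 := by linarith
    have hb₂' : 0 < η + 3 / 2 := by linarith
    have hJ : (k + 1) * (1 - e * x / y) / ((1 + -(g * e / y)) * (η + 1 / 2))
        = (k + 1) * ((y - e * x) / (y - g * e)) / (η + 1 / 2) := by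
      rw [← a3, ← div_div, mul_div_assoc]
    have hc := hypPoly_succ_sub hb₂ k (k + η + ξ + 1)
      ((1 - (e * x / y) ^ 2) / (1 - (-(g * e / y)) ^ 2))
    have hp' := poch_succ_left (ξ + 1 / 2) k
    rw [show ξ + 1 / 2 + 1 = ξ + 3 / 2 by ring] at hp'
    rw [show η + 1 / 2 + 1 = η + 3 / 2 by ring] at hc
    have p2 := (poch_pos hb₁' k).ne'
    have p3 : (k.factorial : ℝ) ≠ 0 := by positivity
    rw [sum_chiharaHat_even he, lagConv_eq hb₁ hb₂ a1 a2, lagConv_eq hb₁' hb₂' a1 a2,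
      bigJacobi_even, hJ, hp', Nat.factorial_succ, pow_succ,
      show (k : ℝ) + (ξ + 3 / 2) + (η + 3 / 2) - 1 = k + η + ξ + 1 + 1 by ring,
      show ((k + 1 : ℕ) : ℝ) + (ξ + 1 / 2) + (η + 1 / 2) - 1 = k + η + ξ + 1 by push_cast; ring]
    have hZ : (1 - (e * x / y) ^ 2) / (1 - (-(g * e / y)) ^ 2)
        = (y - e * x) * (y + e * x) / ((y - g * e) * (y + g * e)) := by
      rw [eq_div_iff (mul_ne_zero h₁ h₂)]
      rw [quad] at a2
      linear_combination 2 * a2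
    generalize (1 - (e * x / y) ^ 2) / (1 - (-(g * e / y)) ^ 2) = Z at *
    have hk : (k : ℝ) + 1 ≠ 0 := by positivity
    rw [sub_eq_iff_eq_add] at hc
    rw [hc]
    generalize hypPoly (k + 1) _ _ _ = A
    generalize hypPoly k _ _ _ = B
    generalize poch (ξ + 3 / 2) k = P at *
    generalize (-((y - g * e) * (y + g * e) / 2 / 2)) ^ k = W
    rw [hZ, show 2 * ξ + 1 = 2 * (ξ + 1 / 2) by ring, show 2 * η + 1 = 2 * (η + 1 / 2) by ring]
    generalize η + 1 / 2 = b₂ at *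
    generalize ξ + 1 / 2 = b₁ at *
    push_cast
    field_simp
    ring

/-- The two convolutions are ₂F₁ series with the same upper parameter s = k + η + ξ + 1 and lower
parameters η + 3/2 and η + 1/2. `hypPoly_contiguous` trades the former for the pair occurring in the
Big -1 Jacobi polynomial of odd degree. -/
lemma sum_chiharaHat_odd_eq (hξ : 0 < ξ) (hη : 0 < η) (he : e * e = 1) (hy : y ≠ 0)
    (h₁ : y - g * e ≠ 0) (h₂ : y + g * e ≠ 0) (k : ℕ) :
    ∑ n ∈ Finset.range (2 * k + 1 + 1), (∏ i ∈ Finset.range n, e * (-1) ^ (2 * k + 1 + i))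
        * chiharaHat n x ξ g * chiharaHat (2 * k + 1 - n) y η (e * x)
      = -((-((y - g * e) * (y + g * e) / 2 / 2)) ^ k * (y - g * e)
          / (2 * k.factorial * poch (ξ + 1 / 2) (k + 1)))
        * bigJacobi (2 * k + 1) (e * x / y) (2 * η) (2 * ξ) (-(g * e / y)) := by
  obtain ⟨a1, a2, a3⟩ := jacobi_arguments (x := x) he hy h₁ h₂
  have hb₁ : 0 < ξ + 1 / 2 := by linarith
  have hb₂ : 0 < η + 1 / 2 := by linarith
  have hb₁' : 0 < ξ + 3 / 2 := by linarith
  have hb₂' : 0 < η + 3 / 2 := by linarith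
  have hJ : (k + η + ξ + 1) * (1 - e * x / y) / ((1 + -(g * e / y)) * (η + 1 / 2))
      = (k + η + ξ + 1) * ((y - e * x) / (y - g * e)) / (η + 1 / 2) := by
    rw [← a3, ← div_div, mul_div_assoc]
  have hc := hypPoly_contiguous hb₂ k (k + η + ξ + 1)
    ((1 - (e * x / y) ^ 2) / (1 - (-(g * e / y)) ^ 2))
  have hp := poch_succ (ξ + 1 / 2) k
  have hp' := poch_succ_left (ξ + 1 / 2) k
  have p1 := (poch_pos hb₁ k).ne'
  have p2 := (poch_pos hb₁' k).ne'
  have p3 : (k.factorial : ℝ) ≠ 0 := by positivity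
  rw [sum_chiharaHat_odd he, lagConv_eq hb₁ hb₂' a1 a2, lagConv_eq hb₁' hb₂ a1 a2,
    bigJacobi_odd, hJ, show (k : ℝ) + (ξ + 1 / 2) + (η + 3 / 2) - 1 = k + η + ξ + 1 by ring,
    show (k : ℝ) + (ξ + 3 / 2) + (η + 1 / 2) - 1 = k + η + ξ + 1 by ring]
  rw [show η + 1 / 2 + 1 = η + 3 / 2 by ring] at hc
  rw [show ξ + 1 / 2 + 1 = ξ + 3 / 2 by ring, hp] at hp'
  have p4 : ξ + 1 / 2 + (k : ℝ) ≠ 0 := by positivity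
  have hP : poch (ξ + 3 / 2) k = poch (ξ + 1 / 2) k * (ξ + 1 / 2 + k) / (ξ + 1 / 2) := by
    rw [hp']; field_simp
  rw [hp, hP]
  generalize (1 - (e * x / y) ^ 2) / (1 - (-(g * e / y)) ^ 2) = Z at *
  generalize hypPoly k _ (η + 1 / 2) _ = A at *
  generalize hypPoly k (k + η + ξ + 1 + 1) _ _ = B at *
  generalize hypPoly k _ _ _ = D at *
  generalize poch (ξ + 1 / 2) k = P at *
  generalize (-((y - g * e) * (y + g * e) / 2 / 2)) ^ k = W
  rw [show (k : ℝ) + η + ξ + 1 = (ξ + 1 / 2 + k) + (η + 1 / 2) by ring] at hc ⊢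
  rw [show 2 * ξ + 1 = 2 * (ξ + 1 / 2) by ring, show 2 * η + 1 = 2 * (η + 1 / 2) by ring]
  generalize ξ + 1 / 2 + (k : ℝ) = s at *
  generalize η + 1 / 2 = b₂ at *
  generalize ξ + 1 / 2 = b₁ at *
  have h₁' : y - e * g ≠ 0 := by rwa [mul_comm]
  rw [mul_comm g e]
  field_simp
  linear_combination (W * (y - e * x)) * hc

end Osp12

namespace Osp12

/-! ### The coupling of two Chihara polynomials -/

section

variable {ξ η : ℝ}

/-- The Gamma quotient under the root of `kFactor` is a perfect square times `couplingConst`. Thus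
`kFactor` contains the same irrational factor as the Clebsch-Gordan coefficients. -/
lemma gamma_const_even (hξ : 0 < ξ) (hη : 0 < η) (k : ℕ) :
    Real.Gamma (ξ + 1 / 2) * Real.Gamma (η + 1 / 2)
        / (Real.Gamma (ξ + η + (2 * k : ℕ) + 1 / 2 + 1 / 2) * bigJacobiNorm (2 * k) (2 * η) (2 * ξ))
      = couplingConst η ξ (2 * k)
        * (muFactorial (2 * k) η / (2 ^ k * k.factorial * poch (ξ + 1 / 2) k)) ^ 2 := by
  have hb₁ : 0 < ξ + 1 / 2 := by linarith
  have hb₂ : 0 < η + 1 / 2 := by linarith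
  have hs : 0 < η + ξ + 1 + k := by positivity
  simp only [bigJacobiNorm, even_two_mul, if_true, Nat.mul_div_cancel_left _ (Nat.succ_pos 1)]
  rw [couplingConst_even, muFactorial_even]
  push_cast
  rw [show ξ + η + 2 * (k : ℝ) + 1 / 2 + 1 / 2 = η + ξ + 1 + k + k by ring,
    show (2 * (k : ℝ) + 2 * ξ + 1) / 2 = ξ + 1 / 2 + k by ring,
    show (2 * (k : ℝ) + 2 * η + 3) / 2 = η + 1 / 2 + (k + 1 : ℕ) by push_cast; ring,
    show (2 * (k : ℝ) + 2 * η + 2 * ξ + 2) / 2 = η + ξ + 1 + k by ring,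
    show (2 * η + 1) / 2 = η + 1 / 2 by ring, poch_gamma hs, poch_gamma hb₁, poch_gamma hb₂,
    poch_succ, show 2 * (k : ℝ) + 2 * η + 1 = 2 * (η + 1 / 2 + k) by ring]
  have g1 := Real.Gamma_pos_of_pos hb₁
  have g2 := Real.Gamma_pos_of_pos hb₂
  have g3 := Real.Gamma_pos_of_pos hs
  have p1 := poch_pos hb₁ k
  have p2 := poch_pos hb₂ k
  have p3 := poch_pos hs k
  have p4 : 0 < η + 1 / 2 + k := by positivity
  have e4 : (4 : ℝ) ^ k = 2 ^ k * 2 ^ k := by rw [← mul_pow]; norm_num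
  have : (k.factorial : ℝ) ≠ 0 := by positivity
  rw [e4]
  generalize Real.Gamma (ξ + 1 / 2) = G1 at *
  generalize Real.Gamma (η + 1 / 2) = G2 at *
  generalize Real.Gamma (η + ξ + 1 + k) = G3 at *
  generalize poch (ξ + 1 / 2) k = A at *
  generalize poch (η + 1 / 2) k = B at *
  generalize poch (η + ξ + 1 + k) k = D at *
  generalize η + 1 / 2 + (k : ℝ) = t at *
  field_simp

/-- The extra 2 compensates for the factor 1/2 left over from the odd power of (x² - c²)/2 in
`kFactor`. -/
lemma gamma_const_odd (hξ : 0 < ξ) (hη : 0 < η) (k : ℕ) :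
    Real.Gamma (ξ + 1 / 2) * Real.Gamma (η + 1 / 2)
        / (Real.Gamma (ξ + η + (2 * k + 1 : ℕ) + 1 / 2 + 1 / 2)
          * bigJacobiNorm (2 * k + 1) (2 * η) (2 * ξ))
      = 2 * couplingConst η ξ (2 * k + 1)
        * (muFactorial (2 * k + 1) η / (2 * 2 ^ k * k.factorial * poch (ξ + 1 / 2) (k + 1))) ^ 2 := by
  have hb₁ : 0 < ξ + 1 / 2 := by linarith
  have hb₂ : 0 < η + 1 / 2 := by linarith
  have hs : 0 < η + ξ + 1 + k := by positivity
  have h1 : ¬ Even (2 * k + 1) := by simp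
  have h2 : (2 * k + 1) / 2 = k := by omega
  simp only [bigJacobiNorm, h1, if_false, h2]
  rw [couplingConst_odd, muFactorial_odd]
  have g3' : Real.Gamma (η + ξ + 1 + k + 1) = (η + ξ + 1 + k) * Real.Gamma (η + ξ + 1 + k) :=
    Real.Gamma_add_one hs.ne'
  push_cast
  rw [show ξ + η + (2 * (k : ℝ) + 1) + 1 / 2 + 1 / 2 = η + ξ + 1 + k + (k + 1 : ℕ) by push_cast; ring,
    show (2 * (k : ℝ) + 1 + 2 * ξ + 2) / 2 = ξ + 1 / 2 + (k + 1 : ℕ) by push_cast; ring,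
    show (2 * (k : ℝ) + 1 + 2 * η + 2) / 2 = η + 1 / 2 + (k + 1 : ℕ) by push_cast; ring,
    show (2 * (k : ℝ) + 1 + 2 * η + 2 * ξ + 3) / 2 = η + ξ + 1 + k + 1 by ring,
    show 2 * (k : ℝ) + 1 + 2 * η + 2 * ξ + 1 = 2 * (η + ξ + 1 + k) by ring,
    show (2 * η + 1) / 2 = η + 1 / 2 by ring, poch_gamma hs, poch_gamma hb₁, poch_gamma hb₂, g3']
  have g1 := Real.Gamma_pos_of_pos hb₁
  have g2 := Real.Gamma_pos_of_pos hb₂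
  have g3 := Real.Gamma_pos_of_pos hs
  have p1 := poch_pos hb₁ (k + 1)
  have p2 := poch_pos hb₂ (k + 1)
  have p3 := poch_pos hs (k + 1)
  have e4 : (4 : ℝ) ^ k = 2 ^ k * 2 ^ k := by rw [← mul_pow]; norm_num
  have : (k.factorial : ℝ) ≠ 0 := by positivity
  rw [e4]
  generalize Real.Gamma (ξ + 1 / 2) = G1 at *
  generalize Real.Gamma (η + 1 / 2) = G2 at *
  generalize Real.Gamma (η + ξ + 1 + k) = G3 at *
  generalize poch (ξ + 1 / 2) (k + 1) = A at *
  generalize poch (η + 1 / 2) (k + 1) = B at *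
  generalize poch (η + ξ + 1 + k) (k + 1) = D at *
  generalize η + ξ + 1 + (k : ℝ) = t at *
  field_simp

end

lemma eps_mul_self (r : DiscreteSeries) : r.eps * r.eps = 1 := by
  rcases r.eps_eq with h | h <;> simp [h]

/-! ### The prefactor K and the two-fold coupling identity -/

variable (r₁ r₂ : DiscreteSeries)

lemma arguments_pos {c y : ℝ} (h : |c| < |y|) :
    y ≠ 0 ∧ 0 < (y - c * r₁.eps * r₂.eps) * (y + c * r₁.eps * r₂.eps) := by
  refine ⟨fun hy => ?_, ?_⟩
  · rw [hy, abs_zero] at h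
    exact absurd h (abs_nonneg c).not_gt
  · have h' := sq_lt_sq.2 h
    have e₁ := eps_mul_self r₁
    have e₂ := eps_mul_self r₂
    have : (y - c * r₁.eps * r₂.eps) * (y + c * r₁.eps * r₂.eps) = y ^ 2 - c ^ 2 := by
      linear_combination (-c ^ 2 * (r₂.eps * r₂.eps)) * e₁ - c ^ 2 * e₂
    rw [this]
    linarith

lemma kFactor_even {c y : ℝ} (h : |c| < |y|) (k : ℕ) :
    kFactor r₁ r₂ (2 * k) y c
      = √(couplingConst r₂.mu r₁.mu (2 * k)) * muFactorial (2 * k) r₂.mu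
        * ((y - c * r₁.eps * r₂.eps) * (y + c * r₁.eps * r₂.eps) / 2 / 2) ^ k
        / (k.factorial * poch (r₁.mu + 1 / 2) k) := by
  obtain ⟨hy, hQ⟩ := arguments_pos r₁ r₂ h
  have h₁ : y - c * r₁.eps * r₂.eps ≠ 0 := left_ne_zero_of_mul hQ.ne'
  have e₁ := eps_mul_self r₁
  have e₂ := eps_mul_self r₂
  have hQc : (y ^ 2 - c ^ 2) / 2 = (y - c * r₁.eps * r₂.eps) * (y + c * r₁.eps * r₂.eps) / 2 := by
    linear_combination (c ^ 2 * (r₂.eps * r₂.eps)) / 2 * e₁ + c ^ 2 / 2 * e₂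
  have hs : Real.sign y ^ (2 * k) = 1 := by
    rcases Real.sign_apply_eq_of_ne_zero y hy with h | h <;> rw [h, pow_mul] <;> norm_num
  have hp := poch_pos (by linarith [r₁.mu_pos] : 0 < r₁.mu + 1 / 2) k
  have hm := muFactorial_pos (2 * k) r₂.mu_pos
  have hβ := couplingConst_pos r₂.mu_pos r₁.mu_pos (2 * k)
  rw [kFactor, couple, gamma_const_even r₁.mu_pos r₂.mu_pos, hs, Even.neg_one_pow (even_two_mul k),
    one_mul, one_mul, div_self h₁, mul_one, hQc, mul_comm 2 k, pow_mul, mul_comm k 2]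
  generalize (y - c * r₁.eps * r₂.eps) * (y + c * r₁.eps * r₂.eps) = Q at *
  have : ((Q / 2) ^ k) ^ 2 * (couplingConst r₂.mu r₁.mu (2 * k) * (muFactorial (2 * k) r₂.mu
      / (2 ^ k * k.factorial * poch (r₁.mu + 1 / 2) k)) ^ 2)
      = couplingConst r₂.mu r₁.mu (2 * k) * ((Q / 2) ^ k * (muFactorial (2 * k) r₂.mu
      / (2 ^ k * k.factorial * poch (r₁.mu + 1 / 2) k))) ^ 2 := by ring
  rw [this, Real.sqrt_mul hβ.le, Real.sqrt_sq (by positivity), div_pow (Q / 2) 2]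
  field_simp

lemma kFactor_odd {c y : ℝ} (h : |c| < |y|) (k : ℕ) :
    kFactor r₁ r₂ (2 * k + 1) y c
      = √(couplingConst r₂.mu r₁.mu (2 * k + 1)) * muFactorial (2 * k + 1) r₂.mu
        * (y - c * r₁.eps * r₂.eps)
        * ((y - c * r₁.eps * r₂.eps) * (y + c * r₁.eps * r₂.eps) / 2 / 2) ^ k
        / (2 * k.factorial * poch (r₁.mu + 1 / 2) (k + 1)) := by
  obtain ⟨hy, hQ⟩ := arguments_pos r₁ r₂ h
  have h₁ : y - c * r₁.eps * r₂.eps ≠ 0 := left_ne_zero_of_mul hQ.ne'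
  have h₂ : y + c * r₁.eps * r₂.eps ≠ 0 := right_ne_zero_of_mul hQ.ne'
  have e₁ := eps_mul_self r₁
  have e₂ := eps_mul_self r₂
  have hQc : (y ^ 2 - c ^ 2) / 2 = (y - c * r₁.eps * r₂.eps) * (y + c * r₁.eps * r₂.eps) / 2 := by
    linear_combination (c ^ 2 * (r₂.eps * r₂.eps)) / 2 * e₁ + c ^ 2 / 2 * e₂
  -- Since |y| > |c|, the difference y - c ε₁ ε₂ has the sign of y. The sign in `kFactor` therefore
  -- undoes the absolute value produced by the square root.
  have hs : Real.sign y ^ (2 * k + 1) * |y - c * r₁.eps * r₂.eps| = y - c * r₁.eps * r₂.eps := by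
    have ha : |c * r₁.eps * r₂.eps| = |c| := by rw [abs_eps, abs_eps]
    rw [← ha] at h
    rcases lt_or_gt_of_ne hy with hn | hn
    · rw [Real.sign_of_neg hn, Odd.neg_one_pow ⟨k, rfl⟩, abs_of_neg, neg_one_mul, neg_neg]
      rw [abs_of_neg hn] at h
      linarith [neg_abs_le (c * r₁.eps * r₂.eps)]
    · rw [Real.sign_of_pos hn, one_pow, one_mul, abs_of_pos]
      rw [abs_of_pos hn] at h
      linarith [le_abs_self (c * r₁.eps * r₂.eps)]
  have hp := poch_pos (by linarith [r₁.mu_pos] : 0 < r₁.mu + 1 / 2) (k + 1)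
  have hm := muFactorial_pos (2 * k + 1) r₂.mu_pos
  have hβ := couplingConst_pos r₂.mu_pos r₁.mu_pos (2 * k + 1)
  rw [kFactor, couple, gamma_const_odd r₁.mu_pos r₂.mu_pos, Odd.neg_one_pow ⟨k, rfl⟩, hQc,
    show y - -1 * c * r₁.eps * r₂.eps = y + c * r₁.eps * r₂.eps by ring]
  have : ((y - c * r₁.eps * r₂.eps) * (y + c * r₁.eps * r₂.eps) / 2) ^ (2 * k + 1)
        * ((y - c * r₁.eps * r₂.eps) / (y + c * r₁.eps * r₂.eps))
        * (2 * couplingConst r₂.mu r₁.mu (2 * k + 1) * (muFactorial (2 * k + 1) r₂.mu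
          / (2 * 2 ^ k * k.factorial * poch (r₁.mu + 1 / 2) (k + 1))) ^ 2)
      = couplingConst r₂.mu r₁.mu (2 * k + 1) * (|y - c * r₁.eps * r₂.eps|
        * (((y - c * r₁.eps * r₂.eps) * (y + c * r₁.eps * r₂.eps) / 2) ^ k
          * (muFactorial (2 * k + 1) r₂.mu
            / (2 * 2 ^ k * k.factorial * poch (r₁.mu + 1 / 2) (k + 1))))) ^ 2 := by
    rw [mul_pow |y - c * r₁.eps * r₂.eps|, sq_abs, pow_succ _ (2 * k), mul_comm 2 k, pow_mul,
      mul_comm k 2]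
    generalize couplingConst r₂.mu r₁.mu (2 * k + 1) = β
    generalize muFactorial (2 * k + 1) r₂.mu
      / (2 * 2 ^ k * k.factorial * poch (r₁.mu + 1 / 2) (k + 1)) = m
    generalize ((y - c * r₁.eps * r₂.eps) * (y + c * r₁.eps * r₂.eps) / 2) ^ k = W
    generalize y - c * r₁.eps * r₂.eps = u at *
    generalize y + c * r₁.eps * r₂.eps = v at *
    field_simp
  have hQ' : 0 ≤ ((y - c * r₁.eps * r₂.eps) * (y + c * r₁.eps * r₂.eps) / 2) ^ k := by positivity
  rw [this, Real.sqrt_mul hβ.le, Real.sqrt_sq (by positivity), mul_left_comm, ← mul_assoc (_ ^ _) |_|,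
    hs, div_pow ((y - c * r₁.eps * r₂.eps) * (y + c * r₁.eps * r₂.eps) / 2) 2 k]
  generalize (y - c * r₁.eps * r₂.eps) * (y + c * r₁.eps * r₂.eps) / 2 = Q
  field_simp

/-- The sign (-1)^(j(j+1)/2) is (-1)^k for j = 2k and (-1)^(k+1) for j = 2k + 1. It absorbs the k-th
power of a negated quantity in the lowest weight sum and, for odd j, the minus sign in front. -/
lemma tensorSum_lowest_eq {c y : ℝ} (x : ℝ) (h : |c| < |y|) (j : ℕ) :
    (-1) ^ (j * (j + 1) / 2) * √(couplingConst r₂.mu r₁.mu j)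
        * tensorSum (chiharaMonic · x r₁.mu (c * r₁.eps)) (chiharaMonic · y r₂.mu (r₂.eps * x)) j
          (lowestCoeff r₁.mu r₂.mu r₂.eps j)
      = kFactor r₁ r₂ j y c * bigJacobi j (r₂.eps * x / y) (2 * r₂.mu) (2 * r₁.mu)
          (-(c * r₁.eps * r₂.eps / y)) := by
  obtain ⟨hy, hQ⟩ := arguments_pos r₁ r₂ h
  have h₁ : y - c * r₁.eps * r₂.eps ≠ 0 := left_ne_zero_of_mul hQ.ne'
  have h₂ : y + c * r₁.eps * r₂.eps ≠ 0 := right_ne_zero_of_mul hQ.ne'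
  have e₂ := eps_mul_self r₂
  rw [tensorSum_lowestCoeff r₁.mu_pos r₂.mu_pos]
  rcases Nat.even_or_odd' j with ⟨k, rfl | rfl⟩
  · rw [sum_chiharaHat_even_eq r₁.mu_pos r₂.mu_pos e₂ hy h₁ h₂, kFactor_even r₁ r₂ h,
      show 2 * k * (2 * k + 1) / 2 = 2 * (k * k) + k by
        rw [show 2 * k * (2 * k + 1) = (2 * (k * k) + k) * 2 by ring, Nat.mul_div_cancel _ two_pos],
      pow_add, Even.neg_one_pow (even_two_mul _), neg_pow (_ / 2 : ℝ)]
    have hs := neg_one_pow_mul_self k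
    linear_combination (√(couplingConst r₂.mu r₁.mu (2 * k)) * muFactorial (2 * k) r₂.mu
        * ((y - c * r₁.eps * r₂.eps) * (y + c * r₁.eps * r₂.eps) / 2 / 2) ^ k
        / (k.factorial * poch (r₁.mu + 1 / 2) k) * bigJacobi (2 * k) (r₂.eps * x / y) (2 * r₂.mu)
          (2 * r₁.mu) (-(c * r₁.eps * r₂.eps / y))) * hs
  · rw [sum_chiharaHat_odd_eq r₁.mu_pos r₂.mu_pos e₂ hy h₁ h₂, kFactor_odd r₁ r₂ h,
      show (2 * k + 1) * (2 * k + 1 + 1) / 2 = 2 * (k * k + k) + k + 1 by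
        rw [show (2 * k + 1) * (2 * k + 1 + 1) = (2 * (k * k + k) + k + 1) * 2 by ring,
          Nat.mul_div_cancel _ two_pos],
      pow_succ, pow_add, Even.neg_one_pow (even_two_mul _), neg_pow (_ / 2 : ℝ)]
    have hs := neg_one_pow_mul_self k
    linear_combination (√(couplingConst r₂.mu r₁.mu (2 * k + 1)) * muFactorial (2 * k + 1) r₂.mu
        * (y - c * r₁.eps * r₂.eps)
        * ((y - c * r₁.eps * r₂.eps) * (y + c * r₁.eps * r₂.eps) / 2 / 2) ^ k
        / (2 * k.factorial * poch (r₁.mu + 1 / 2) (k + 1))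
        * bigJacobi (2 * k + 1) (r₂.eps * x / y) (2 * r₂.mu)
          (2 * r₁.mu) (-(c * r₁.eps * r₂.eps / y))) * hs

/-- Passing to monic polynomials multiplies by the roots of [n]! and [m]!, which are matched by the
factorials under the root of the Clebsch-Gordan coefficient. By `couplingConst_eq` the remaining
prefactor depends only on j and N, so it can be taken out of the sum over n + m. -/
lemma clebschGordan_mul_chihara (x y c : ℝ) (j N n m : ℕ) (hnm : n + m = j + N) :
    clebschGordan r₁ r₂ n m j * (chihara n x r₁.mu (c * r₁.eps) * chihara m y r₂.mu (x * r₂.eps))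
      = (-1) ^ (j * (j + 1) / 2)
        * √(couplingConst r₂.mu r₁.mu j / muFactorial N (r₁.mu + r₂.mu + j + 1 / 2))
        * (coupledCoeff r₁.mu r₂.mu r₂.eps j N n * chiharaMonic n x r₁.mu (c * r₁.eps)
          * chiharaMonic m y r₂.mu (r₂.eps * x)) := by
  have hμ : 0 < r₁.mu + r₂.mu + j + 1 / 2 := by
    have := r₁.mu_pos; have := r₂.mu_pos; positivity
  have hn := muFactorial_pos n r₁.mu_pos
  have hm := muFactorial_pos m r₂.mu_pos
  have hM := muFactorial_pos N hμ
  have hw := couplingConst_eq r₂.mu_pos r₁.mu_pos j N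
  rw [clebschGordan, hnm, chihara_eq n x r₁.mu_pos, chihara_eq m y r₂.mu_pos,
    coupledCoeff_eq_dualHahn r₂.mu_pos r₁.mu_pos (eps_mul_self r₂) j N n (by omega), chiharaMonic,
    chiharaMonic, mul_comm x]
  have e1 : muFactorial m r₂.mu * dualHahnRho j r₂.mu r₁.mu (j + N)
      / (muFactorial n r₁.mu * muFactorial (j + N) r₂.mu * dualHahnNormZero r₂.mu r₁.mu (j + N))
      = muFactorial m r₂.mu * (couplingConst r₂.mu r₁.mu j
        / muFactorial N (r₁.mu + r₂.mu + j + 1 / 2)) / muFactorial n r₁.mu := by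
    rw [← hw]
    generalize muFactorial N (r₁.mu + r₂.mu + j + 1 / 2) = F at *
    field_simp
  have hβ := couplingConst_pos r₂.mu_pos r₁.mu_pos j
  rw [e1, Real.sqrt_div' _ hn.le, Real.sqrt_mul hm.le, pow_add, pow_add, pow_add]
  have s1 := Real.mul_self_sqrt hm.le
  have s2 : √(muFactorial n r₁.mu) ≠ 0 := (Real.sqrt_pos.2 hn).ne'
  generalize √(couplingConst r₂.mu r₁.mu j / muFactorial N (r₁.mu + r₂.mu + j + 1 / 2)) = w
  generalize dualHahn _ _ _ _ _ = R
  generalize chiharaHat n x r₁.mu (c * r₁.eps) = P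
  generalize chiharaHat m y r₂.mu (r₂.eps * x) = P'
  generalize √(muFactorial m r₂.mu) = u at *
  rw [← s1]
  field_simp

/-- Coupling two Chihara polynomials gives a Big -1 Jacobi polynomial times a Chihara
polynomial. -/
theorem sum_clebschGordan {c y : ℝ} (x : ℝ) (h : |c| < |y|) (j N : ℕ) :
    ∑ q ∈ Finset.HasAntidiagonal.antidiagonal (N + j), clebschGordan r₁ r₂ q.1 q.2 j
        * (chihara q.1 x r₁.mu (c * r₁.eps) * chihara q.2 y r₂.mu (x * r₂.eps))
      = kFactor r₁ r₂ j y c * bigJacobi j (r₂.eps * x / y) (2 * r₂.mu) (2 * r₁.mu)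
          (-(c * r₁.eps * r₂.eps / y))
        * chihara N y (couple r₁ r₂ j).mu (c * (couple r₁ r₂ j).eps) := by
  have hμ := (couple r₁ r₂ j).mu_pos
  have hM := muFactorial_pos N hμ
  rw [← tensorSum_lowest_eq r₁ r₂ x h, chihara_eq N y hμ, add_comm N j,
    Finset.sum_congr rfl fun q hq => clebschGordan_mul_chihara r₁ r₂ x y c j N q.1 q.2
      (Finset.HasAntidiagonal.mem_antidiagonal.1 hq), ← Finset.mul_sum,
    Finset.Nat.sum_antidiagonal_eq_sum_range_succ_mk]
  have ht := tensorSum_coupledCoeff r₁.mu_pos r₂.mu_pos (eps_mul_self r₂) (c * r₁.eps) x y j N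
  rw [tensorSum] at ht
  simp only at ht ⊢
  rw [ht, chiharaMonic,
    show r₁.mu + r₂.mu + j + 1 / 2 = (couple r₁ r₂ j).mu from rfl, Real.sqrt_div' _ hM.le]
  have e : r₂.eps * (c * r₁.eps) * (-1) ^ j = c * (couple r₁ r₂ j).eps := by
    simp only [couple]; ring
  have s1 := Real.mul_self_sqrt hM.le
  have s2 : √(muFactorial N (couple r₁ r₂ j).mu) ≠ 0 := (Real.sqrt_pos.2 hM).ne'
  rw [e]
  generalize √(muFactorial N (couple r₁ r₂ j).mu) = u at *
  rw [← s1]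
  field_simp

/-! ### The three-fold tensor product -/

variable (r₃ : DiscreteSeries) (c : ℝ)

/-- The coupling identity needs the strict inequalities between the absolute values of the
coordinates, which hold almost everywhere for the weighted measure. -/
lemma ae_mem_region : ∀ᵐ x ∂tripleMeasure r₁ r₂ r₃ c, x ∈ region c :=
  (withDensity_absolutelyContinuous _ _).ae_le (ae_restrict_mem (measurableSet_region c))

variable {r₁ r₂ r₃ c} in
lemma theta_sum {ι : Type*} (s : Finset ι) (v : ι → TripleSpace) (F : ι → ℝ × ℝ × ℝ → ℝ)
    (h : ∀ i ∈ s, theta r₁ r₂ r₃ c (v i) =ᵐ[tripleMeasure r₁ r₂ r₃ c] fun x => (F i x : ℂ)) :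
    theta r₁ r₂ r₃ c (∑ i ∈ s, v i) =ᵐ[tripleMeasure r₁ r₂ r₃ c]
      fun x => ((∑ i ∈ s, F i x : ℝ) : ℂ) := by
  classical
  induction s using Finset.induction_on with
  | empty =>
    simp only [Finset.sum_empty, map_zero, Complex.ofReal_zero]
    exact Lp.coeFn_zero _ _ _
  | insert i s hi ih =>
    rw [Finset.sum_insert hi, map_add]
    filter_upwards [Lp.coeFn_add (theta r₁ r₂ r₃ c (v i)) (theta r₁ r₂ r₃ c (∑ i ∈ s, v i)),
      h i (Finset.mem_insert_self i s), ih fun k hk => h k (Finset.mem_insert_of_mem hk)]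
      with x h1 h2 h3
    rw [h1, Pi.add_apply, h2, h3, Finset.sum_insert hi, Complex.ofReal_add]

lemma theta_smul_basisVec (a : ℝ) (n₁ n₂ n₃ : ℕ) :
    theta r₁ r₂ r₃ c ((a : ℂ) • basisVec n₁ n₂ n₃) =ᵐ[tripleMeasure r₁ r₂ r₃ c]
      fun x => ((a * triplePoly r₁ r₂ r₃ c (n₁, n₂, n₃) x : ℝ) : ℂ) := by
  rw [map_smul]
  filter_upwards [Lp.coeFn_smul (a : ℂ) (theta r₁ r₂ r₃ c (basisVec n₁ n₂ n₃)),
    theta_basisVec r₁ r₂ r₃ c n₁ n₂ n₃] with x h1 h2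
  rw [h1, Pi.smul_apply, h2, smul_eq_mul, Complex.ofReal_mul]

/-- The two shifts by 1/2 add up to 1 and the signs multiply to (-1)^(j + j₁₂), so only the total j
survives in the labels. -/
lemma couple_couple_left (j₁₂ j : ℕ) :
    couple (couple r₁ r₂ j₁₂) r₃ j = triple r₁ r₂ r₃ (j + j₁₂) := by
  simp only [couple, triple, DiscreteSeries.mk.injEq]
  refine ⟨by push_cast; ring, by ring⟩

lemma couple_couple_right (j₂₃ j : ℕ) :
    couple r₁ (couple r₂ r₃ j₂₃) j = triple r₁ r₂ r₃ (j + j₂₃) := by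
  simp only [couple, triple, DiscreteSeries.mk.injEq]
  refine ⟨by push_cast; ring, by ring⟩

end Osp12

theorem proposition6 (r₁ r₂ r₃ : DiscreteSeries) (c : ℝ) (n₁₂₃ j₁₂₃ : ℕ) :
    (∀ j₁₂ j₁₂_₃ : ℕ, j₁₂₃ = j₁₂_₃ + j₁₂ →
      theta r₁ r₂ r₃ c (fVec r₁ r₂ r₃ n₁₂₃ j₁₂₃ j₁₂) =ᵐ[tripleMeasure r₁ r₂ r₃ c]
        fun x : ℝ × ℝ × ℝ =>
          ((kFactor r₁ r₂ j₁₂ x.2.1 c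
            * bigJacobi j₁₂ (r₂.eps * x.1 / x.2.1) (2 * r₂.mu) (2 * r₁.mu)
                (-(c * r₁.eps * r₂.eps / x.2.1))
            * kFactor (couple r₁ r₂ j₁₂) r₃ j₁₂_₃ x.2.2 c
            * bigJacobi j₁₂_₃ (r₃.eps * x.2.1 / x.2.2) (2 * r₃.mu) (2 * (couple r₁ r₂ j₁₂).mu)
                (-(c * (couple r₁ r₂ j₁₂).eps * r₃.eps / x.2.2))
            * chihara n₁₂₃ x.2.2 (triple r₁ r₂ r₃ j₁₂₃).mu
                (c * (triple r₁ r₂ r₃ j₁₂₃).eps) : ℝ) : ℂ)) ∧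
    (∀ j₂₃ j₁_₂₃ : ℕ, j₁₂₃ = j₁_₂₃ + j₂₃ →
      theta r₁ r₂ r₃ c (gVec r₁ r₂ r₃ n₁₂₃ j₁₂₃ j₂₃) =ᵐ[tripleMeasure r₁ r₂ r₃ c]
        fun x : ℝ × ℝ × ℝ =>
          ((kFactor r₂ r₃ j₂₃ x.2.2 x.1
            * bigJacobi j₂₃ (r₃.eps * x.2.1 / x.2.2) (2 * r₃.mu) (2 * r₂.mu)
                (-(x.1 * r₂.eps * r₃.eps / x.2.2))
            * kFactor r₁ (couple r₂ r₃ j₂₃) j₁_₂₃ x.2.2 c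
            * bigJacobi j₁_₂₃ ((couple r₂ r₃ j₂₃).eps * x.1 / x.2.2)
                (2 * (couple r₂ r₃ j₂₃).mu) (2 * r₁.mu)
                (-(c * r₁.eps * (couple r₂ r₃ j₂₃).eps / x.2.2))
            * chihara n₁₂₃ x.2.2 (triple r₁ r₂ r₃ j₁₂₃).mu
                (c * (triple r₁ r₂ r₃ j₁₂₃).eps) : ℝ) : ℂ)) := by
  constructor
  · rintro j₁₂ j rfl
    rw [fVec, Nat.add_sub_cancel]
    have hT := theta_sum _ _ _ fun p (_ : p ∈ Finset.HasAntidiagonal.antidiagonal (n₁₂₃ + j)) =>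
      theta_sum (Finset.HasAntidiagonal.antidiagonal (p.1 + j₁₂)) _ _ fun q _ =>
        theta_smul_basisVec r₁ r₂ r₃ c (clebschGordan (couple r₁ r₂ j₁₂) r₃ p.1 p.2 j
          * clebschGordan r₁ r₂ q.1 q.2 j₁₂) q.1 q.2 p.2
    filter_upwards [hT, ae_mem_region r₁ r₂ r₃ c] with x hx hr
    obtain ⟨hr₁, hr₂, hr₃⟩ := hr
    rw [hx, ← couple_couple_left]
    congr 1
    -- The outer coupling is read backwards: the right side becomes a sum over p whose first Chihara
    -- factor, in x₂, is exactly what the inner coupling produces for that p.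
    rw [mul_assoc _ (kFactor _ _ _ _ _), mul_assoc,
      ← sum_clebschGordan (couple r₁ r₂ j₁₂) r₃ x.2.1 ((hr₁.trans hr₂).trans hr₃), Finset.mul_sum]
    refine Finset.sum_congr rfl fun p _ => ?_
    have hi := sum_clebschGordan r₁ r₂ x.1 (hr₁.trans hr₂) j₁₂ p.1
    calc _ = clebschGordan (couple r₁ r₂ j₁₂) r₃ p.1 p.2 j
          * chihara p.2 x.2.2 r₃.mu (x.2.1 * r₃.eps)
          * ∑ q ∈ Finset.HasAntidiagonal.antidiagonal (p.1 + j₁₂), clebschGordan r₁ r₂ q.1 q.2 j₁₂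
            * (chihara q.1 x.1 r₁.mu (c * r₁.eps) * chihara q.2 x.2.1 r₂.mu (x.1 * r₂.eps)) := by
          rw [Finset.mul_sum]
          refine Finset.sum_congr rfl fun q _ => ?_
          simp only [triplePoly]
          ring
      _ = _ := by rw [hi]; ring
  · rintro j₂₃ j rfl
    rw [gVec, Nat.add_sub_cancel]
    have hT := theta_sum _ _ _ fun p (_ : p ∈ Finset.HasAntidiagonal.antidiagonal (n₁₂₃ + j)) =>
      theta_sum (Finset.HasAntidiagonal.antidiagonal (p.2 + j₂₃)) _ _ fun q _ =>
        theta_smul_basisVec r₁ r₂ r₃ c (clebschGordan r₁ (couple r₂ r₃ j₂₃) p.1 p.2 j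
          * clebschGordan r₂ r₃ q.1 q.2 j₂₃) p.1 q.1 q.2
    filter_upwards [hT, ae_mem_region r₁ r₂ r₃ c] with x hx hr
    obtain ⟨hr₁, hr₂, hr₃⟩ := hr
    rw [hx, ← couple_couple_right]
    congr 1
    rw [mul_assoc _ (kFactor _ _ _ _ _), mul_assoc,
      ← sum_clebschGordan r₁ (couple r₂ r₃ j₂₃) x.1 ((hr₁.trans hr₂).trans hr₃), Finset.mul_sum]
    refine Finset.sum_congr rfl fun p _ => ?_
    -- Here x₁ plays the part of the parameter c, which is legitimate because |x₁| < |x₃| on the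
    -- region.
    have hi := sum_clebschGordan r₂ r₃ x.2.1 (hr₂.trans hr₃) j₂₃ p.2
    calc _ = clebschGordan r₁ (couple r₂ r₃ j₂₃) p.1 p.2 j
          * chihara p.1 x.1 r₁.mu (c * r₁.eps)
          * ∑ q ∈ Finset.HasAntidiagonal.antidiagonal (p.2 + j₂₃), clebschGordan r₂ r₃ q.1 q.2 j₂₃
            * (chihara q.1 x.2.1 r₂.mu (x.1 * r₂.eps)
              * chihara q.2 x.2.2 r₃.mu (x.2.1 * r₃.eps)) := by
          rw [Finset.mul_sum]
          refine Finset.sum_congr rfl fun q _ => ?_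
          simp only [triplePoly]
          ring
      _ = _ := by rw [hi]; ring
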